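/- There is a single (deterministic) algorithm with the following property. Its input consists of a simple undirected graph $G$ on $n$ vertices and a multi-$k$-expression $\varphi$ of $G$, where $k\le n$; it decides whether $G$ has a Hamiltonian cycle, i.e. a cycle that visits every vertex of $G$ exactly once, and it runs in time $n^{O(k)}\cdot|\varphi|^{O(1)}$, where $|\varphi|$ is the number of operations in $\varphi$ and the constants hidden in the $O$-notation are absolute. In particular, the running time is $n^{O(k)}$ whenever $|\varphi|$ is polynomial in $n$. Here a multi-$k$-labeled graph is a graph $H$ with a map $\mathrm{lab}$ that assigns to each vertex of $H$ a subset of $[k]=\{1,\dots,k\}$. A multi-$k$-expression of $G$ is a well-formed term over the following four operations whose value is $G$ (with some labeling): 1. introduce: create a single vertex $v$ with a non-empty label set $S\subseteq[k]$; 2. union: the disjoint union of two vertex-disjoint multi-$k$-labeled graphs, label sets being preserved; 3. join $\eta_{i,j}$ for labels $i\ne j$, applicable only if no vertex holds both $i$ and $j$: add all edges $uv$ with $i\in\mathrm{lab}(u)$ and $j\in\mathrm{lab}(v)$, label sets being preserved; 4. relabel $\rho_{i\to S}$ for a label $i$ and a set $S\subseteq[k]$: replace $\mathrm{lab}(v)$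 by $(\mathrm{lab}(v)\setminus\{i\})\cup S$ for every vertex $v$ with $i\in\mathrm{lab}(v)$. -/

import Mathlib

/-!
## Computation model

The WHILE language over binary trees ("pure Lisp" data), with the usual time measure. The values
are binary trees, a program is one fixed piece of code with finitely many tree variables, and the
only primitive operations are: read a variable, the constant `nil`, `cons`, head, tail, and a test
whether a tree is `nil`. Every one of them costs one unit of time. With trees stored as pointers,
every unit of time is a constant number of operations of a pointer machine or RAM, and the time
agrees with Turing machine time up to a polynomial.
-/

namespace WhileLang

/-- Data values: binary trees. -/
inductive BTree : Type
  | nil : BTree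
  | cons : BTree → BTree → BTree

namespace BTree

/-- The head of a tree (`nil` for `nil`). -/
def head : BTree → BTree
  | nil => nil
  | cons a _ => a

/-- The tail of a tree (`nil` for `nil`). -/
def tail : BTree → BTree
  | nil => nil
  | cons _ b => b

/-- Natural numbers in unary. -/
def ofNat : ℕ → BTree
  | 0 => nil
  | n + 1 => cons nil (ofNat n)

/-- Lists of trees as trees. -/
def ofList : List BTree → BTree
  | [] => nil
  | a :: l => cons a (ofList l)

end BTree

/-- A store: the values of the variables, which are numbered `0, 1, 2, …`. -/
abbrev Store : Type := ℕ → BTree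

/-- Expressions. -/
inductive Expr : Type
  | var : ℕ → Expr
  | nil : Expr
  | cons : Expr → Expr → Expr
  | head : Expr → Expr
  | tail : Expr → Expr

/-- The value of an expression. -/
def Expr.eval (s : Store) : Expr → BTree
  | .var x => s x
  | .nil => BTree.nil
  | .cons e f => BTree.cons (e.eval s) (f.eval s)
  | .head e => (e.eval s).head
  | .tail e => (e.eval s).tail

/-- The time to evaluate an expression: one unit for each of its symbols. -/
def Expr.cost : Expr → ℕ
  | .var _ => 1
  | .nil => 1
  | .cons e f => e.cost + f.cost + 1
  | .head e => e.cost + 1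
  | .tail e => e.cost + 1

/-- Programs: assignment, sequential composition, conditional (`cond e p q` runs `p` if the value
of `e` is not `nil`, and `q` otherwise) and while loop (`loop e p` repeats `p` as long as the value
of `e` is not `nil`). -/
inductive Program : Type
  | assign : ℕ → Expr → Program
  | seq : Program → Program → Program
  | cond : Expr → Program → Program → Program
  | loop : Expr → Program → Program

/-- `Runs p s s' t`: the program `p`, started in the store `s`, halts in the store `s'` after
exactly `t` units of time. -/
inductive Runs : Program → Store → Store → ℕ → Prop
  | assign (x : ℕ) (e : Expr) (s : Store) :
      Runs (.assign x e) s (Function.update s x (e.eval s)) (e.cost + 1)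
  | seq {p q : Program} {s₁ s₂ s₃ : Store} {t₁ t₂ : ℕ} :
      Runs p s₁ s₂ t₁ → Runs q s₂ s₃ t₂ → Runs (.seq p q) s₁ s₃ (t₁ + t₂)
  | cond_true {e : Expr} {p q : Program} {s s' : Store} {t : ℕ} :
      e.eval s ≠ BTree.nil → Runs p s s' t → Runs (.cond e p q) s s' (e.cost + t + 1)
  | cond_false {e : Expr} {p q : Program} {s s' : Store} {t : ℕ} :
      e.eval s = BTree.nil → Runs q s s' t → Runs (.cond e p q) s s' (e.cost + t + 1)
  | loop_done {e : Expr} {p : Program} {s : Store} :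
      e.eval s = BTree.nil → Runs (.loop e p) s s (e.cost + 1)
  | loop_step {e : Expr} {p : Program} {s₁ s₂ s₃ : Store} {t₁ t₂ : ℕ} :
      e.eval s₁ ≠ BTree.nil → Runs p s₁ s₂ t₁ → Runs (.loop e p) s₂ s₃ t₂ →
        Runs (.loop e p) s₁ s₃ (e.cost + t₁ + t₂ + 1)

/-- The initial store: the input is in variable `0`, all other variables are `nil`. -/
def initStore (input : BTree) : Store :=
  Function.update (fun _ => BTree.nil) 0 input

/-- On the given input, the program halts within `T` units of time and answers (in variable `0`,
where `nil` means "no" and everything else means "yes") whether `Q` holds. -/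
def Program.DecidesWithin (p : Program) (input : BTree) (Q : Prop) (T : ℕ) : Prop :=
  ∃ (s : Store) (t : ℕ), Runs p (initStore input) s t ∧ t ≤ T ∧ (s 0 ≠ BTree.nil ↔ Q)

end WhileLang

/-! ## Multi-`k`-expressions -/

/-- Expression trees over the four operations on multi-`k`-labeled graphs with vertices from `V`
and labels from `Fin k`; see `MultiExpr.WellFormed` for the side conditions. -/
inductive MultiExpr (V : Type) (k : ℕ) : Type
  | introduce : V → Finset (Fin k) → MultiExpr V k
  | union : MultiExpr V k → MultiExpr V k → MultiExpr V k
  | join : Fin k → Fin k → MultiExpr V k → MultiExpr V k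
  | relabel : Fin k → Finset (Fin k) → MultiExpr V k → MultiExpr V k

namespace MultiExpr

variable {V : Type} {k : ℕ}

/-- The vertex set of the graph created by an expression. -/
def verts : MultiExpr V k → Set V
  | introduce v _ => {v}
  | union a b => a.verts ∪ b.verts
  | join _ _ a => a.verts
  | relabel _ _ a => a.verts

open Classical in
/-- The multi-labeling function of the graph created by an expression; an element of `V` that is
not a vertex of this graph gets the empty set. -/
noncomputable def lab : MultiExpr V k → V → Finset (Fin k)
  | introduce v S => fun w => if w = v then S else ∅
  | union a b => fun w => a.lab w ∪ b.lab w
  | join _ _ a => a.lab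
  | relabel i S a => fun w => if i ∈ a.lab w then (a.lab w).erase i ∪ S else a.lab w

/-- The edges of the graph created by an expression; an element of `V` that is not a vertex of
this graph has no incident edges. -/
noncomputable def graph : MultiExpr V k → SimpleGraph V
  | introduce _ _ => ⊥
  | union a b => a.graph ⊔ b.graph
  | join i j a => a.graph ⊔ SimpleGraph.fromRel (fun u v => i ∈ a.lab u ∧ j ∈ a.lab v)
  | relabel _ _ a => a.graph

/-- The side conditions of the operations: an introduced vertex has at least one label, a union is
taken of vertex-disjoint graphs, and a join uses two distinct labels that no vertex holds
simultaneously. -/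
def WellFormed : MultiExpr V k → Prop
  | introduce _ S => S.Nonempty
  | union a b => a.WellFormed ∧ b.WellFormed ∧ Disjoint a.verts b.verts
  | join i j a => a.WellFormed ∧ i ≠ j ∧ ∀ v ∈ a.verts, ¬ (i ∈ a.lab v ∧ j ∈ a.lab v)
  | relabel _ _ a => a.WellFormed

/-- `φ` is a multi-`k`-expression of the graph `G`. -/
def IsExpressionOf (φ : MultiExpr V k) (G : SimpleGraph V) : Prop :=
  φ.WellFormed ∧ φ.verts = Set.univ ∧ φ.graph = G

/-- The number of nodes (operations) of an expression. -/
def numNodes : MultiExpr V k → ℕ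
  | introduce _ _ => 1
  | union a b => a.numNodes + b.numNodes + 1
  | join _ _ a => a.numNodes + 1
  | relabel _ _ a => a.numNodes + 1

end MultiExpr

/-! ## Encoding of the input -/

open WhileLang

/-- The list of the labels in a label set, in increasing order. -/
def encodeLabels {k : ℕ} (S : Finset (Fin k)) : BTree :=
  BTree.ofList ((S.sort (· ≤ ·)).map fun i => BTree.ofNat i)

/-- An expression as a nested list, each operation with a numerical tag. -/
def encodeExpr {n k : ℕ} : MultiExpr (Fin n) k → BTree
  | .introduce v S => BTree.ofList [BTree.ofNat 0, BTree.ofNat v, encodeLabels S]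
  | .union a b => BTree.ofList [BTree.ofNat 1, encodeExpr a, encodeExpr b]
  | .join i j a => BTree.ofList [BTree.ofNat 2, BTree.ofNat i, BTree.ofNat j, encodeExpr a]
  | .relabel i S a => BTree.ofList [BTree.ofNat 3, BTree.ofNat i, encodeLabels S, encodeExpr a]

open Classical in
/-- The adjacency matrix of a graph, as the list of its rows. -/
noncomputable def encodeGraph {n : ℕ} (G : SimpleGraph (Fin n)) : BTree :=
  BTree.ofList (List.ofFn fun u : Fin n => BTree.ofList (List.ofFn fun v : Fin n =>
    if G.Adj u v then BTree.ofNat 1 else BTree.ofNat 0))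

/-- The input: the number of labels, the graph, and the expression. -/
noncomputable def encodeInput {n k : ℕ} (G : SimpleGraph (Fin n)) (φ : MultiExpr (Fin n) k) :
    BTree :=
  BTree.ofList [BTree.ofNat k, encodeGraph G, encodeExpr φ]

/-! Orient the cycle: each vertex `v` has a leaving half-edge `(v, true)` and an entering one `(v,
false)`, and a Hamiltonian cycle matches leaving with entering half-edges along edges, which is a
permutation with a single orbit. The expression is evaluated bottom-up. At every stage a half-edge
is either matched along an existing edge or waits at one label of its vertex; index `2 * i + 1`
holds the leaving and `2 * i` the entering half-edges that wait at label `i`. A relabel lets waiting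
half-edges move, and a join of `i` and `j` lets half-edges of opposite direction at `i` and `j`
match.

Counting the paths for every pair of end indices would make the exponent quadratic in `k`. Instead a
state keeps, per index, only the number of waiting half-edges and a class name, which leaves `n ^
O(k)` states (`Tidy.length_le`). This is enough because half-edges that wait at the same index are
interchangeable: exchanging their later fates gives another valid solution, and if they end on
different cycles, the exchange merges these cycles. So it suffices to follow the equivalence
relation on vertices generated by matches and by meetings at an index; the classes of indices are
its trace on the waiting half-edges. The only thing to forbid is that a class loses its last waiting
half-edge while half-edges wait elsewhere.

`Spec` ties tables to partial solutions by two one-sided statements. Soundness: every state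
describes a member of a family closed under the needed exchanges (`Fam`, `Inv`); `Fam.step` is the
exchange argument and shows that elementary steps preserve this. Completeness: each solution
contained in a map without proper nonempty closed vertex sets is described by a state (`CInv`); a
color class in which nothing waits would be such a closed set, so the forbidden case does not arise.
`MultiExpr.spec_tab` establishes `Spec` by induction on the expression. At the end,
`Spec.exists_isZero_iff` takes a permutation of the family whose cycle through a fixed vertex is
largest; a proper cycle could be enlarged by an exchange, since the relation is total.

For the running time, `Comp` and `PT` form a calculus of programs and polynomial bounds. The
expression is flattened into a list of steps for a stack of tables (`pt_ops`, `foldl_ops`); one step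
takes time polynomial in the sizes of its arguments and of the stack (`pt_exec`), and the stack
stays small because every table is cleaned (`sz_foldl_exec_le`). `stateBound_le` turns the number of
states into a power of `n`. -/

namespace WhileLang

/-! ## Encodings -/

/-- The number of nodes of a tree, leaves included. -/
def BTree.size : BTree → ℕ
  | .nil => 1
  | .cons a b => a.size + b.size + 1

/-- Types whose elements are represented by trees. -/
class Enc (α : Type) where
  /-- The tree that represents an element. -/
  toTree : α → BTree

/-- The tree that represents an element. -/
abbrev enc {α : Type} [Enc α] (a : α) : BTree := Enc.toTree a

instance : Enc Unit := ⟨fun _ => .nil⟩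
instance : Enc Bool := ⟨fun b => if b then .cons .nil .nil else .nil⟩
instance : Enc ℕ := ⟨BTree.ofNat⟩
instance {α β : Type} [Enc α] [Enc β] : Enc (α × β) := ⟨fun p => .cons (enc p.1) (enc p.2)⟩
instance {α : Type} [Enc α] : Enc (List α) := ⟨fun l => BTree.ofList (l.map enc)⟩
-- A subtype keeps the encoding of the ambient type. A function that is computed correctly only for
-- some arguments, such as the head of a nonempty list, thus becomes a function between encoded
-- types.
instance {α : Type} [Enc α] (P : α → Prop) : Enc {a // P a} := ⟨fun a => enc a.1⟩

variable {α β γ δ : Type} [Enc α] [Enc β] [Enc γ] [Enc δ]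

@[simp] theorem enc_unit (u : Unit) : enc u = .nil := rfl
@[simp] theorem enc_true : enc true = .cons .nil .nil := rfl
@[simp] theorem enc_false : enc false = .nil := rfl
@[simp] theorem enc_zero : enc (0 : ℕ) = .nil := rfl
@[simp] theorem enc_succ (n : ℕ) : enc (n + 1) = .cons .nil (enc n) := rfl
@[simp] theorem enc_pair (a : α) (b : β) : enc (a, b) = .cons (enc a) (enc b) := rfl

theorem enc_prod (p : α × β) : enc p = .cons (enc p.1) (enc p.2) := rfl
@[simp] theorem enc_nil : enc ([] : List α) = .nil := rfl
@[simp] theorem enc_cons (a : α) (l : List α) : enc (a :: l) = .cons (enc a) (enc l) := rfl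
@[simp] theorem enc_val {P : α → Prop} (a : {a // P a}) : enc a = enc a.1 := rfl

/-- The size of the representation. -/
def sz (a : α) : ℕ := (enc a).size

theorem sz_pos (a : α) : 1 ≤ sz a := by
  unfold sz; cases enc a <;> simp [BTree.size]

@[simp] theorem sz_unit (u : Unit) : sz u = 1 := rfl
@[simp] theorem sz_nat (n : ℕ) : sz n = 2 * n + 1 := by
  induction n with
  | zero => rfl
  | succ n ih => unfold sz at *; simp [BTree.size, ih]; ring
theorem sz_bool (b : Bool) : sz b ≤ 3 := by cases b <;> simp [sz, BTree.size]
@[simp] theorem sz_pair (a : α) (b : β) : sz (a, b) = sz a + sz b + 1 := rfl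
theorem sz_prod (p : α × β) : sz p = sz p.1 + sz p.2 + 1 := rfl
@[simp] theorem sz_nil : sz ([] : List α) = 1 := rfl
@[simp] theorem sz_cons (a : α) (l : List α) : sz (a :: l) = sz a + sz l + 1 := rfl
@[simp] theorem sz_val {P : α → Prop} (a : {a // P a}) : sz a = sz a.1 := rfl

theorem sz_append (l l' : List α) : sz (l ++ l') + 1 = sz l + sz l' := by
  induction l with
  | nil => simp [add_comm]
  | cons a l ih => simp; omega

theorem sz_reverse (l : List α) : sz l.reverse = sz l := by
  induction l with
  | nil => rfl
  | cons a l ih => have := sz_append l.reverse [a]; simp at *; omega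

theorem length_le_sz (l : List α) : l.length ≤ sz l := by
  induction l with
  | nil => simp
  | cons a l ih => simp; omega

theorem sz_le_of_mem {l : List α} {a : α} (h : a ∈ l) : sz a ≤ sz l := by
  induction l with
  | nil => simp at h
  | cons b l ih =>
    simp only [List.mem_cons] at h
    rcases h with rfl | h
    · simp; omega
    · have := ih h; simp; omega

theorem sz_le_mul {l : List α} {M : ℕ} (h : ∀ a ∈ l, sz a ≤ M) :
    sz l ≤ l.length * (M + 1) + 1 := by
  induction l with
  | nil => simp
  | cons b l ih =>
    have h1 := h b (by simp)
    have h2 := ih fun a ha => h a (by simp [ha])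
    simp only [sz_cons, List.length_cons, Nat.succ_mul]; omega

theorem enc_list_eq_nil (l : List α) : enc l = .nil ↔ l = [] := by
  cases l <;> simp

/-! ## Programs that compute functions -/

/-- Some program that leaves all but finitely many variables alone computes `f` from variable `0`
to variable `0` within time `T`, whatever the other variables hold at the start. -/
def Comp (f : α → β) (T : α → ℕ) : Prop :=
  ∃ (p : Program) (m : ℕ), ∀ (a : α) (s : Store), s 0 = enc a →
    ∃ s' t, Runs p s s' t ∧ s' 0 = enc (f a) ∧ (∀ x, m ≤ x → s' x = s x) ∧ t ≤ T a

namespace Comp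

theorem mono {f : α → β} {T T' : α → ℕ} (h : Comp f T) (hT : ∀ a, T a ≤ T' a) : Comp f T' := by
  obtain ⟨p, m, h⟩ := h
  refine ⟨p, m, fun a s hs => ?_⟩
  obtain ⟨s', t, h1, h2, h3, h4⟩ := h a s hs
  exact ⟨s', t, h1, h2, h3, h4.trans (hT a)⟩

theorem congr {f g : α → β} {T : α → ℕ} (h : Comp f T) (hfg : ∀ a, f a = g a) : Comp g T := by
  rwa [← funext hfg]

/-- Only the representations of the arguments and of the values matter. -/
theorem cast {α' β' : Type} [Enc α'] [Enc β'] {f : α → β} {T : α → ℕ} (h : Comp f T)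
    (i : α' → α) (g : α' → β') (hi : ∀ a, enc (i a) = enc a)
    (hg : ∀ a, enc (f (i a)) = enc (g a)) : Comp g (fun a => T (i a)) := by
  obtain ⟨p, m, h⟩ := h
  refine ⟨p, m, fun a s hs => ?_⟩
  obtain ⟨s', t, h1, h2, h3, h4⟩ := h (i a) s (hs.trans (hi a).symm)
  exact ⟨s', t, h1, h2.trans (hg a), h3, h4⟩

theorem of_expr {f : α → β} (e : Expr)
    (h : ∀ a (s : Store), s 0 = enc a → e.eval s = enc (f a)) :
    Comp f (fun _ => e.cost + 1) := by
  refine ⟨.assign 0 e, 1, fun a s hs => ⟨_, _, .assign 0 e s, by simp [h a s hs], ?_, le_rfl⟩⟩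
  intro x hx
  exact Function.update_of_ne (by omega) _ _

theorem comp {g : β → γ} {f : α → β} {Tg : β → ℕ} {Tf : α → ℕ} (hg : Comp g Tg)
    (hf : Comp f Tf) : Comp (fun a => g (f a)) (fun a => Tf a + Tg (f a)) := by
  obtain ⟨p, m, hf⟩ := hf
  obtain ⟨q, m', hg⟩ := hg
  refine ⟨.seq p q, max m m', fun a s hs => ?_⟩
  obtain ⟨s1, t1, h1, h2, h3, h4⟩ := hf a s hs
  obtain ⟨s2, t2, k1, k2, k3, k4⟩ := hg (f a) s1 h2
  refine ⟨s2, _, h1.seq k1, k2, fun x hx => ?_, add_le_add h4 k4⟩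
  rw [k3 x (le_of_max_le_right hx), h3 x (le_of_max_le_left hx)]

theorem pair {f : α → β} {g : α → γ} {Tf Tg : α → ℕ} (hf : Comp f Tf) (hg : Comp g Tg) :
    Comp (fun a => (f a, g a)) (fun a => Tf a + Tg a + 10) := by
  obtain ⟨p, m, hf⟩ := hf
  obtain ⟨q, m', hg⟩ := hg
  -- Both programs leave the variables from `M` on alone, so `M` can save the argument and `M + 1`
  -- the first result; the `+ 1` keeps `M` different from variable `0`.
  set M := max m m' + 1 with hM
  refine ⟨.seq (.assign M (.var 0)) (.seq p (.seq (.assign (M + 1) (.var 0))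
    (.seq (.assign 0 (.var M)) (.seq q (.assign 0 (.cons (.var (M + 1)) (.var 0))))))),
    M + 2, fun a s hs => ?_⟩
  have hm1 : m ≤ max m m' := le_max_left _ _
  have hm2 : m' ≤ max m m' := le_max_right _ _
  obtain ⟨s1, t1, h1, h2, h3, h4⟩ := hf a (Function.update s M ((Expr.var 0).eval s))
    (by rw [Function.update_of_ne (by omega)]; exact hs)
  obtain ⟨s2, t2, k1, k2, k3, k4⟩ := hg a
    (Function.update (Function.update s1 (M + 1) ((Expr.var 0).eval s1)) 0
      ((Expr.var M).eval (Function.update s1 (M + 1) ((Expr.var 0).eval s1))))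
    (by
      simp only [Function.update_self, Expr.eval]
      rw [Function.update_of_ne (by omega), h3 M (by omega)]
      simpa [Expr.eval] using hs)
  refine ⟨_, _, .seq (.assign _ _ _) (.seq h1 (.seq (.assign _ _ _) (.seq (.assign _ _ _)
    (.seq k1 (.assign _ _ _))))), ?_, fun x hx => ?_, ?_⟩
  · simp only [Function.update_self, Expr.eval, enc_pair, k2]
    rw [k3 (M + 1) (by omega), Function.update_of_ne (by omega), Function.update_self]
    simp [Expr.eval, h2]
  · rw [Function.update_of_ne (by omega), k3 x (by omega), Function.update_of_ne (by omega),
      Function.update_of_ne (by omega), h3 x (by omega), Function.update_of_ne (by omega)]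
  · simp only [Expr.cost]; omega

/-- Each branch has to be right only on the arguments that select it. The time bound adds both
branches, which spares a case distinction in later estimates. -/
theorem ite {c : α → Bool} {f : α → β} {Tc T₁ T₂ : α → ℕ} (hc : Comp c Tc)
    (h₁ : Comp (fun a : {a // c a = true} => f a.1) (fun a => T₁ a.1))
    (h₂ : Comp (fun a : {a // c a = false} => f a.1) (fun a => T₂ a.1)) :
    Comp f (fun a => Tc a + T₁ a + T₂ a + 10) := by
  obtain ⟨p, m, hc⟩ := hc
  obtain ⟨q, m₁, h₁⟩ := h₁
  obtain ⟨r, m₂, h₂⟩ := h₂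
  set M := max m (max m₁ m₂) + 1 with hM
  refine ⟨.seq (.assign M (.var 0)) (.seq p (.cond (.var 0) (.seq (.assign 0 (.var M)) q)
    (.seq (.assign 0 (.var M)) r))), M + 1, fun a s hs => ?_⟩
  have hm0 : m < M := by omega
  have hm1 : m₁ < M := by omega
  have hm2 : m₂ < M := by omega
  obtain ⟨s1, t1, k1, k2, k3, k4⟩ := hc a (Function.update s M ((Expr.var 0).eval s))
    (by rw [Function.update_of_ne (by omega)]; exact hs)
  have hs1 : Function.update s1 0 ((Expr.var M).eval s1) 0 = enc a := by
    simp only [Function.update_self, Expr.eval]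
    rw [k3 M (by omega)]
    simpa [Expr.eval] using hs
  by_cases hca : c a = true
  · obtain ⟨s2, t2, l1, l2, l3, l4⟩ := h₁ ⟨a, hca⟩ _ hs1
    refine ⟨s2, _, .seq (.assign _ _ _) (.seq k1 (.cond_true ?_ (.seq (.assign _ _ _) l1))), l2,
      fun x hx => ?_, ?_⟩
    · simp [Expr.eval, k2, hca]
    · rw [l3 x (by omega), Function.update_of_ne (by omega), k3 x (by omega),
        Function.update_of_ne (by omega)]
    · simp only [Expr.cost]; simp only at l4; omega
  · simp only [Bool.not_eq_true] at hca
    obtain ⟨s2, t2, l1, l2, l3, l4⟩ := h₂ ⟨a, hca⟩ _ hs1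
    refine ⟨s2, _, .seq (.assign _ _ _) (.seq k1 (.cond_false ?_ (.seq (.assign _ _ _) l1))), l2,
      fun x hx => ?_, ?_⟩
    · simp [Expr.eval, k2, hca]
    · rw [l3 x (by omega), Function.update_of_ne (by omega), k3 x (by omega),
        Function.update_of_ne (by omega)]
    · simp only [Expr.cost]; simp only at l4; omega

/-- Iteration of a step as long as an expression is not `nil`. -/
theorem loop (e : Expr) {C : γ → Prop} (hC : ∀ g (s : Store), s 0 = enc g → (e.eval s ≠ .nil ↔ C g))
    {step : γ → γ} {Ts : γ → ℕ} (hstep : Comp (fun g : {g // C g} => step g.1) (fun g => Ts g.1))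
    {f : α → γ} {Tf : α → ℕ} (hf : Comp f Tf)
    {it B : α → ℕ} (hrun : ∀ a, ∀ i < it a, C (step^[i] (f a)))
    (hdone : ∀ a, ¬ C (step^[it a] (f a)))
    (hB : ∀ a, ∀ i < it a, Ts (step^[i] (f a)) ≤ B a) :
    Comp (fun a => step^[it a] (f a))
      (fun a => Tf a + it a * (B a + e.cost + 1) + e.cost + 1) := by
  obtain ⟨p, m, hf⟩ := hf
  obtain ⟨q, m', hstep⟩ := hstep
  refine ⟨.seq p (.loop e q), max m m', fun a s hs => ?_⟩
  obtain ⟨s1, t1, h1, h2, h3, h4⟩ := hf a s hs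
  -- Induction on the number `n` of iterations that remain after the first `i`.
  have key : ∀ n i, i + n = it a → ∀ s : Store, s 0 = enc (step^[i] (f a)) →
      ∃ s' t, Runs (.loop e q) s s' t ∧ s' 0 = enc (step^[it a] (f a)) ∧
        (∀ x, m' ≤ x → s' x = s x) ∧ t ≤ n * (B a + e.cost + 1) + e.cost + 1 := by
    intro n
    induction n with
    | zero =>
      intro i hi s hs
      obtain rfl : i = it a := by omega
      refine ⟨s, _, .loop_done ?_, hs, fun _ _ => rfl, by simp⟩
      have := hC _ s hs
      have := hdone a
      tauto
    | succ n ih =>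
      intro i hi s hs
      have hCi := hrun a i (by omega)
      obtain ⟨s2, t2, k1, k2, k3, k4⟩ := hstep ⟨_, hCi⟩ s hs
      obtain ⟨s3, t3, l1, l2, l3, l4⟩ := ih (i + 1) (by omega) s2
        (by rw [k2, Function.iterate_succ_apply'])
      refine ⟨s3, _, .loop_step ((hC _ s hs).2 hCi) k1 l1, l2, fun x hx => ?_, ?_⟩
      · rw [l3 x hx, k3 x hx]
      · have := hB a i (by omega)
        simp only at k4
        rw [Nat.succ_mul]; omega
  obtain ⟨s2, t2, k1, k2, k3, k4⟩ := key (it a) 0 (by omega) s1 h2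
  refine ⟨s2, _, h1.seq k1, k2, fun x hx => ?_, ?_⟩
  · rw [k3 x (le_of_max_le_right hx), h3 x (le_of_max_le_left hx)]
  · exact (add_le_add h4 k4).trans (le_of_eq (by ring))

protected theorem id : Comp (fun a : α => a) (fun _ => 2) := of_expr (.var 0) fun _ _ h => h

protected theorem fst : Comp (fun p : α × β => p.1) (fun _ => 3) :=
  of_expr (.head (.var 0)) fun a s h => by simp [Expr.eval, h, enc_prod a, BTree.head]

protected theorem snd : Comp (fun p : α × β => p.2) (fun _ => 3) :=
  of_expr (.tail (.var 0)) fun a s h => by simp [Expr.eval, h, enc_prod a, BTree.tail]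

/-- Folding a list, with the argument available in every step. -/
theorem foldl {l : α → List β} {init : α → γ} {step : α × γ × β → γ} {Tl Ti : α → ℕ}
    {Ts : α × γ × β → ℕ} {B : α → ℕ} (hl : Comp l Tl) (hi : Comp init Ti) (hs : Comp step Ts)
    (hB : ∀ a l₁ b l₂, l a = l₁ ++ b :: l₂ →
      Ts (a, l₁.foldl (fun acc b => step (a, acc, b)) (init a), b) ≤ B a) :
    Comp (fun a => (l a).foldl (fun acc b => step (a, acc, b)) (init a))
      (fun a => Tl a + Ti a + (l a).length * (B a + 234) + 100) := by
  -- The loop state consists of the argument, the accumulator and the unread rest of the list.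
  set C : α × γ × List β → Prop := fun x => x.2.2 ≠ [] with hCdef
  set st : α × γ × List β → α × γ × List β := fun x =>
    match x with
    | (a, g, []) => (a, g, [])
    | (a, g, b :: l) => (a, step (a, g, b), l) with hst
  have hC : ∀ x (s : Store), s 0 = enc x → ((Expr.tail (.tail (.var 0))).eval s ≠ .nil ↔ C x) := by
    rintro ⟨a, g, l⟩ s h
    simp [Expr.eval, h, BTree.tail, hCdef, enc_list_eq_nil]
  have harg : Comp (fun x : {x // C x} =>
      ((x.1.1, x.1.2.1, x.1.2.2.head x.2) : α × γ × β)) (fun _ => 100) := by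
    refine (of_expr (.cons (.head (.var 0)) (.cons (.head (.tail (.var 0)))
      (.head (.tail (.tail (.var 0)))))) ?_).mono fun _ => by simp [Expr.cost]
    rintro ⟨⟨a, g, l⟩, hx⟩ s h
    obtain ⟨b, l, rfl⟩ := List.exists_cons_of_ne_nil hx
    simp [Expr.eval, h, BTree.tail, BTree.head]
  have hrest : Comp (fun x : {x // C x} => x.1.2.2.tail) (fun _ => 100) := by
    refine (of_expr (.tail (.tail (.tail (.var 0)))) ?_).mono fun _ => by simp [Expr.cost]
    rintro ⟨⟨a, g, l⟩, hx⟩ s h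
    obtain ⟨b, l, rfl⟩ := List.exists_cons_of_ne_nil hx
    simp [Expr.eval, h, BTree.tail]
  have hfst : Comp (fun x : {x // C x} => x.1.1) (fun _ => 3) :=
    Comp.fst.cast (fun x : {x // C x} => x.1) _ (fun _ => rfl) (fun _ => rfl)
  -- The body never runs on an empty rest, so the default `0` is harmless.
  set Tst : α × γ × List β → ℕ := fun y =>
    if h : y.2.2 ≠ [] then Ts (y.1, y.2.1, y.2.2.head h) + 230 else 0 with hTst
  have hstep : Comp (fun x : {x // C x} => st x.1) (fun x => Tst x.1) := by
    refine ((hfst.pair ((hs.comp harg).pair hrest)).congr ?_).mono ?_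
    · rintro ⟨⟨a, g, l⟩, hx⟩
      obtain ⟨b, l, rfl⟩ := List.exists_cons_of_ne_nil hx
      simp [hst]
    · rintro ⟨y, hy⟩
      simp only [hTst]; rw [dif_pos hy]; omega
  have hiter : ∀ a l₂ l₁, l a = l₁ ++ l₂ → st^[l₁.length] (a, init a, l a) =
      (a, l₁.foldl (fun acc b => step (a, acc, b)) (init a), l₂) := by
    intro a l₂ l₁
    induction l₁ using List.reverseRecOn generalizing l₂ with
    | nil => intro h; simp [h]
    | append_singleton l₁ b ih =>
      intro h
      rw [List.length_append, List.length_singleton, Function.iterate_succ_apply',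
        ih (b :: l₂) (by simp [h])]
      simp [hst]
  have hsplit : ∀ a, ∀ i < (l a).length, ∃ b, l a = (l a).take i ++ b :: (l a).drop (i + 1) := by
    intro a i hi
    exact ⟨(l a)[i], by simp⟩
  have hit : ∀ a, ∀ i < (l a).length, ∃ b, st^[i] (a, init a, l a) =
      (a, ((l a).take i).foldl (fun acc b => step (a, acc, b)) (init a),
        b :: (l a).drop (i + 1)) ∧ l a = (l a).take i ++ b :: (l a).drop (i + 1) := by
    intro a i hi
    obtain ⟨b, hb⟩ := hsplit a i hi
    have h := hiter a _ _ hb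
    rw [List.length_take, min_eq_left hi.le] at h
    exact ⟨b, h, hb⟩
  have hend : ∀ a, st^[(l a).length] (a, init a, l a) =
      (a, (l a).foldl (fun acc b => step (a, acc, b)) (init a), []) := fun a =>
    hiter a [] (l a) (by simp)
  have main := loop (step := st) (Ts := Tst) (f := fun a => (a, init a, l a)) (it := fun a => (l
      a).length)
    (B := fun a => B a + 230) _ hC hstep (Comp.id.pair (hi.pair hl)) ?_ ?_ ?_
  · have h2 : Comp (fun x : α × γ × List β => x.2.1) (fun _ => 6) :=
      (Comp.fst.comp Comp.snd).mono fun _ => by omega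
    refine ((h2.comp main).congr fun a => by rw [hend]).mono fun a => ?_
    simp only [Expr.cost]
    have : (l a).length * (B a + 230 + (1 + 1 + 1) + 1) = (l a).length * (B a + 234) := rfl
    omega
  · intro a i hi
    obtain ⟨b, h, -⟩ := hit a i hi
    simp [h, hCdef]
  · intro a
    simp [hend, hCdef]
  · intro a i hi
    obtain ⟨b, h, h'⟩ := hit a i hi
    rw [h]
    simp only [hTst, ne_eq, reduceCtorEq, not_false_eq_true, dite_true, List.head_cons]
    have := hB a _ b _ h'
    omega

end Comp
end WhileLang

namespace WhileLang

variable {α β γ δ : Type} [Enc α] [Enc β] [Enc γ] [Enc δ]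

/-! ## Polynomial bounds -/

/-- The function is bounded by a polynomial in the size of the argument. -/
def Pb (g : α → ℕ) : Prop := ∃ c, ∀ a, g a ≤ c * sz a ^ c

theorem mul_pow_le {x a b C : ℕ} (hx : 1 ≤ x) (ha : a ≤ C) (hb : b ≤ C) :
    a * x ^ b ≤ C * x ^ C :=
  Nat.mul_le_mul ha (Nat.pow_le_pow_right hx hb)

namespace Pb

theorem mono {g h : α → ℕ} (hh : Pb h) (hg : ∀ a, g a ≤ h a) : Pb g := by
  obtain ⟨c, hc⟩ := hh
  exact ⟨c, fun a => (hg a).trans (hc a)⟩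

theorem const (n : ℕ) : Pb (fun _ : α => n) :=
  ⟨n, fun a => Nat.le_mul_of_pos_right _ (Nat.pow_pos (sz_pos a))⟩

protected theorem sz : Pb (fun a : α => sz a) := ⟨1, fun a => by simp⟩

theorem add {g h : α → ℕ} (hg : Pb g) (hh : Pb h) : Pb (fun a => g a + h a) := by
  obtain ⟨c, hc⟩ := hg
  obtain ⟨d, hd⟩ := hh
  refine ⟨c + d, fun a => ?_⟩
  have h1 := (hc a).trans (mul_pow_le (C := c) (b := c) (sz_pos a) le_rfl le_rfl)
  have h2 : sz a ^ c ≤ sz a ^ (c + d) := Nat.pow_le_pow_right (sz_pos a) (by omega)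
  have h3 : sz a ^ d ≤ sz a ^ (c + d) := Nat.pow_le_pow_right (sz_pos a) (by omega)
  calc g a + h a ≤ c * sz a ^ c + d * sz a ^ d := add_le_add (hc a) (hd a)
    _ ≤ c * sz a ^ (c + d) + d * sz a ^ (c + d) := by gcongr
    _ = (c + d) * sz a ^ (c + d) := by ring

theorem mul {g h : α → ℕ} (hg : Pb g) (hh : Pb h) : Pb (fun a => g a * h a) := by
  obtain ⟨c, hc⟩ := hg
  obtain ⟨d, hd⟩ := hh
  refine ⟨c * d + (c + d), fun a => ?_⟩
  calc g a * h a ≤ (c * sz a ^ c) * (d * sz a ^ d) := Nat.mul_le_mul (hc a) (hd a)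
    _ = (c * d) * sz a ^ (c + d) := by ring
    _ ≤ _ := mul_pow_le (sz_pos a) (by omega) (by omega)

theorem pow {g : α → ℕ} (hg : Pb g) (n : ℕ) : Pb (fun a => g a ^ n) := by
  induction n with
  | zero => simpa using const 1
  | succ n ih => simpa [pow_succ] using ih.mul hg

theorem comp {g : β → ℕ} {f : α → β} (hg : Pb g) (hf : Pb (fun a => sz (f a))) :
    Pb (fun a => g (f a)) := by
  obtain ⟨c, hc⟩ := hg
  exact (((const c).mul (hf.pow c))).mono fun a => hc (f a)

end Pb

/-! ## Polynomial time functions -/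

/-- The function is computed in polynomial time, with values of polynomial size. -/
def PT (f : α → β) : Prop := ∃ T, Comp f T ∧ Pb T ∧ Pb (fun a => sz (f a))

namespace PT

theorem congr {f g : α → β} (h : PT f) (hfg : ∀ a, f a = g a) : PT g := by
  rwa [← funext hfg]

theorem size {f : α → β} (h : PT f) : Pb (fun a => sz (f a)) := h.choose_spec.2.2

theorem of_expr {f : α → β} (e : Expr) (h : ∀ a (s : Store), s 0 = enc a → e.eval s = enc (f a))
    (hf : Pb (fun a => sz (f a))) : PT f :=
  ⟨_, Comp.of_expr e h, Pb.const _, hf⟩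

/-- Here the size bound inside `PT` is needed: the time of `g` is polynomial in the size of `f a`,
and only the bound on that size makes it polynomial in the size of `a`. -/
theorem comp {g : β → γ} {f : α → β} (hg : PT g) (hf : PT f) : PT (fun a => g (f a)) := by
  obtain ⟨Tg, g1, g2, g3⟩ := hg
  obtain ⟨Tf, f1, f2, f3⟩ := hf
  exact ⟨_, g1.comp f1, f2.add (g2.comp f3), g3.comp f3⟩

theorem pair {f : α → β} {g : α → γ} (hf : PT f) (hg : PT g) : PT (fun a => (f a, g a)) := by
  obtain ⟨Tg, g1, g2, g3⟩ := hg
  obtain ⟨Tf, f1, f2, f3⟩ := hf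
  exact ⟨_, f1.pair g1, (f2.add g2).add (Pb.const _), (f3.add g3).add (Pb.const 1)⟩

protected theorem id : PT (fun a : α => a) := ⟨_, Comp.id, Pb.const _, Pb.sz⟩

/-- Only the representations of the arguments and of the values matter. -/
theorem cast {α' β' : Type} [Enc α'] [Enc β'] {f : α → β} (h : PT f)
    (i : α' → α) (g : α' → β') (hi : ∀ a, enc (i a) = enc a)
    (hg : ∀ a, enc (f (i a)) = enc (g a)) : PT g := by
  obtain ⟨T, h1, ⟨c, h2⟩, ⟨d, h3⟩⟩ := h
  refine ⟨_, h1.cast i g hi hg, ⟨c, fun a => ?_⟩, ⟨d, fun a => ?_⟩⟩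
  · have := h2 (i a)
    simpa only [sz, hi] using this
  · have := h3 (i a)
    simpa only [sz, hi, hg] using this

theorem restrict {f : α → β} (h : PT f) (P : α → Prop) : PT (fun a : {a // P a} => f a.1) :=
  h.cast _ _ (fun _ => rfl) (fun _ => rfl)

protected theorem fst : PT (fun p : α × β => p.1) :=
  ⟨_, Comp.fst, Pb.const _, Pb.sz.mono fun p => by rw [sz_prod p]; beta_reduce; omega⟩

protected theorem snd : PT (fun p : α × β => p.2) :=
  ⟨_, Comp.snd, Pb.const _, Pb.sz.mono fun p => by rw [sz_prod p]; beta_reduce; omega⟩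

/-- Constants. -/
theorem const (b : β) : PT (fun _ : α => b) := by
  obtain ⟨e, he⟩ : ∃ e : Expr, ∀ s, e.eval s = enc b := by
    generalize enc b = t
    induction t with
    | nil => exact ⟨.nil, fun _ => rfl⟩
    | cons a b iha ihb =>
      obtain ⟨e, he⟩ := iha
      obtain ⟨f, hf⟩ := ihb
      exact ⟨.cons e f, fun s => by simp [Expr.eval, he, hf]⟩
  exact of_expr e (fun _ s _ => he s) (Pb.const _)

/-- Case distinction, where each case need only be treated on its arguments. -/
theorem cases {c : α → Bool} {f : α → β} (hc : PT c)
    (h₁ : PT (fun a : {a // c a = true} => f a.1))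
    (h₂ : PT (fun a : {a // c a = false} => f a.1)) : PT f := by
  obtain ⟨Tc, c1, c2, c3⟩ := hc
  obtain ⟨T₁, a1, ⟨c₁, a2⟩, ⟨d₁, a3⟩⟩ := h₁
  obtain ⟨T₂, b1, ⟨c₂, b2⟩, ⟨d₂, b3⟩⟩ := h₂
  -- The bounds of the branches hold only on the subtypes; explicit monomials replace them by
  -- functions on all of `α`.
  have e1 : Pb (fun a : α => c₁ * sz a ^ c₁) := ⟨c₁, fun a => le_rfl⟩
  have e2 : Pb (fun a : α => c₂ * sz a ^ c₂) := ⟨c₂, fun a => le_rfl⟩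
  have e3 : Pb (fun a : α => d₁ * sz a ^ d₁) := ⟨d₁, fun a => le_rfl⟩
  have e4 : Pb (fun a : α => d₂ * sz a ^ d₂) := ⟨d₂, fun a => le_rfl⟩
  refine ⟨_, Comp.ite c1 (a1.mono a2) (b1.mono b2), ((c2.add e1).add e2).add (Pb.const 10),
    (e3.add e4).mono fun a => ?_⟩
  cases h : c a
  · exact (b3 ⟨a, h⟩).trans (Nat.le_add_left _ _)
  · exact (a3 ⟨a, h⟩).trans (Nat.le_add_right _ _)

theorem ite {c : α → Prop} [DecidablePred c] {f g : α → β} (hc : PT (fun a => decide (c a)))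
    (hf : PT f) (hg : PT g) : PT (fun a => if c a then f a else g a) := by
  refine cases hc ((hf.restrict _).congr ?_) ((hg.restrict _).congr ?_)
  · rintro ⟨a, ha⟩
    simp at ha; simp [ha]
  · rintro ⟨a, ha⟩
    simp at ha; simp [ha]

/-- Folding a list, if the intermediate results have polynomial size. -/
theorem foldl {l : α → List β} {init : α → γ} {step : α × γ × β → γ}
    (hl : PT l) (hi : PT init) (hs : PT step) {B : α → ℕ} (hB : Pb B)
    (h : ∀ a l₁ l₂, l a = l₁ ++ l₂ →
      sz (l₁.foldl (fun acc b => step (a, acc, b)) (init a)) ≤ B a) :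
    PT (fun a => (l a).foldl (fun acc b => step (a, acc, b)) (init a)) := by
  obtain ⟨Tl, l1, l2, l3⟩ := hl
  obtain ⟨Ti, i1, i2, i3⟩ := hi
  obtain ⟨Ts, s1, ⟨c, s2⟩, s3⟩ := hs
  refine ⟨_, Comp.foldl (B := fun a => c * (sz a + (B a + sz (l a) + 1) + 1) ^ c) l1 i1 s1
    fun a l₁ b l₂ hab => (s2 _).trans ?_, ?_, hB.mono fun a => h a (l a) [] (by simp)⟩
  · have h1 := h a _ _ hab
    have h2 : sz b ≤ sz (l a) := sz_le_of_mem (by simp [hab])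
    simp only [sz_pair]
    gcongr
  · refine (((l2.add i2).add (Pb.mul (l3.mono fun a => length_le_sz _) (Pb.add
      ((Pb.const c).mul (Pb.pow ?_ c)) (Pb.const _))))).add (Pb.const _)
    exact (Pb.sz.add ((hB.add l3).add (Pb.const 1))).add (Pb.const 1)

/-- Folding a list, if every step adds at most a polynomial amount in the size of the argument and
of the list element. -/
theorem foldl_add {l : α → List β} {init : α → γ} {step : α × γ × β → γ}
    (hl : PT l) (hi : PT init) (hs : PT step) {q : α × β → ℕ} (hq : Pb q)
    (h : ∀ a g b, sz (step (a, g, b)) ≤ sz g + q (a, b)) :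
    PT (fun a => (l a).foldl (fun acc b => step (a, acc, b)) (init a)) := by
  obtain ⟨c, hc⟩ := hq
  refine foldl hl hi hs
    (B := fun a => sz (init a) + sz (l a) * (c * (sz a + sz (l a) + 1) ^ c)) ?_ ?_
  · exact hi.size.add (hl.size.mul ((Pb.const c).mul
      (((Pb.sz.add hl.size).add (Pb.const 1)).pow c)))
  · intro a l₁ l₂ hab
    have key : ∀ l₁ : List β, (∀ b ∈ l₁, sz b ≤ sz (l a)) → ∀ g,
        sz (l₁.foldl (fun acc b => step (a, acc, b)) g) ≤
          sz g + l₁.length * (c * (sz a + sz (l a) + 1) ^ c) := by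
      intro l₁
      induction l₁ with
      | nil => intro _ g; simp
      | cons b l₁ ih =>
        intro hl₁ g
        have h1 := ih (fun b hb => hl₁ b (by simp [hb])) (step (a, g, b))
        have h2 := h a g b
        have h3 := hc (a, b)
        have h4 : sz (a, b) ≤ sz a + sz (l a) + 1 := by
          have := hl₁ b (by simp)
          rw [sz_pair]; omega
        have h5 : c * sz (a, b) ^ c ≤ c * (sz a + sz (l a) + 1) ^ c := by gcongr
        simp only [List.foldl_cons, List.length_cons, Nat.succ_mul]
        omega
    refine (key l₁ (fun b hb => sz_le_of_mem (by simp [hab, hb])) _).trans ?_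
    have : l₁.length ≤ sz (l a) := le_trans (by simp [hab]) (length_le_sz (l a))
    gcongr

/-! ### Lists -/

/-- A nonempty list and the pair of its head and tail have the same encoding. -/
theorem cons {f : α → β} {l : α → List β} (hf : PT f) (hl : PT l) :
    PT (fun a => f a :: l a) :=
  (hf.pair hl).cast (fun a => a) _ (fun _ => rfl) (fun _ => rfl)

theorem tail {l : α → List β} (hl : PT l) : PT (fun a => (l a).tail) :=
  (of_expr (f := fun l : List β => l.tail) (.tail (.var 0))
    (fun l s h => by cases l <;> simp [Expr.eval, h, BTree.tail])
    (Pb.sz.mono fun l => by cases l <;> simp; omega)).comp hl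

theorem not_nil {l : α → List β} (hl : PT l) : PT (fun a => !(l a).isEmpty) := by
  have : PT (fun l : List β => !l.isEmpty) := by
    refine ⟨fun _ => 20, ⟨.cond (.var 0) (.assign 0 (.cons .nil .nil)) (.assign 0 .nil), 1, ?_⟩,
      Pb.const _, (Pb.const 3).mono fun _ => sz_bool _⟩
    intro l s hs
    cases l with
    | nil =>
      refine ⟨_, _, .cond_false (by simp [Expr.eval, hs]) (.assign _ _ _), by simp [Expr.eval],
        fun x hx => Function.update_of_ne (by omega) _ _, by simp [Expr.cost]⟩
    | cons b l =>
      refine ⟨_, _, .cond_true (by simp [Expr.eval, hs]) (.assign _ _ _), by simp [Expr.eval],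
        fun x hx => Function.update_of_ne (by omega) _ _, by simp [Expr.cost]⟩
  exact this.comp hl

theorem reverse {l : α → List β} (hl : PT l) : PT (fun a => (l a).reverse) := by
  have : PT (fun l : List β => l.foldl (fun acc b => b :: acc) []) :=
    foldl_add (step := fun x : List β × List β × β => x.2.2 :: x.2.1) PT.id (const [])
      (cons (PT.snd.comp PT.snd) (PT.fst.comp PT.snd))
      (q := fun x => sz x.2 + 1) ((PT.snd.size).add (Pb.const 1))
      (fun a g b => by simp; omega)
  refine (this.congr fun l => ?_).comp hl
  simp

theorem foldr_add {l : α → List β} {init : α → γ} {step : α × γ × β → γ}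
    (hl : PT l) (hi : PT init) (hs : PT step) {q : α × β → ℕ} (hq : Pb q)
    (h : ∀ a g b, sz (step (a, g, b)) ≤ sz g + q (a, b)) :
    PT (fun a => (l a).foldr (fun b acc => step (a, acc, b)) (init a)) :=
  (foldl_add hl.reverse hi hs hq h).congr fun a => by simp

theorem map {l : α → List β} {g : α × β → γ} (hl : PT l) (hg : PT g) :
    PT (fun a => (l a).map fun b => g (a, b)) := by
  have := foldr_add (step := fun x : α × List γ × β => g (x.1, x.2.2) :: x.2.1) hl
    (const ([] : List γ))
    (cons (hg.comp (PT.fst.pair (PT.snd.comp PT.snd))) (PT.fst.comp PT.snd))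
    (q := fun x => sz (g x) + 1) (hg.size.add (Pb.const 1)) (fun a l b => by simp; omega)
  refine this.congr fun a => ?_
  induction l a with
  | nil => rfl
  | cons b l ih => simp [ih]

theorem append {l l' : α → List β} (hl : PT l) (hl' : PT l') : PT (fun a => l a ++ l' a) := by
  have := foldr_add (step := fun x : α × List β × β => x.2.2 :: x.2.1) hl hl'
    (cons (PT.snd.comp PT.snd) (PT.fst.comp PT.snd))
    (q := fun x => sz x.2 + 1) ((PT.snd.size).add (Pb.const 1)) (fun a l b => by simp; omega)
  refine this.congr fun a => ?_
  induction l a with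
  | nil => rfl
  | cons b l ih => simp [ih]

theorem flatMap {l : α → List β} {g : α × β → List γ} (hl : PT l) (hg : PT g) :
    PT (fun a => (l a).flatMap fun b => g (a, b)) := by
  have := foldr_add (step := fun x : α × List γ × β => g (x.1, x.2.2) ++ x.2.1) hl
    (const ([] : List γ))
    (append (hg.comp (PT.fst.pair (PT.snd.comp PT.snd))) (PT.fst.comp PT.snd))
    (q := fun x => sz (g x)) hg.size (fun a l b => by
      have := sz_append (g (a, b)) l
      simp only; omega)
  refine this.congr fun a => ?_
  induction l a with
  | nil => rfl
  | cons b l ih => simp [ih]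

theorem filter {l : α → List β} {g : α × β → Bool} (hl : PT l) (hg : PT g) :
    PT (fun a => (l a).filter fun b => g (a, b)) := by
  have := flatMap (g := fun x : α × β => if g x = true then [x.2] else []) hl
    (ite (hg.congr fun _ => by simp) (cons PT.snd (const [])) (const []))
  refine this.congr fun a => ?_
  induction l a with
  | nil => rfl
  | cons b l ih => by_cases h : g (a, b) <;> simp [ih, h]

theorem any {l : α → List β} {g : α × β → Bool} (hl : PT l) (hg : PT g) :
    PT (fun a => (l a).any fun b => g (a, b)) :=
  ((filter hl hg).not_nil).congr fun a => by
    induction l a with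
    | nil => rfl
    | cons b l ih => by_cases h : g (a, b) <;> simp_all

/-- A fold carries the position as a counter. Copying the counter makes the growth per step depend
on the accumulator, so `foldl_add` does not apply; the closed form `hfold` bounds the intermediate
results instead. -/
theorem mapIdx {l : α → List β} {g : α × ℕ × β → γ} (hl : PT l) (hg : PT g) :
    PT (fun a => (l a).mapIdx fun i b => g (a, i, b)) := by
  have hfold : ∀ l : List β, l.foldl (fun (acc : ℕ × List (ℕ × β)) b =>
      (acc.1 + 1, (acc.1, b) :: acc.2)) (0, []) =
        (l.length, (l.mapIdx fun i b => (i, b)).reverse) := by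
    intro l
    induction l using List.reverseRecOn with
    | nil => rfl
    | append_singleton l b ih => simp [ih, List.mapIdx_append]
  have hst : PT (fun x : α × (ℕ × List (ℕ × β)) × β =>
      ((x.2.1.1 + 1, (x.2.1.1, x.2.2) :: x.2.1.2) : ℕ × List (ℕ × β))) := by
    have h1 : PT (fun x : α × (ℕ × List (ℕ × β)) × β => x.2.1) := PT.fst.comp PT.snd
    have h2 : PT (fun x : α × (ℕ × List (ℕ × β)) × β => x.2.1.1) := PT.fst.comp h1
    have h3 : PT (fun x : α × (ℕ × List (ℕ × β)) × β => x.2.1.1 + 1) :=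
      ((const ()).pair h2).cast (fun a => a) _ (fun _ => rfl) (fun _ => rfl)
    exact h3.pair (cons (h2.pair (PT.snd.comp PT.snd)) (PT.snd.comp h1))
  have key := foldl hl (const (0, [])) hst
    (B := fun a => 2 * sz (l a) + 1 + (sz (l a) * ((2 * sz (l a) + 1) + sz (l a) + 1 + 1) + 1) + 1)
    ?_ ?_
  · refine (map (g := fun x : α × (ℕ × β) => g (x.1, x.2.1, x.2.2))
      (reverse (PT.snd.comp key)) (hg.comp (PT.fst.pair PT.snd))).congr fun a => ?_
    simp only [hfold, List.reverse_reverse]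
    apply List.ext_getElem <;> simp
  · have h2 := (Pb.const 2).mul hl.size
    have h1 := Pb.const (α := α) 1
    exact ((h2.add h1).add ((hl.size.mul ((((h2.add h1).add hl.size).add h1).add h1)).add h1)).add
      h1
  · intro a l₁ l₂ h
    have hlen : l₁.length ≤ sz (l a) := le_trans (by simp [h]) (length_le_sz (l a))
    simp only [hfold, sz_pair, sz_nat, sz_reverse]
    have := sz_le_mul (l := l₁.mapIdx fun i b => (i, b))
      (M := (2 * sz (l a) + 1) + sz (l a) + 1) (fun x hx => by
        obtain ⟨i, hi, rfl⟩ := List.mem_mapIdx.1 hx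
        have : sz l₁[i] ≤ sz (l a) := sz_le_of_mem (by simp [h])
        simp only [sz_pair, sz_nat]; omega)
    have h3 : (l₁.mapIdx fun i b => (i, b)).length * (2 * sz (l a) + 1 + sz (l a) + 1 + 1) ≤
        sz (l a) * (2 * sz (l a) + 1 + sz (l a) + 1 + 1) := by
      rw [List.length_mapIdx]; gcongr
    omega

/-! ### Booleans -/

theorem and {f g : α → Bool} (hf : PT f) (hg : PT g) : PT (fun a => f a && g a) :=
  (ite (c := fun a => f a = true) (hf.congr fun _ => by simp) hg (const false)).congr fun a => by
    cases f a <;> simp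

theorem or {f g : α → Bool} (hf : PT f) (hg : PT g) : PT (fun a => f a || g a) :=
  (ite (c := fun a => f a = true) (hf.congr fun _ => by simp) (const true) hg).congr fun a => by
    cases f a <;> simp

theorem not {f : α → Bool} (hf : PT f) : PT (fun a => !f a) :=
  (ite (c := fun a => f a = true) (hf.congr fun _ => by simp) (const false)
    (const true)).congr fun a => by cases f a <;> simp

theorem all {l : α → List β} {g : α × β → Bool} (hl : PT l) (hg : PT g) :
    PT (fun a => (l a).all fun b => g (a, b)) :=
  ((any hl hg.not).not).congr fun a => by simp [List.all_eq_not_any_not]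

/-! ### Natural numbers -/

theorem succ {f : α → ℕ} (hf : PT f) : PT (fun a => f a + 1) :=
  ((const ()).pair hf).cast (fun a => a) _ (fun _ => rfl) (fun _ => rfl)

/-- A unary number is a list of units, so arithmetic reduces to list operations: addition is
`append`, truncated subtraction is `drop`, and comparisons follow from subtraction. -/
theorem enc_replicate (n : ℕ) : enc (List.replicate n ()) = enc n := by
  induction n with
  | zero => rfl
  | succ n ih => simp [List.replicate_succ, ih]

theorem units {f : α → ℕ} (hf : PT f) : PT (fun a => List.replicate (f a) ()) :=
  hf.cast (fun a => a) _ (fun _ => rfl) (fun _ => (enc_replicate _).symm)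

theorem length {l : α → List β} (hl : PT l) : PT (fun a => (l a).length) :=
  (map hl (const ())).cast (fun a => a) _ (fun _ => rfl) (fun a => by
    rw [List.map_const', enc_replicate])

theorem add {f g : α → ℕ} (hf : PT f) (hg : PT g) : PT (fun a => f a + g a) :=
  (append hf.units hg.units).cast (fun a => a) _ (fun _ => rfl) (fun a => by
    rw [← enc_replicate, List.replicate_add])

theorem drop {f : α → ℕ} {l : α → List β} (hf : PT f) (hl : PT l) :
    PT (fun a => (l a).drop (f a)) := by
  have := foldl_add (step := fun x : α × List β × Unit => x.2.1.tail) hf.units hl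
    (tail (PT.fst.comp PT.snd)) (q := fun _ => 0) (Pb.const 0) (fun a g b => by
      cases g <;> simp; omega)
  refine this.congr fun a => ?_
  generalize l a = l
  generalize f a = n
  induction n generalizing l with
  | zero => rfl
  | succ n ih => simp [List.replicate_succ, ih]

theorem sub {f g : α → ℕ} (hf : PT f) (hg : PT g) : PT (fun a => f a - g a) :=
  (drop hg hf.units).cast (fun a => a) _ (fun _ => rfl) (fun a => by
    rw [List.drop_replicate, enc_replicate])

theorem eq_zero {f : α → ℕ} (hf : PT f) : PT (fun a => decide (f a = 0)) :=
  (not_nil hf.units).not.congr fun a => by cases f a <;> simp [List.replicate_succ]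

theorem le {f g : α → ℕ} (hf : PT f) (hg : PT g) : PT (fun a => decide (f a ≤ g a)) :=
  (eq_zero (hf.sub hg)).congr fun a => by simp [Nat.sub_eq_zero_iff_le]

theorem lt {f g : α → ℕ} (hf : PT f) (hg : PT g) : PT (fun a => decide (f a < g a)) :=
  (le hf.succ hg).congr fun a => by simp

theorem nat_eq {f g : α → ℕ} (hf : PT f) (hg : PT g) : PT (fun a => decide (f a = g a)) :=
  (and (hf.le hg) (hg.le hf)).congr fun a => by
    rw [← Bool.decide_and]; simp [le_antisymm_iff]

theorem range {f : α → ℕ} (hf : PT f) : PT (fun a => List.range (f a)) :=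
  ((mapIdx (g := fun x : α × ℕ × Unit => x.2.1) hf.units (PT.fst.comp PT.snd))).congr fun a => by
    apply List.ext_getElem <;> simp

/-- Equality of pairs. -/
theorem pair_eq [DecidableEq β] [DecidableEq γ] (h₁ : PT (fun p : β × β => decide (p.1 = p.2)))
    (h₂ : PT (fun p : γ × γ => decide (p.1 = p.2))) :
    PT (fun p : (β × γ) × (β × γ) => decide (p.1 = p.2)) :=
  (and (h₁.comp ((PT.fst.comp PT.fst).pair (PT.fst.comp PT.snd)))
    (h₂.comp ((PT.snd.comp PT.fst).pair (PT.snd.comp PT.snd)))).congr fun p => by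
      rw [← Bool.decide_and]; simp [Prod.ext_iff]

/-- Equality of lists. -/
theorem list_eq [DecidableEq β] (h : PT (fun p : β × β => decide (p.1 = p.2))) :
    PT (fun p : List β × List β => decide (p.1 = p.2)) := by
  have hd : PT (fun x : List β × β => decide (x.1.head? = some x.2)) := by
    refine cases (c := fun x : List β × β => !x.1.isEmpty) (not_nil PT.fst) ?_ ?_
    · have h1 : PT (fun x : {x : List β × β // (!x.1.isEmpty) = true} =>
          (x.1.1.head (by simpa using x.2), x.1.2)) := by
        refine of_expr (.cons (.head (.head (.var 0))) (.tail (.var 0))) ?_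
          (Pb.sz.mono ?_)
        · rintro ⟨⟨l, b⟩, hl⟩ s hs
          cases l with
          | nil => simp at hl
          | cons c l => simp [Expr.eval, hs, BTree.head, BTree.tail]
        · rintro ⟨⟨l, b⟩, hl⟩
          cases l with
          | nil => simp at hl
          | cons c l => simp; omega
      refine (h.comp h1).congr ?_
      rintro ⟨⟨l, b⟩, hl⟩
      cases l with
      | nil => simp at hl
      | cons c l => simp only [List.head_cons, List.head?_cons, Option.some.injEq]; congr
    · refine (const false).congr ?_
      rintro ⟨⟨l, b⟩, hl⟩
      cases l <;> simp at hl ⊢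
  -- The first list is read while the second is consumed. The accumulator records whether all
  -- entries agreed so far and what is left of the second list, which has to be empty at the end.
  have key := foldl_add (α := List β × List β) (l := fun p => p.1) (init := fun p => (true, p.2))
    (step := fun x : (List β × List β) × (Bool × List β) × β =>
      (x.2.1.1 && decide (x.2.1.2.head? = some x.2.2), x.2.1.2.tail))
    PT.fst ((const true).pair PT.snd)
    ((and (PT.fst.comp (PT.fst.comp PT.snd))
      (hd.comp ((PT.snd.comp (PT.fst.comp PT.snd)).pair (PT.snd.comp PT.snd)))).pair
      (tail (PT.snd.comp (PT.fst.comp PT.snd)))) (q := fun _ => 2) (Pb.const 2) ?_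
  · refine (and (PT.fst.comp key) (not (not_nil (PT.snd.comp key)))).congr ?_
    rintro ⟨l, l'⟩
    have : ∀ (l l' : List β) (c : Bool), ((l.foldl (fun (acc : Bool × List β) b =>
        (acc.1 && decide (acc.2.head? = some b), acc.2.tail)) (c, l')).1 &&
        !!(l.foldl (fun (acc : Bool × List β) b =>
        (acc.1 && decide (acc.2.head? = some b), acc.2.tail)) (c, l')).2.isEmpty) =
        (c && decide (l = l')) := by
      intro l
      induction l with
      | nil => intro l' c; cases l' <;> simp
      | cons b l ih =>
        intro l' c
        rw [List.foldl_cons, ih]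
        cases l' with
        | nil => simp
        | cons b' l' =>
          rw [Bool.eq_iff_iff]
          have : b' = b ↔ b = b' := eq_comm
          simp only [List.head?_cons, Option.some.injEq, this, List.tail_cons, Bool.and_eq_true,
            decide_eq_true_eq, and_assoc, List.cons.injEq]
          exact and_congr Iff.rfl (and_congr Iff.rfl decide_eq_true_iff)
    simpa using this l l' true
  · rintro a ⟨c, l⟩ b
    have h1 := sz_bool (c && decide (l.head? = some b))
    have h2 := sz_pos c
    have h3 : sz l.tail ≤ sz l := by cases l <;> simp; omega
    simp only [sz_pair]; omega

theorem mem [DecidableEq β] (h : PT (fun p : β × β => decide (p.1 = p.2))) {f : α → β}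
    {l : α → List β} (hf : PT f) (hl : PT l) : PT (fun a => decide (f a ∈ l a)) :=
  (any (g := fun x : α × β => decide (f x.1 = x.2)) hl
    (h.comp ((hf.comp PT.fst).pair PT.snd))).congr fun a => by
      rw [Bool.eq_iff_iff]; simp

end PT
end WhileLang

namespace HamDP

/-! ## The dynamic program

A state lists, for each index, the number of half-edges that wait at this index, and the name of
the class of this index. -/

abbrev State : Type := List (ℕ × ℕ)

abbrev Table : Type := List State

/-- The number of half-edges that wait at an index. -/
def cnt (s : State) (a : ℕ) : ℕ := (s.getD a (0, 0)).1

/-- The class of an index. -/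
def cls (s : State) (a : ℕ) : ℕ := (s.getD a (0, 0)).2

/-- Change the counts at `a` and `b`, and put the class of `a` and the index `b` into class `y`. -/
def shift (a b ca cb y : ℕ) (s : State) : State :=
  s.mapIdx fun l p => (if l = a then ca else if l = b then cb else p.1,
    if p.2 = cls s a ∨ l = b then y else p.2)

/-- Move `m` half-edges from `a` to `b`. -/
def moveN (m a b : ℕ) (s : State) : State :=
  -- If nothing waits at `b`, its class name carries no information and `b` just enters the class of
  -- `a`. Otherwise the moved half-edges meet those at `b`, and the two classes merge.
  shift a b (cnt s a - m) (cnt s b + m) (if cnt s b = 0 then cls s a else cls s b) s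

/-- Match `m` half-edges at `a` with `m` half-edges at `b`. -/
def cancelN (m a b : ℕ) (s : State) : State :=
  shift a b (cnt s a - m) (cnt s b - m) (cls s b) s

/-- No half-edge waits. -/
def isZero (s : State) : Bool := s.all fun p => decide (p.1 = 0)

/-- Some half-edge waits at an index of class `y`. -/
def live (y : ℕ) (s : State) : Bool := s.any fun p => !decide (p.1 = 0) && decide (p.2 = y)

/-- All results of moving half-edges from `a` to `b`. -/
def moves (a b : ℕ) (s : State) : Table :=
  s :: (List.range (cnt s a)).map fun m => moveN (m + 1) a b s

/-- All results of matching half-edges at `a` with half-edges at `b` that do not close a class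
while half-edges wait in other classes. -/
def cancels (a b : ℕ) (s : State) : Table :=
  s :: (((List.range (cnt s a)).filter fun m => decide (m < cnt s b)).map
    fun m => cancelN (m + 1) a b s).filter fun t => isZero t || live (cls s b) t

/-- Two states side by side, where `N` bounds the class names of the first one. -/
def concat (N : ℕ) (s t : State) : State := s ++ t.map fun p => (p.1, p.2 + N)

/-- The first `L` indices of a state, with short class names. -/
def norm (L : ℕ) (s : State) : State :=
  (List.range L).map fun l => (cnt s l, (s.map fun p => p.2).idxOf (cls s l))

/-- The state of a single vertex with outgoing half-edge labeled `i` and ingoing half-edge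
labeled `j`. -/
def initState (L i j : ℕ) : State :=
  (List.range L).map fun l => (if l = 2 * i + 1 ∨ l = 2 * j then 1 else 0, 0)

/-- A list without its duplicates. -/
def undup (T : Table) : Table := T.foldr (fun s acc => if s ∈ acc then acc else s :: acc) []

/-- Bounds on length, counts, and class names. -/
def small (n k : ℕ) (s : State) : Bool :=
  decide (s.length ≤ 4 * k) && s.all fun p => decide (p.1 ≤ n) && decide (p.2 ≤ 8 * k)

/-- Applied after every step, so that the size of a table is under control whatever the input.
States that describe partial solutions survive by `small_of_shape`. -/
def clean (n k : ℕ) (T : Table) : Table := undup (T.filter fun s => small n k s)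

/-- The leaving and the entering half-edge of a new vertex choose their labels independently. -/
def introT (n k : ℕ) (S : List ℕ) : Table :=
  clean n k (S.flatMap fun i => S.map fun j => initState (2 * k) i j)

/-- If nothing waits on one side of a union, the cycles there are closed and miss the other side, so
such states cannot be part of a Hamiltonian cycle. -/
def catT (n k : ℕ) (T T' : Table) : Table :=
  clean n k (T.flatMap fun s => T'.flatMap fun t =>
    if (isZero s || isZero t) = true then [] else [concat (4 * k) s t])

def moveT (n k a b : ℕ) (T : Table) : Table := clean n k (T.flatMap fun s => moves a b s)

def cancelT (n k a b : ℕ) (T : Table) : Table := clean n k (T.flatMap fun s => cancels a b s)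

def dropT (n k a : ℕ) (T : Table) : Table := clean n k (T.filter fun s => decide (cnt s a = 0))

def normT (n k : ℕ) (T : Table) : Table := clean n k (T.map fun s => norm (2 * k) s)

theorem mem_undup {T : Table} {s : State} : s ∈ undup T ↔ s ∈ T := by
  unfold undup
  induction T with
  | nil => simp
  | cons t T ih =>
    simp only [List.foldr_cons, List.mem_cons]
    split_ifs with h
    · rw [ih]
      constructor
      · exact Or.inr
      · rintro (rfl | h')
        · exact ih.1 h |> fun h => h
        · exact h'
    · rw [List.mem_cons, ih]

theorem nodup_undup (T : Table) : (undup T).Nodup := by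
  unfold undup
  induction T with
  | nil => simp
  | cons t T ih =>
    simp only [List.foldr_cons]
    split_ifs with h
    · exact ih
    · exact List.nodup_cons.2 ⟨h, ih⟩

theorem mem_clean {n k : ℕ} {T : Table} {s : State} :
    s ∈ clean n k T ↔ s ∈ T ∧ small n k s = true := by
  rw [clean, mem_undup, List.mem_filter]

/-! ### Counts and classes of the results -/

theorem cnt_of_le {s : State} {l : ℕ} (h : s.length ≤ l) : cnt s l = 0 := by
  unfold cnt; rw [List.getD_eq_default _ _ h]

theorem cnt_mk {s : State} {l : ℕ} (h : l < s.length) : cnt s l = s[l].1 := by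
  simp [cnt, h]

theorem cls_mk {s : State} {l : ℕ} (h : l < s.length) : cls s l = s[l].2 := by
  simp [cls, h]

theorem length_shift (a b ca cb y : ℕ) (s : State) : (shift a b ca cb y s).length = s.length := by
  simp [shift]

theorem cnt_shift {a b ca cb y : ℕ} {s : State} {l : ℕ} (h : l < s.length) :
    cnt (shift a b ca cb y s) l = if l = a then ca else if l = b then cb else cnt s l := by
  rw [cnt_mk (by rwa [length_shift]), cnt_mk h]; simp [shift]

theorem cls_shift {a b ca cb y : ℕ} {s : State} {l : ℕ} (h : l < s.length) :
    cls (shift a b ca cb y s) l = if cls s l = cls s a ∨ l = b then y else cls s l := by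
  rw [cls_mk (by rwa [length_shift]), cls_mk h]; simp [shift]

theorem isZero_iff {s : State} : isZero s = true ↔ ∀ l, cnt s l = 0 := by
  simp only [isZero, List.all_eq_true, decide_eq_true_eq]
  constructor
  · intro h l
    by_cases hl : l < s.length
    · rw [cnt_mk hl]; exact h _ (List.getElem_mem hl)
    · exact cnt_of_le (by omega)
  · intro h p hp
    obtain ⟨l, hl, rfl⟩ := List.getElem_of_mem hp
    rw [← cnt_mk hl]; exact h l

theorem live_iff {y : ℕ} {s : State} : live y s = true ↔ ∃ l, cnt s l ≠ 0 ∧ cls s l = y := by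
  simp only [live, List.any_eq_true, Bool.and_eq_true, Bool.not_eq_true', decide_eq_false_iff_not,
    decide_eq_true_eq]
  constructor
  · rintro ⟨p, hp, h1, h2⟩
    obtain ⟨l, hl, rfl⟩ := List.getElem_of_mem hp
    exact ⟨l, by rwa [cnt_mk hl], by rwa [cls_mk hl]⟩
  · rintro ⟨l, h1, h2⟩
    have hl : l < s.length := by
      by_contra h
      exact h1 (cnt_of_le (by omega))
    rw [cnt_mk hl] at h1
    rw [cls_mk hl] at h2
    exact ⟨_, List.getElem_mem hl, h1, h2⟩

theorem cnt_concat {N : ℕ} {s t : State} {l : ℕ} :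
    cnt (concat N s t) l = if l < s.length then cnt s l else cnt t (l - s.length) := by
  unfold cnt concat
  split_ifs with h
  · rw [List.getD_append _ _ _ _ h]
  · rw [List.getD_append_right _ _ _ _ (by omega)]
    by_cases h' : l - s.length < t.length
    · simp [h']
    · simp only [not_lt] at h'
      rw [List.getD_eq_default _ _ (by simpa using h'), List.getD_eq_default _ _ h']

theorem cls_concat_left {N : ℕ} {s t : State} {l : ℕ} (h : l < s.length) :
    cls (concat N s t) l = cls s l := by
  unfold cls concat
  rw [List.getD_append _ _ _ _ h]

theorem cls_concat_right {N : ℕ} {s t : State} {l : ℕ} (h : l < t.length) :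
    cls (concat N s t) (s.length + l) = cls t l + N := by
  unfold cls concat
  rw [List.getD_append_right _ _ _ _ (by omega)]
  simp [h]

theorem cnt_norm {L : ℕ} {s : State} {l : ℕ} (h : l < L) : cnt (norm L s) l = cnt s l := by
  rw [cnt_mk (by simpa [norm] using h)]; simp [norm]

theorem cls_norm {L : ℕ} {s : State} {l : ℕ} (h : l < L) :
    cls (norm L s) l = (s.map fun p => p.2).idxOf (cls s l) := by
  rw [cls_mk (by simpa [norm] using h)]; simp [norm]

theorem cls_mem {s : State} {l : ℕ} (h : l < s.length) : cls s l ∈ s.map fun p => p.2 := by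
  rw [cls_mk h]; exact List.mem_map_of_mem (List.getElem_mem h)

theorem cnt_initState {L i j l : ℕ} (h : l < L) :
    cnt (initState L i j) l = if l = 2 * i + 1 ∨ l = 2 * j then 1 else 0 := by
  rw [cnt_mk (by simpa [initState] using h)]; simp [initState]

theorem cls_initState {L i j l : ℕ} : cls (initState L i j) l = 0 := by
  by_cases h : l < L
  · rw [cls_mk (by simpa [initState] using h)]; simp [initState]
  · simp only [cls]
    rw [List.getD_eq_default]
    simpa [initState] using h

/-- Length of a state and strict bound on its class names. -/
def Shape (L N : ℕ) (s : State) : Prop := s.length = L ∧ ∀ l < L, cls s l < N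

theorem Shape.shift {L N a b ca cb y : ℕ} {s : State} (h : Shape L N s) (hy : y < N) :
    Shape L N (shift a b ca cb y s) := by
  refine ⟨by rw [length_shift]; exact h.1, fun l hl => ?_⟩
  rw [cls_shift (by rw [h.1]; exact hl)]
  split_ifs
  · exact hy
  · exact h.2 l hl

theorem Shape.moveN {L N m a b : ℕ} {s : State} (h : Shape L N s) (ha : a < L) (hb : b < L) :
    Shape L N (moveN m a b s) := by
  refine h.shift ?_
  split_ifs
  · exact h.2 a ha
  · exact h.2 b hb

theorem Shape.cancelN {L N m a b : ℕ} {s : State} (h : Shape L N s) (hb : b < L) :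
    Shape L N (cancelN m a b s) := h.shift (h.2 b hb)

theorem small_of_shape {n k L N : ℕ} {s : State} (h : Shape L N s) (hL : L ≤ 4 * k)
    (hN : N ≤ 8 * k) (hc : ∀ l, cnt s l ≤ n) : small n k s = true := by
  simp only [small, h.1, Bool.and_eq_true, decide_eq_true_eq, List.all_eq_true]
  refine ⟨hL, fun p hp => ?_⟩
  obtain ⟨l, hl, rfl⟩ := List.getElem_of_mem hp
  rw [← cnt_mk hl, ← cls_mk hl]
  have := h.2 l (by rwa [← h.1])
  exact ⟨hc l, by omega⟩

end HamDP

namespace HamDP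

/-! ## Partial solutions

A partial solution tells of every half-edge of a vertex of `X` whether it waits at an index or is
matched with another half-edge. The half-edge `(v, true)` leaves `v`, and `(v, false)` enters it. -/

variable {V : Type}

/-- What happened to each half-edge. -/
abbrev Partial (V : Type) : Type := V × Bool → ℕ ⊕ (V × Bool)

/-- The admissible partial solutions: `adm` tells which indices a vertex may use, and `Q` which
half-edges may be matched. -/
def Val (X : Set V) (adm : V → ℕ → Prop) (Q : V × Bool → V × Bool → Prop) (f : Partial V) : Prop :=
  ∀ h : V × Bool, h.1 ∈ X → (∃ l, f h = .inl l ∧ adm h.1 l ∧ l.bodd = h.2) ∨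
    ∃ g : V × Bool, g.1 ∈ X ∧ f h = .inr g ∧ f g = .inr h ∧ h.2 ≠ g.2 ∧ Q h g

/-- Two vertices that have half-edges at the same index, or matched half-edges. -/
def Link (X : Set V) (f : Partial V) (u v : V) : Prop :=
  u ∈ X ∧ v ∈ X ∧ ((∃ b l, f (u, b) = .inl l ∧ f (v, b) = .inl l) ∨
    ∃ b c, f (u, b) = .inr (v, c))

/-- The equivalence relation generated by `E` and the links of a partial solution. -/
def grow (E : Setoid V) (X : Set V) (f : Partial V) : Setoid V :=
  E ⊔ Relation.EqvGen.setoid (Link X f)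

theorem le_grow (E : Setoid V) (X : Set V) (f : Partial V) : E ≤ grow E X f := le_sup_left

theorem grow_of_link {E : Setoid V} {X : Set V} {f : Partial V} {u v : V} (h : Link X f u v) :
    (grow E X f).r u v :=
  (le_sup_right : _ ≤ grow E X f) (.rel _ _ h)

theorem grow_le {E E' : Setoid V} {X : Set V} {f : Partial V} (h : E ≤ E')
    (h' : ∀ u v, Link X f u v → E'.r u v) : grow E X f ≤ E' :=
  sup_le h (Setoid.eqvGen_le h')

theorem Link.congr {X : Set V} {f f' : Partial V} (hf : ∀ h : V × Bool, h.1 ∈ X → f h = f' h)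
    {u v : V} (h : Link X f u v) : Link X f' u v := by
  obtain ⟨hu, hv, h⟩ := h
  refine ⟨hu, hv, ?_⟩
  rcases h with ⟨b, l, h1, h2⟩ | ⟨b, c, h1⟩
  · exact .inl ⟨b, l, by rw [← hf _ hu, h1], by rw [← hf _ hv, h2]⟩
  · exact .inr ⟨b, c, by rw [← hf _ hu, h1]⟩

theorem grow_congr {X : Set V} {f f' : Partial V} (hf : ∀ h : V × Bool, h.1 ∈ X → f h = f' h)
    (E : Setoid V) : grow E X f = grow E X f' :=
  le_antisymm (grow_le (le_grow _ _ _) fun _ _ h => grow_of_link (h.congr hf))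
    (grow_le (le_grow _ _ _) fun _ _ h => grow_of_link (h.congr fun x hx => (hf x hx).symm))

theorem Val.congr {X : Set V} {adm adm' : V → ℕ → Prop} {Q Q' : V × Bool → V × Bool → Prop}
    {f f' : Partial V} (h : Val X adm Q f) (hf : ∀ h : V × Bool, h.1 ∈ X → f h = f' h)
    (ha : ∀ v ∈ X, ∀ l, adm v l → adm' v l)
    (hQ : ∀ h g : V × Bool, h.1 ∈ X → g.1 ∈ X → h.2 ≠ g.2 → Q h g → Q' h g) :
    Val X adm' Q' f' := by
  intro x hx
  rcases h x hx with ⟨l, h1, h2, h3⟩ | ⟨g, h1, h2, h3, h4, h5⟩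
  · exact .inl ⟨l, by rw [← hf _ hx, h1], ha _ hx _ h2, h3⟩
  · exact .inr ⟨g, h1, by rw [← hf _ hx, h2], by rw [← hf _ h1, h3], h4, hQ _ _ hx h1 h4 h5⟩

/-! ### Exchanging two half-edges -/

/-- A partial solution with the half-edges renamed by an involution. -/
def conj (π : Equiv.Perm (V × Bool)) (f : Partial V) : Partial V := fun h => (f (π h)).map id π

/-- The involutions of the half-edges that respect `X` and the direction. -/
structure Adapted (X : Set V) (π : Equiv.Perm (V × Bool)) : Prop where
  invol : ∀ h, π (π h) = h
  snd : ∀ h, (π h).2 = h.2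
  mem : ∀ h, (π h).1 ∈ X ↔ h.1 ∈ X

theorem conj_conj {X : Set V} {π : Equiv.Perm (V × Bool)} (hπ : Adapted X π) (f : Partial V) :
    conj π (conj π f) = f := by
  funext h
  simp only [conj, hπ.invol]
  cases f h <;> simp [hπ.invol]

theorem conj_inl {π : Equiv.Perm (V × Bool)} {f : Partial V} {h : V × Bool} {l : ℕ} :
    conj π f h = .inl l ↔ f (π h) = .inl l := by
  unfold conj; cases f (π h) <;> simp

theorem conj_inr {X : Set V} {π : Equiv.Perm (V × Bool)} (hπ : Adapted X π) {f : Partial V}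
    {h g : V × Bool} : conj π f h = .inr g ↔ f (π h) = .inr (π g) := by
  unfold conj; cases f (π h) with
  | inl l => simp
  | inr x =>
    simp only [Sum.map_inr, Sum.inr.injEq]
    constructor
    · rintro rfl; rw [hπ.invol]
    · rintro rfl; rw [hπ.invol]

theorem adapted_swap [DecidableEq V] {X : Set V} {u v : V} (b : Bool) (hu : u ∈ X) (hv : v ∈ X) :
    Adapted X (Equiv.swap (u, b) (v, b)) where
  invol := by simp
  snd h := by
    rw [Equiv.swap_apply_def]; split_ifs with h1 h2 <;> simp [*]
  mem h := by
    rw [Equiv.swap_apply_def]; split_ifs with h1 h2 <;> simp [*]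

theorem rel_swap [DecidableEq V] {E : Setoid V} {u v : V} (b : Bool) (h : E.r u v) (x : V × Bool) :
    E.r (Equiv.swap (u, b) (v, b) x).1 x.1 := by
  rw [Equiv.swap_apply_def]
  split_ifs with h1 h2
  · subst h1; exact E.symm h
  · subst h2; exact h
  · exact E.refl _

/-- A link of the renamed solution between two vertices is a link of the original one between the
renamed vertices, and these are `E`-equivalent to the given ones. -/
theorem grow_conj_le {X : Set V} {π : Equiv.Perm (V × Bool)} (hπ : Adapted X π) {E : Setoid V}
    (hE : ∀ x, E.r (π x).1 x.1) (f : Partial V) : grow E X (conj π f) ≤ grow E X f := by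
  refine grow_le (le_grow _ _ _) fun u v h => ?_
  obtain ⟨hu, hv, h⟩ := h
  have hE' : ∀ x, (grow E X f).r (π x).1 x.1 := fun x => le_grow _ _ _ (hE x)
  rcases h with ⟨b, l, h1, h2⟩ | ⟨b, c, h1⟩
  · rw [conj_inl] at h1 h2
    have h3 : Link X f (π (u, b)).1 (π (v, b)).1 := by
      refine ⟨(hπ.mem _).2 hu, (hπ.mem _).2 hv, .inl ⟨b, l, ?_, ?_⟩⟩
      · rw [← h1]; congr 1; exact Prod.ext rfl (hπ.snd (u, b)).symm
      · rw [← h2]; congr 1; exact Prod.ext rfl (hπ.snd (v, b)).symm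
    exact (grow E X f).trans ((grow E X f).symm (hE' (u, b)))
      ((grow E X f).trans (grow_of_link h3) (hE' (v, b)))
  · rw [conj_inr hπ] at h1
    have h3 : Link X f (π (u, b)).1 (π (v, c)).1 := by
      refine ⟨(hπ.mem _).2 hu, (hπ.mem _).2 hv, .inr ⟨b, c, ?_⟩⟩
      convert h1 using 2
      · exact Prod.ext rfl (hπ.snd (u, b)).symm
      · exact Prod.ext rfl (hπ.snd (v, c)).symm
    exact (grow E X f).trans ((grow E X f).symm (hE' (u, b)))
      ((grow E X f).trans (grow_of_link h3) (hE' (v, c)))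

theorem grow_conj {X : Set V} {π : Equiv.Perm (V × Bool)} (hπ : Adapted X π) {E : Setoid V}
    (hE : ∀ x, E.r (π x).1 x.1) (f : Partial V) : grow E X (conj π f) = grow E X f := by
  refine le_antisymm (grow_conj_le hπ hE f) ?_
  have := grow_conj_le hπ hE (conj π f)
  rwa [conj_conj hπ] at this

/-- Families of partial solutions, each with an equivalence relation on the vertices, in which any
two sets of cycles that the equivalence relation connects can be connected by exchanging two
half-edges. -/
structure Fam [DecidableEq V] (X : Set V) (adm : V → ℕ → Prop) (Q : V × Bool → V × Bool → Prop)
    (C : Set (Partial V × Setoid V)) : Prop where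
  congr : ∀ f f' E, (f, E) ∈ C → (∀ h : V × Bool, h.1 ∈ X → f h = f' h) → (f', E) ∈ C
  val : ∀ f E, (f, E) ∈ C → Val X adm Q f
  swap : ∀ f E, (f, E) ∈ C → ∀ A : V → Prop,
    (∀ h g : V × Bool, h.1 ∈ X → f h = .inr g → (A h.1 ↔ A g.1)) →
    (∃ u v, E.r u v ∧ A u ∧ ¬ A v) →
    ∃ u v b, u ∈ X ∧ v ∈ X ∧ A u ∧ ¬ A v ∧ E.r u v ∧
      (conj (Equiv.swap (u, b) (v, b)) f, E) ∈ C

/-- Exchanging two half-edges that wait at the same index changes nothing. -/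
theorem conj_swap_eq [DecidableEq V] {X : Set V} {adm : V → ℕ → Prop}
    {Q : V × Bool → V × Bool → Prop}
    {f : Partial V} (hf : Val X adm Q f) {u v : V} {b : Bool} {l : ℕ} (hu : f (u, b) = .inl l)
    (hv : f (v, b) = .inl l) {h : V × Bool} (hX : h.1 ∈ X) :
    conj (Equiv.swap (u, b) (v, b)) f h = f h := by
  unfold conj
  by_cases h1 : h = (u, b)
  · rw [h1, Equiv.swap_apply_left, hu, hv]; rfl
  by_cases h2 : h = (v, b)
  · rw [h2, Equiv.swap_apply_right, hu, hv]; rfl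
  rw [Equiv.swap_apply_of_ne_of_ne h1 h2]
  rcases hf h hX with ⟨l, h3, -⟩ | ⟨g, -, h3, h4, -⟩
  · rw [h3]; rfl
  · rw [h3, Sum.map_inr, Equiv.swap_apply_of_ne_of_ne]
    · rintro rfl; simp [h4] at hu
    · rintro rfl; simp [h4] at hv

/-- The exchange argument, for any step relation `R` that commutes with renaming half-edges and
keeps matches. If the old relation `E` crosses `A`, the exchange provided by `C` is carried through
the step. If it does not, some new link crosses `A`. A match cannot, by the assumption on `A`, so
two half-edges waiting at a common index lie on different sides; exchanging these leaves the partial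
solution unchanged on `X`. -/
theorem Fam.step [DecidableEq V] {X : Set V} {adm adm' : V → ℕ → Prop} {Q Q' : V × Bool → V ×
    Bool → Prop}
    {C : Set (Partial V × Setoid V)} (hC : Fam X adm Q C) (R : Partial V → Partial V → Prop)
    (hcongr : ∀ f f' f'', R f f' → (∀ h : V × Bool, h.1 ∈ X → f' h = f'' h) → R f f'')
    (hequi : ∀ π f f', Adapted X π → R f f' → R (conj π f) (conj π f'))
    (hinr : ∀ f f', R f f' → ∀ h g : V × Bool, h.1 ∈ X → f h = .inr g → f' h = .inr g)
    (hval : ∀ f f', R f f' → Val X adm Q f → Val X adm' Q' f') :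
    Fam X adm' Q' {q | ∃ f E, (f, E) ∈ C ∧ R f q.1 ∧ q.2 = grow E X q.1} where
  congr := by
    rintro f f' _ ⟨f₀, E, h1, h2, hq⟩ hf
    obtain rfl : _ = grow E X f := hq
    exact ⟨f₀, E, h1, hcongr _ _ _ h2 hf, grow_congr hf E⟩
  val := by
    rintro f _ ⟨f₀, E, h1, h2, -⟩
    exact hval _ _ h2 (hC.val _ _ h1)
  swap := by
    rintro f _ ⟨f₀, E, h1, h2, hq⟩ A hA hcross
    obtain rfl : _ = grow E X f := hq
    have hv := hval _ _ h2 (hC.val _ _ h1)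
    simp only at h2 hA hcross ⊢
    by_cases hE : ∃ u v, E.r u v ∧ A u ∧ ¬ A v
    · obtain ⟨u, v, b, hu, hv, hAu, hAv, huv, hmem⟩ := hC.swap f₀ E h1 A
        (fun h g hX hg => hA h g hX (hinr _ _ h2 h g hX hg)) hE
      have hπ := adapted_swap b hu hv
      refine ⟨u, v, b, hu, hv, hAu, hAv, le_grow _ _ _ huv, _, E, hmem, hequi _ _ _ hπ h2, ?_⟩
      exact (grow_conj hπ (rel_swap b huv) f).symm
    · have hEA : E ≤ Setoid.ker A := by
        intro u v huv
        rw [Setoid.ker_def]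
        by_contra hne
        by_cases hu : A u
        · exact hE ⟨u, v, huv, hu, fun hv => hne (by simp [hu, hv])⟩
        · exact hE ⟨v, u, E.symm huv, by by_contra hv; exact hne (by simp [hu, hv]), hu⟩
      -- Otherwise `A` would be constant on the classes of the relation generated by `E` and the
      -- links.
      have : ∃ u v, Link X f u v ∧ ¬ (A u ↔ A v) := by
        by_contra hno
        push Not at hno
        have hle : grow E X f ≤ Setoid.ker A := grow_le hEA fun u v h => propext (hno u v h)
        obtain ⟨u, v, huv, hu, hv⟩ := hcross
        have : A u = A v := hle huv
        exact hv (this ▸ hu)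
      obtain ⟨u, v, hl, hne⟩ := this
      obtain ⟨hu, hv', hl' | ⟨b, c, hbc⟩⟩ := hl
      · obtain ⟨b, l, hb, hb'⟩ := hl'
        have key : ∀ u v, u ∈ X → v ∈ X → f (u, b) = .inl l → f (v, b) = .inl l → A u → ¬ A v →
            ∃ u v b, u ∈ X ∧ v ∈ X ∧ A u ∧ ¬ A v ∧ (grow E X f).r u v ∧
              (conj (Equiv.swap (u, b) (v, b)) f, grow E X f) ∈
                {q : Partial V × Setoid V | ∃ f E, (f, E) ∈ C ∧ R f q.1 ∧ q.2 = grow E X q.1} := by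
          intro u v hu hv' hb hb' hAu hAv
          have heq : ∀ h : V × Bool, h.1 ∈ X → f h = conj (Equiv.swap (u, b) (v, b)) f h :=
            fun h hX => (conj_swap_eq hv hb hb' hX).symm
          exact ⟨u, v, b, hu, hv', hAu, hAv, grow_of_link ⟨hu, hv', .inl ⟨b, l, hb, hb'⟩⟩,
            f₀, E, h1, hcongr _ _ _ h2 heq, grow_congr heq E⟩
        by_cases hAu : A u
        · exact key u v hu hv' hb hb' hAu fun hAv => hne (by simp [hAu, hAv])
        · exact key v u hv' hu hb' hb (by by_contra hAv; exact hne (by simp [hAu, hAv])) hAu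
      · exact absurd (hA (u, b) (v, c) hu hbc) hne

/-- Families for disjoint sets of vertices can be combined. -/
theorem Fam.union [DecidableEq V] {X X' : Set V} {adm adm' : V → ℕ → Prop} {Q Q' : V × Bool → V
    × Bool → Prop}
    {C C' : Set (Partial V × Setoid V)} (hC : Fam X adm Q C) (hC' : Fam X' adm' Q' C')
    (hX : Disjoint X X') :
    Fam (X ∪ X') (fun v l => v ∈ X ∧ adm v l ∨ v ∈ X' ∧ adm' v l)
      (fun h g => h.1 ∈ X ∧ g.1 ∈ X ∧ Q h g ∨ h.1 ∈ X' ∧ g.1 ∈ X' ∧ Q' h g)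
      {q | ∃ E E', (q.1, E) ∈ C ∧ (q.1, E') ∈ C' ∧ q.2 = E ⊔ E'} where
  congr := by
    rintro f f' _ ⟨E, E', h1, h2, rfl⟩ hf
    exact ⟨E, E', hC.congr _ _ _ h1 fun h hX => hf h (.inl hX),
      hC'.congr _ _ _ h2 fun h hX => hf h (.inr hX), rfl⟩
  val := by
    rintro f _ ⟨E, E', h1, h2, rfl⟩ h (hX | hX)
    · rcases hC.val _ _ h1 h hX with ⟨l, k1, k2, k3⟩ | ⟨g, k1, k2, k3, k4, k5⟩
      · exact .inl ⟨l, k1, .inl ⟨hX, k2⟩, k3⟩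
      · exact .inr ⟨g, .inl k1, k2, k3, k4, .inl ⟨hX, k1, k5⟩⟩
    · rcases hC'.val _ _ h2 h hX with ⟨l, k1, k2, k3⟩ | ⟨g, k1, k2, k3, k4, k5⟩
      · exact .inl ⟨l, k1, .inr ⟨hX, k2⟩, k3⟩
      · exact .inr ⟨g, .inr k1, k2, k3, k4, .inr ⟨hX, k1, k5⟩⟩
  swap := by
    rintro f _ ⟨E, E', h1, h2, rfl⟩ A hA hcross
    simp only at h1 h2 hA hcross ⊢
    -- An exchange on one side does not affect the other, because half-edges are matched within
    -- their own side.
    have hfix : ∀ {Y Y' : Set V} {a : V → ℕ → Prop} {q : V × Bool → V × Bool → Prop} {u v : V}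
        {b : Bool}, Disjoint Y Y' → Val Y' a q f → u ∈ Y → v ∈ Y → ∀ h : V × Bool, h.1 ∈ Y' →
        f h = conj (Equiv.swap (u, b) (v, b)) f h := by
      intro Y Y' a q u v b hY hval hu hv h hh
      have hne : ∀ g : V × Bool, g.1 ∈ Y' → Equiv.swap (u, b) (v, b) g = g := by
        intro g hg
        refine Equiv.swap_apply_of_ne_of_ne ?_ ?_
        · rintro rfl; exact Set.disjoint_left.1 hY hu hg
        · rintro rfl; exact Set.disjoint_left.1 hY hv hg
      unfold conj
      rw [hne h hh]
      rcases hval h hh with ⟨l, k1, -⟩ | ⟨g, k1, k2, -⟩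
      · rw [k1]; rfl
      · rw [k2, Sum.map_inr, hne g k1]
    by_cases hE : ∃ u v, E.r u v ∧ A u ∧ ¬ A v
    · obtain ⟨u, v, b, hu, hv, hAu, hAv, huv, hmem⟩ := hC.swap f E h1 A
        (fun h g hX hg => hA h g (.inl hX) hg) hE
      exact ⟨u, v, b, .inl hu, .inl hv, hAu, hAv, (le_sup_left : E ≤ E ⊔ E') huv, E, E', hmem,
        hC'.congr _ _ _ h2 (hfix hX (hC'.val _ _ h2) hu hv), rfl⟩
    by_cases hE' : ∃ u v, E'.r u v ∧ A u ∧ ¬ A v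
    · obtain ⟨u, v, b, hu, hv, hAu, hAv, huv, hmem⟩ := hC'.swap f E' h2 A
        (fun h g hX hg => hA h g (.inr hX) hg) hE'
      exact ⟨u, v, b, .inr hu, .inr hv, hAu, hAv, (le_sup_right : E' ≤ E ⊔ E') huv, E, E',
        hC.congr _ _ _ h1 (hfix hX.symm (hC.val _ _ h1) hu hv), hmem, rfl⟩
    have hker : ∀ D : Setoid V, (¬ ∃ u v, D.r u v ∧ A u ∧ ¬ A v) → D ≤ Setoid.ker A := by
      intro D hD u v huv
      rw [Setoid.ker_def]
      by_contra hne
      by_cases hu : A u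
      · exact hD ⟨u, v, huv, hu, fun hv => hne (by simp [hu, hv])⟩
      · exact hD ⟨v, u, D.symm huv, by by_contra hv; exact hne (by simp [hu, hv]), hu⟩
    obtain ⟨u, v, huv, hu, hv⟩ := hcross
    have : A u = A v := (sup_le (hker E hE) (hker E' hE') : E ⊔ E' ≤ Setoid.ker A) huv
    exact absurd (this ▸ hu) hv

end HamDP

namespace HamDP

variable {V : Type} [Fintype V] [DecidableEq V]

/-! ## Tables that describe the partial solutions -/

open Classical in
/-- The half-edges that wait at an index. -/
noncomputable def tok (X : Set V) (f : Partial V) (l : ℕ) : Finset (V × Bool) :=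
  Finset.univ.filter fun h => h.1 ∈ X ∧ f h = .inl l

theorem mem_tok {X : Set V} {f : Partial V} {l : ℕ} {h : V × Bool} :
    h ∈ tok X f l ↔ h.1 ∈ X ∧ f h = .inl l := by simp [tok]

/-- The state describes the partial solution, and half-edges that wait in the same class belong to
equivalent vertices. -/
structure Inv (X : Set V) (f : Partial V) (E : Setoid V) (s : State) : Prop where
  count : ∀ l, cnt s l = (tok X f l).card
  classes : ∀ h g l l', h ∈ tok X f l → g ∈ tok X f l' → cls s l = cls s l' → E.r h.1 g.1
  reach : ∀ v ∈ X, (∃ h l, h ∈ tok X f l ∧ E.r v h.1) ∨ (∀ l, tok X f l = ∅) ∧ ∀ w ∈ X, E.r v w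

/-- The state describes the partial solution, and the vertices can be colored by class names such
that matched half-edges belong to vertices of the same color. -/
structure CInv (X : Set V) (f : Partial V) (κ : V → ℕ) (s : State) : Prop where
  count : ∀ l, cnt s l = (tok X f l).card
  classes : ∀ h l, h ∈ tok X f l → κ h.1 = cls s l
  matched : ∀ h g : V × Bool, h.1 ∈ X → f h = .inr g → κ h.1 = κ g.1

/-- The table describes exactly the partial solutions with the given vertices, admissible indices,
and admissible matches. -/
structure Spec (L N : ℕ) (T : Table) (X : Set V) (adm : V → ℕ → Prop)
    (Q : V × Bool → V × Bool → Prop) : Prop where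
  shape : ∀ s ∈ T, Shape L N s
  lt : ∀ v ∈ X, ∀ l, adm v l → l < L
  sound : ∃ C, Fam X adm Q C ∧ ∀ s ∈ T, ∃ f E, (f, E) ∈ C ∧ Inv X f E s
  complete : ∀ F : V × Bool → V × Bool,
    (∀ C : Set V, C.Nonempty → (∀ h : V × Bool, h.1 ∈ C → (F h).1 ∈ C) → C = Set.univ) →
    ∀ f, Val X adm Q f → (∀ h g : V × Bool, h.1 ∈ X → f h = .inr g → F h = g) →
    ∃ s ∈ T, ∃ κ, CInv X f κ s

theorem tok_congr {X : Set V} {f f' : Partial V} (hf : ∀ h : V × Bool, h.1 ∈ X → f h = f' h)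
    (l : ℕ) : tok X f l = tok X f' l := by
  ext h
  rw [mem_tok, mem_tok]
  exact and_congr_right fun hX => by rw [hf h hX]

theorem CInv.congr {X : Set V} {f f' : Partial V} {κ : V → ℕ} {s : State} (h : CInv X f κ s)
    (hf : ∀ h : V × Bool, h.1 ∈ X → f h = f' h) : CInv X f' κ s where
  count l := by rw [h.count, tok_congr hf]
  classes x l hx := h.classes x l (by rwa [tok_congr hf])
  matched x g hX hg := h.matched x g hX (by rwa [hf x hX])

theorem Inv.congr {X : Set V} {f f' : Partial V} {E E' : Setoid V} {s : State} (h : Inv X f E s)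
    (hf : ∀ h : V × Bool, h.1 ∈ X → f h = f' h) (hE : E ≤ E') : Inv X f' E' s where
  count l := by rw [h.count, tok_congr hf]
  classes x g l l' hx hg hl := hE (h.classes x g l l' (by rwa [tok_congr hf])
    (by rwa [tok_congr hf]) hl)
  reach v hv := by
    simp only [← tok_congr hf]
    rcases h.reach v hv with ⟨x, l, h1, h2⟩ | ⟨h1, h2⟩
    · exact .inl ⟨x, l, h1, hE h2⟩
    · exact .inr ⟨h1, fun w hw => hE (h2 w hw)⟩

/-- The parity of an index fixes the direction of the half-edges that wait there, so each vertex
contributes at most one. -/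
theorem Val.card_tok_le {X : Set V} {adm : V → ℕ → Prop} {Q : V × Bool → V × Bool → Prop}
    {f : Partial V} (h : Val X adm Q f) (l : ℕ) : (tok X f l).card ≤ Fintype.card V := by
  have : tok X f l ⊆ Finset.univ.image fun v => (v, l.bodd) := by
    intro x hx
    rw [mem_tok] at hx
    rcases h x hx.1 with ⟨l', h1, -, h3⟩ | ⟨g, -, h1, -⟩
    · rw [hx.2] at h1
      obtain rfl := Sum.inl_injective h1
      simp only [Finset.mem_image, Finset.mem_univ, true_and]
      exact ⟨x.1, by rw [h3]⟩
    · rw [hx.2] at h1; cases h1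
  exact (Finset.card_le_card this).trans (Finset.card_image_le.trans (by simp))

theorem Val.bodd_eq {X : Set V} {adm : V → ℕ → Prop} {Q : V × Bool → V × Bool → Prop}
    {f : Partial V} (h : Val X adm Q f) {l : ℕ} {x : V × Bool} (hx : x ∈ tok X f l) :
    l.bodd = x.2 := by
  rw [mem_tok] at hx
  rcases h x hx.1 with ⟨l', h1, -, h3⟩ | ⟨g, -, h1, -⟩
  · rw [hx.2] at h1
    obtain rfl := Sum.inl_injective h1
    exact h3
  · rw [hx.2] at h1; cases h1

theorem Spec.congr {L N N' : ℕ} {T : Table} {X : Set V} {adm adm' : V → ℕ → Prop}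
    {Q Q' : V × Bool → V × Bool → Prop} (h : Spec L N T X adm Q)
    (ha : ∀ v ∈ X, ∀ l, adm v l ↔ adm' v l)
    (hQ : ∀ h g : V × Bool, h.1 ∈ X → g.1 ∈ X → h.2 ≠ g.2 → (Q h g ↔ Q' h g)) (hN : N ≤ N') :
    Spec L N' T X adm' Q' where
  shape s hs := ⟨(h.shape s hs).1, fun l hl => ((h.shape s hs).2 l hl).trans_le hN⟩
  lt v hv l hl := h.lt v hv l ((ha v hv l).2 hl)
  sound := by
    obtain ⟨C, hC, hs⟩ := h.sound
    exact ⟨C, ⟨hC.congr, fun f E hf => (hC.val f E hf).congr (fun _ _ => rfl)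
      (fun v hv l => (ha v hv l).1) (fun x g h1 h2 h3 => (hQ x g h1 h2 h3).1), hC.swap⟩, hs⟩
  complete F hF f hf hfF := h.complete F hF f (hf.congr (fun _ _ => rfl)
      (fun v hv l => (ha v hv l).2) (fun x g h1 h2 h3 => (hQ x g h1 h2 h3).2)) hfF

/-! ### Moving -/

theorem cnt_shift' {a b ca cb y : ℕ} {s : State} (ha : a < s.length) (hb : b < s.length) (l : ℕ) :
    cnt (shift a b ca cb y s) l = if l = a then ca else if l = b then cb else cnt s l := by
  by_cases hl : l < s.length
  · exact cnt_shift hl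
  · rw [cnt_of_le (by rw [length_shift]; omega), cnt_of_le (s := s) (by omega),
      if_neg (by omega), if_neg (by omega)]

theorem card_tok_move {X : Set V} {f f' : Partial V} {Z : Finset (V × Bool)} {a b : ℕ}
    (hab : a ≠ b) (hZ : Z ⊆ tok X f a)
    (hf : ∀ h : V × Bool, h.1 ∈ X → f' h = if h ∈ Z then .inl b else f h) (l : ℕ) :
    (tok X f' l).card = if l = a then (tok X f a).card - Z.card else
      if l = b then (tok X f b).card + Z.card else (tok X f l).card := by
  have hZ' : ∀ h ∈ Z, h.1 ∈ X ∧ f h = .inl a := fun h hh => mem_tok.1 (hZ hh)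
  split_ifs with h1 h2
  · subst h1
    rw [← Finset.card_sdiff_of_subset hZ]
    congr 1
    ext h
    rw [Finset.mem_sdiff, mem_tok, mem_tok]
    constructor
    · rintro ⟨hX, hh⟩
      rw [hf h hX] at hh
      split_ifs at hh with hz
      · exact absurd (Sum.inl_injective hh).symm hab
      · exact ⟨⟨hX, hh⟩, hz⟩
    · rintro ⟨⟨hX, hh⟩, hz⟩
      exact ⟨hX, by rw [hf h hX, if_neg hz, hh]⟩
  · subst h2
    rw [← Finset.card_union_of_disjoint]
    · congr 1
      ext h
      rw [Finset.mem_union, mem_tok, mem_tok]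
      constructor
      · rintro ⟨hX, hh⟩
        rw [hf h hX] at hh
        split_ifs at hh with hz
        · exact .inr hz
        · exact .inl ⟨hX, hh⟩
      · rintro (⟨hX, hh⟩ | hz)
        · exact ⟨hX, by rw [hf h hX, hh]; simp⟩
        · exact ⟨(hZ' h hz).1, by rw [hf h (hZ' h hz).1, if_pos hz]⟩
    · rw [Finset.disjoint_left]
      intro h hh hz
      rw [mem_tok] at hh
      rw [(hZ' h hz).2] at hh
      exact h1 (Sum.inl_injective hh.2).symm
  · congr 1
    ext h
    rw [mem_tok, mem_tok]
    refine and_congr_right fun hX => ?_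
    rw [hf h hX]
    split_ifs with hz
    · rw [(hZ' h hz).2]
      simp only [Sum.inl.injEq]
      constructor <;> intro h <;> omega
    · rfl

/-- The partial solutions that arise by moving half-edges from `a` to `b`. -/
def MoveRel (X : Set V) (a b : ℕ) (f f' : Partial V) : Prop :=
  ∀ h : V × Bool, h.1 ∈ X → f' h = f h ∨ f h = .inl a ∧ f' h = .inl b

theorem Fam.move {X : Set V} {adm : V → ℕ → Prop} {Q : V × Bool → V × Bool → Prop}
    {C : Set (Partial V × Setoid V)} (hC : Fam X adm Q C) {a b : ℕ} (hab : a.bodd = b.bodd) :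
    Fam X (fun v l => adm v l ∨ l = b ∧ adm v a) Q
      {q | ∃ f E, (f, E) ∈ C ∧ MoveRel X a b f q.1 ∧ q.2 = grow E X q.1} := by
  refine hC.step _ ?_ ?_ ?_ ?_
  · intro f f' f'' h hf x hX
    rw [← hf x hX]; exact h x hX
  · intro π f f' hπ h x hX
    rcases h (π x) ((hπ.mem x).2 hX) with h | ⟨h1, h2⟩
    · exact .inl (by unfold conj; rw [h])
    · exact .inr ⟨conj_inl.2 h1, conj_inl.2 h2⟩
  · intro f f' h x g hX hg
    rcases h x hX with h | ⟨h1, -⟩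
    · rw [h, hg]
    · rw [h1] at hg; cases hg
  · intro f f' h hv x hX
    rcases h x hX with h1 | ⟨h1, h2⟩
    · rcases hv x hX with ⟨l, k1, k2, k3⟩ | ⟨g, k1, k2, k3, k4, k5⟩
      · exact .inl ⟨l, h1.trans k1, .inl k2, k3⟩
      · refine .inr ⟨g, k1, h1.trans k2, ?_, k4, k5⟩
        rcases h g k1 with h2 | ⟨h2, -⟩
        · rw [h2, k3]
        · rw [h2] at k3; cases k3
    · rcases hv x hX with ⟨l, k1, k2, k3⟩ | ⟨g, k1, k2, -⟩
      · rw [h1] at k1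
        obtain rfl := Sum.inl_injective k1
        exact .inl ⟨b, h2, .inr ⟨rfl, k2⟩, hab ▸ k3⟩
      · rw [h1] at k2; cases k2

/-- Soundness needs only one partial solution, so any `m` half-edges at `a` may be moved. They now
share an index with those at `b`; these links justify that the state merges the class of `a` with
that of `b`. -/
theorem Inv.move {X : Set V} {adm : V → ℕ → Prop} {Q : V × Bool → V × Bool → Prop}
    {f : Partial V} {E : Setoid V} {s : State} (h : Inv X f E s) (hv : Val X adm Q f)
    {a b m : ℕ} (hab : a ≠ b) (hab' : a.bodd = b.bodd) (ha : a < s.length) (hb : b < s.length)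
        (hm : 1 ≤ m)
    (hm' : m ≤ cnt s a) : ∃ f', MoveRel X a b f f' ∧ Inv X f' (grow E X f') (moveN m a b s) := by
  classical
  obtain ⟨Z, hZ, hZm⟩ := Finset.exists_subset_card_eq (hm'.trans_eq (h.count a))
  have hZ' : ∀ h ∈ Z, h.1 ∈ X ∧ f h = .inl a := fun h hh => mem_tok.1 (hZ hh)
  set f' : Partial V := fun h => if h ∈ Z then .inl b else f h with hf'
  refine ⟨f', ?_, ?_⟩
  · intro x hX
    by_cases hx : x ∈ Z
    · exact .inr ⟨(hZ' x hx).2, by simp [hf', hx]⟩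
    · exact .inl (by simp [hf', hx])
  obtain ⟨z, hz⟩ : Z.Nonempty := Finset.card_pos.1 (by omega)
  set E' := grow E X f' with hE'
  have hEE' : ∀ {u v}, E.r u v → E'.r u v := fun huv => le_grow _ _ _ huv
  have hbz : z.2 = b.bodd := by rw [← hv.bodd_eq (hZ hz), hab']
  have hfb : ∀ x, x ∈ tok X f b → E'.r x.1 z.1 := by
    intro x hx
    have hz' : f' z = .inl b := by simp [hf', hz]
    have hx2 := hv.bodd_eq hx
    rw [mem_tok] at hx
    have hx' : f' x = .inl b := by simp [hf', hx.2]
    refine grow_of_link ⟨hx.1, (hZ' z hz).1, .inl ⟨b.bodd, b, ?_, ?_⟩⟩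
    · rw [hx2]; exact hx'
    · rw [← hbz]; exact hz'
  have hfZ : ∀ x ∈ Z, E.r x.1 z.1 := fun x hx => h.classes x z a a (hZ hx) (hZ hz) rfl
  set y := if cnt s b = 0 then cls s a else cls s b with hy
  have hcls : ∀ l, l < s.length → cls (moveN m a b s) l =
      if cls s l = cls s a ∨ l = b then y else cls s l := fun l hl => cls_shift hl
  have hlt : ∀ x l, x ∈ tok X f l → l < s.length := by
    intro x l hx
    by_contra hl
    have := h.count l
    rw [cnt_of_le (by omega), eq_comm, Finset.card_eq_zero] at this
    simp [this] at hx
  have horig : ∀ x l, x ∈ tok X f' l → x ∈ Z ∧ l = b ∨ x ∉ Z ∧ x ∈ tok X f l := by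
    intro x l hx
    rw [mem_tok] at hx
    by_cases hxZ : x ∈ Z
    · refine .inl ⟨hxZ, ?_⟩
      have := hx.2
      simp only [hf', hxZ, if_true, Sum.inl.injEq] at this
      exact this.symm
    · refine .inr ⟨hxZ, mem_tok.2 ⟨hx.1, ?_⟩⟩
      have := hx.2
      simpa only [hf', hxZ, if_false] using this
  have hclsy : ∀ x l, x ∈ tok X f' l → cls (moveN m a b s) l = y → E'.r x.1 z.1 := by
    intro x l hx hl
    rcases horig x l hx with ⟨hxZ, -⟩ | ⟨-, hx⟩
    · exact hEE' (hfZ x hxZ)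
    · rw [hcls l (hlt x l hx)] at hl
      by_cases h1 : cls s l = cls s a
      · exact hEE' (h.classes x z l a hx (hZ hz) h1)
      by_cases h2 : l = b
      · exact hfb x (h2 ▸ hx)
      rw [if_neg (by tauto)] at hl
      rw [hy] at hl
      split_ifs at hl with h3
      · exact absurd hl h1
      · rw [h.count] at h3
        obtain ⟨g, hg⟩ := Finset.card_ne_zero.1 h3
        exact E'.trans (hEE' (h.classes x g l b hx hg hl)) (hfb g hg)
  constructor
  · intro l
    rw [card_tok_move hab hZ (fun x _ => rfl), hZm, moveN, cnt_shift' ha hb, h.count, h.count,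
      h.count]
  · intro x g l l' hx hg hll
    by_cases hl : cls (moveN m a b s) l = y
    · exact E'.trans (hclsy x l hx hl) (E'.symm (hclsy g l' hg (hll ▸ hl)))
    · have hl' : cls (moveN m a b s) l' ≠ y := hll ▸ hl
      have hold : ∀ x l, x ∈ tok X f' l → cls (moveN m a b s) l ≠ y →
          x ∈ tok X f l ∧ cls (moveN m a b s) l = cls s l := by
        intro x l hx hl
        rcases horig x l hx with ⟨hxZ, rfl⟩ | ⟨-, hx⟩
        · exact absurd (by rw [hcls l hb]; simp) hl
        · refine ⟨hx, ?_⟩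
          rw [hcls l (hlt x l hx)] at hl ⊢
          split_ifs at hl ⊢ with h1
          · exact absurd rfl hl
          · rfl
      obtain ⟨h1, h2⟩ := hold x l hx hl
      obtain ⟨h3, h4⟩ := hold g l' hg hl'
      exact hEE' (h.classes x g l l' h1 h3 (by rw [← h2, ← h4, hll]))
  · intro v hvX
    rcases h.reach v hvX with ⟨x, l, h1, h2⟩ | ⟨h1, -⟩
    · refine .inl ⟨x, if x ∈ Z then b else l, ?_, hEE' h2⟩
      rw [mem_tok] at h1 ⊢
      refine ⟨h1.1, ?_⟩
      by_cases hx : x ∈ Z <;> simp [hf', hx, h1.2]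
    · have := hZ hz
      simp [h1 a] at this

/-- Colors only have to be constant along matches, so merging colors does no harm: color `cls s a`
is renamed in the same way as the class. -/
theorem CInv.move {X : Set V} {f f' : Partial V} {κ : V → ℕ} {s : State} {a b : ℕ}
    (h : CInv X f κ s) (hab : a ≠ b) (ha : a < s.length) (hb : b < s.length)
    {Z : Finset (V × Bool)} (hZ : Z ⊆ tok X f a)
    (hf : ∀ h : V × Bool, h.1 ∈ X → f' h = if h ∈ Z then .inl b else f h) :
    ∃ κ', CInv X f' κ' (moveN Z.card a b s) := by
  have hZ' : ∀ h ∈ Z, h.1 ∈ X ∧ f h = .inl a := fun h hh => mem_tok.1 (hZ hh)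
  set y := if cnt s b = 0 then cls s a else cls s b with hy
  have hcls : ∀ l, l < s.length → cls (moveN Z.card a b s) l =
      if cls s l = cls s a ∨ l = b then y else cls s l := fun l hl => cls_shift hl
  have hlt : ∀ x l, x ∈ tok X f l → l < s.length := by
    intro x l hx
    by_contra hl
    have := h.count l
    rw [cnt_of_le (by omega), eq_comm, Finset.card_eq_zero] at this
    simp [this] at hx
  refine ⟨fun v => if κ v = cls s a then y else κ v, ?_, ?_, ?_⟩
  · intro l
    rw [card_tok_move hab hZ hf, moveN, cnt_shift' ha hb, h.count, h.count, h.count]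
  · intro x l hx
    rw [mem_tok, and_congr_right fun hX => by rw [hf x hX]] at hx
    obtain ⟨hX, hx⟩ := hx
    split_ifs at hx with hxZ
    · obtain rfl := Sum.inl_injective hx
      rw [hcls _ hb, h.classes x a (hZ hxZ)]; simp
    · have hx' : x ∈ tok X f l := mem_tok.2 ⟨hX, hx⟩
      rw [hcls l (hlt x l hx'), h.classes x l hx']
      by_cases h1 : cls s l = cls s a
      · simp [h1]
      by_cases h2 : l = b
      · subst h2
        have : cnt s l ≠ 0 := by
          rw [h.count]; exact Finset.card_ne_zero.2 ⟨x, hx'⟩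
        simp [h1, hy, this]
      · simp [h1, h2]
  · intro x g hX hg
    rw [hf x hX] at hg
    split_ifs at hg with hxZ
    rw [h.matched x g hX hg]

theorem Spec.move {n k L N a b : ℕ} {T : Table} {X : Set V} {adm : V → ℕ → Prop}
    {Q : V × Bool → V × Bool → Prop} (h : Spec L N T X adm Q) (hn : Fintype.card V = n)
    (hL : L ≤ 4 * k) (hN : N ≤ 8 * k) (ha : a < L) (hb : b < L) (hab : a ≠ b)
    (hab' : a.bodd = b.bodd) :
    Spec L N (moveT n k a b T) X (fun v l => adm v l ∨ l = b ∧ adm v a) Q where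
  shape s hs := by
    obtain ⟨hs, -⟩ := mem_clean.1 hs
    obtain ⟨t, ht, hs⟩ := List.mem_flatMap.1 hs
    rcases List.mem_cons.1 hs with rfl | hs
    · exact h.shape _ ht
    · obtain ⟨m, -, rfl⟩ := List.mem_map.1 hs
      exact (h.shape t ht).moveN ha hb
  lt v hv l hl := by
    rcases hl with hl | ⟨rfl, -⟩
    · exact h.lt v hv l hl
    · exact hb
  sound := by
    obtain ⟨C, hC, hT⟩ := h.sound
    refine ⟨_, hC.move hab', fun s hs => ?_⟩
    obtain ⟨hs, -⟩ := mem_clean.1 hs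
    obtain ⟨t, ht, hs⟩ := List.mem_flatMap.1 hs
    obtain ⟨f, E, hf, hi⟩ := hT t ht
    rcases List.mem_cons.1 hs with rfl | hs
    · exact ⟨f, _, ⟨f, E, hf, fun x _ => .inl rfl, rfl⟩, hi.congr (fun _ _ => rfl) (le_grow _ _ _)⟩
    · obtain ⟨m, hm, rfl⟩ := List.mem_map.1 hs
      rw [List.mem_range] at hm
      have hl := (h.shape t ht).1
      obtain ⟨f', h1, h2⟩ := hi.move (hC.val _ _ hf) (m := m + 1) hab hab' (by omega) (by omega)
        (by omega) hm
      exact ⟨f', _, ⟨f, E, hf, h1, rfl⟩, h2⟩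
  complete F hF f' hf' hfF := by
    classical
    -- Rewinding the step: a half-edge at `b` that was not admissible there before must have come
    -- from `a`.
    set Z : Finset (V × Bool) := Finset.univ.filter fun h =>
      h.1 ∈ X ∧ f' h = .inl b ∧ ¬ adm h.1 b with hZdef
    have hZ' : ∀ h, h ∈ Z ↔ h.1 ∈ X ∧ f' h = .inl b ∧ ¬ adm h.1 b := fun h => by simp [hZdef]
    set f : Partial V := fun h => if h ∈ Z then .inl a else f' h with hf
    have hval : Val X adm Q f := by
      intro x hX
      by_cases hx : x ∈ Z
      · obtain ⟨-, hx1, hx2⟩ := (hZ' x).1 hx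
        refine .inl ⟨a, by simp [hf, hx], ?_⟩
        rcases hf' x hX with ⟨l, h1, h2, h3⟩ | ⟨g, h1, h2, -⟩
        · rw [hx1] at h1
          obtain rfl := Sum.inl_injective h1
          exact ⟨by tauto, hab'.trans h3⟩
        · rw [hx1] at h2; cases h2
      · have hfx : f x = f' x := by simp [hf, hx]
        rcases hf' x hX with ⟨l, h1, h2, h3⟩ | ⟨g, h1, h2, h3, h4⟩
        · refine .inl ⟨l, hfx.trans h1, ?_, h3⟩
          rcases h2 with h2 | ⟨rfl, -⟩
          · exact h2
          · by_contra h4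
            exact hx ((hZ' x).2 ⟨hX, h1, h4⟩)
        · refine .inr ⟨g, h1, hfx.trans h2, ?_, h4⟩
          have hg : g ∉ Z := fun hg => by
            have := ((hZ' g).1 hg).2.1
            rw [h3] at this; cases this
          simp [hf, hg, h3]
    have hffF : ∀ h g : V × Bool, h.1 ∈ X → f h = .inr g → F h = g := by
      intro x g hX hg
      refine hfF x g hX ?_
      by_cases hx : x ∈ Z
      · simp [hf, hx] at hg
      · simpa [hf, hx] using hg
    obtain ⟨s, hs, κ, hκ⟩ := h.complete F hF f hval hffF
    have hsl := (h.shape s hs).1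
    have hZtok : Z ⊆ tok X f a := fun x hx => mem_tok.2 ⟨((hZ' x).1 hx).1, by simp [hf, hx]⟩
    have hback : ∀ x : V × Bool, x.1 ∈ X → f' x = if x ∈ Z then .inl b else f x := by
      intro x _
      by_cases hx : x ∈ Z
      · simp [hx, ((hZ' x).1 hx).2.1]
      · simp [hf, hx]
    by_cases hZ0 : Z = ∅
    · have heq : ∀ x : V × Bool, x.1 ∈ X → f x = f' x := fun x _ => by simp [hf, hZ0]
      refine ⟨s, mem_clean.2 ⟨List.mem_flatMap.2 ⟨s, hs, by simp [moves]⟩, ?_⟩, κ, hκ.congr heq⟩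
      refine small_of_shape (h.shape s hs) hL hN fun l => ?_
      rw [hκ.count, ← hn]; exact hval.card_tok_le l
    · obtain ⟨κ', hκ'⟩ := hκ.move hab (by omega) (by omega) hZtok hback
      refine ⟨_, mem_clean.2 ⟨List.mem_flatMap.2 ⟨s, hs, ?_⟩, ?_⟩, κ', hκ'⟩
      · refine List.mem_cons_of_mem _ (List.mem_map.2 ⟨Z.card - 1, ?_, ?_⟩)
        · rw [List.mem_range, hκ.count]
          have h1 := Finset.card_le_card hZtok
          have h2 := Finset.card_pos.2 (Finset.nonempty_iff_ne_empty.2 hZ0)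
          omega
        · have h2 := Finset.card_pos.2 (Finset.nonempty_iff_ne_empty.2 hZ0)
          rw [Nat.sub_add_cancel h2]
      · refine small_of_shape ((h.shape s hs).moveN ha hb) hL hN fun l => ?_
        rw [hκ'.count, ← hn]; exact hf'.card_tok_le l

end HamDP

namespace HamDP

variable {V : Type} [Fintype V] [DecidableEq V]

/-! ### Matching -/

/-- A bijection glued to its inverse, so that matched half-edges point at each other. -/
theorem exists_partner {α : Type} [DecidableEq α] {Z W : Finset α} (hd : Disjoint Z W)
    (hc : Z.card = W.card) :
    ∃ p : α → α, (∀ h ∈ Z, p h ∈ W ∧ p (p h) = h) ∧ ∀ h ∈ W, p h ∈ Z ∧ p (p h) = h := by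
  let e := Finset.equivOfCardEq hc
  let p : α → α := fun h => if hz : h ∈ Z then e ⟨h, hz⟩ else if hw : h ∈ W then
    e.symm ⟨h, hw⟩ else h
  have h1 : ∀ h (hz : h ∈ Z), p h = e ⟨h, hz⟩ := fun h hz => by simp [p, hz]
  have h2 : ∀ h (hw : h ∈ W), p h = e.symm ⟨h, hw⟩ := fun h hw => by
    simp [p, hw, Finset.disjoint_right.1 hd hw]
  refine ⟨p, fun h hz => ?_, fun h hw => ?_⟩
  · rw [h1 h hz]
    refine ⟨(e ⟨h, hz⟩).2, ?_⟩
    rw [h2 _ (e ⟨h, hz⟩).2]; simp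
  · rw [h2 h hw]
    refine ⟨(e.symm ⟨h, hw⟩).2, ?_⟩
    rw [h1 _ (e.symm ⟨h, hw⟩).2]; simp

theorem card_tok_cancel {X : Set V} {f f' : Partial V} {Z W : Finset (V × Bool)} {a b : ℕ}
    (hab : a ≠ b) (hZ : Z ⊆ tok X f a) (hW : W ⊆ tok X f b)
    (hf : ∀ h : V × Bool, h.1 ∈ X → h ∉ Z → h ∉ W → f' h = f h)
    (hf' : ∀ h : V × Bool, h ∈ Z ∨ h ∈ W → ∃ g, f' h = .inr g) (l : ℕ) :
    (tok X f' l).card = if l = a then (tok X f a).card - Z.card else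
      if l = b then (tok X f b).card - W.card else (tok X f l).card := by
  have hmem : ∀ h l, h ∈ tok X f' l ↔ h ∈ tok X f l ∧ h ∉ Z ∧ h ∉ W := by
    intro h l
    by_cases hz : h ∈ Z ∨ h ∈ W
    · obtain ⟨g, hg⟩ := hf' h hz
      constructor
      · intro hh
        rw [mem_tok, hg] at hh; cases hh.2
      · tauto
    · have hz1 : h ∉ Z := by tauto
      have hz2 : h ∉ W := by tauto
      rw [mem_tok, mem_tok, and_congr_right fun hX => by rw [hf h hX hz1 hz2]]
      tauto
  have hdis : ∀ {h l l'}, h ∈ tok X f l → h ∈ tok X f l' → l = l' := by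
    intro h l l' h1 h2
    rw [mem_tok] at h1 h2
    exact Sum.inl_injective (h1.2.symm.trans h2.2)
  split_ifs with h1 h2
  · subst h1
    rw [← Finset.card_sdiff_of_subset hZ]
    congr 1
    ext h
    rw [hmem, Finset.mem_sdiff]
    exact ⟨fun hh => ⟨hh.1, hh.2.1⟩, fun hh => ⟨hh.1, hh.2, fun hw => hab (hdis hh.1 (hW hw))⟩⟩
  · subst h2
    rw [← Finset.card_sdiff_of_subset hW]
    congr 1
    ext h
    rw [hmem, Finset.mem_sdiff]
    exact ⟨fun hh => ⟨hh.1, hh.2.2⟩, fun hh => ⟨hh.1, fun hz => h1 (hdis hh.1 (hZ hz)), hh.2⟩⟩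
  · congr 1
    ext h
    rw [hmem]
    exact ⟨fun hh => hh.1, fun hh => ⟨hh, fun hz => h1 (hdis hh (hZ hz)),
      fun hw => h2 (hdis hh (hW hw))⟩⟩

/-- The partial solutions that arise by matching half-edges at `a` with half-edges at `b`. -/
def CancelRel (X : Set V) (a b : ℕ) (f f' : Partial V) : Prop :=
  ∀ h : V × Bool, h.1 ∈ X → f' h = f h ∨ ∃ g : V × Bool, g.1 ∈ X ∧ f' h = .inr g ∧
    f' g = .inr h ∧ h.2 ≠ g.2 ∧ (f h = .inl a ∧ f g = .inl b ∨ f h = .inl b ∧ f g = .inl a)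

/-- The matches that become possible when the indices `a` and `b` are joined. -/
def joinQ (adm : V → ℕ → Prop) (Q : V × Bool → V × Bool → Prop) (a b : ℕ) (h g : V × Bool) :
    Prop :=
  Q h g ∨ (adm h.1 a ∧ a.bodd = h.2 ∧ adm g.1 b ∧ b.bodd = g.2) ∨
    (adm h.1 b ∧ b.bodd = h.2 ∧ adm g.1 a ∧ a.bodd = g.2)

theorem Val.mem_of_eq_inl {X : Set V} {adm : V → ℕ → Prop} {Q : V × Bool → V × Bool → Prop}
    {f : Partial V} (h : Val X adm Q f) {x : V × Bool} (hX : x.1 ∈ X) {l : ℕ}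
    (hx : f x = .inl l) : adm x.1 l ∧ l.bodd = x.2 := by
  rcases h x hX with ⟨l', h1, h2, h3⟩ | ⟨g, -, h1, -⟩
  · rw [hx] at h1
    obtain rfl := Sum.inl_injective h1
    exact ⟨h2, h3⟩
  · rw [hx] at h1; cases h1

theorem Fam.cancel {X : Set V} {adm : V → ℕ → Prop} {Q : V × Bool → V × Bool → Prop}
    {C : Set (Partial V × Setoid V)} (hC : Fam X adm Q C) (a b : ℕ) :
    Fam X adm (joinQ adm Q a b)
      {q | ∃ f E, (f, E) ∈ C ∧ CancelRel X a b f q.1 ∧ q.2 = grow E X q.1} := by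
  refine hC.step _ ?_ ?_ ?_ ?_
  · intro f f' f'' h hf x hX
    rw [← hf x hX]
    rcases h x hX with h | ⟨g, h1, h2⟩
    · exact .inl h
    · refine .inr ⟨g, h1, ?_⟩
      rwa [← hf g h1]
  · intro π f f' hπ h x hX
    rcases h (π x) ((hπ.mem x).2 hX) with h | ⟨g, h1, h2, h3, h4, h5⟩
    · exact .inl (by unfold conj; rw [h])
    · refine .inr ⟨π g, (hπ.mem g).2 h1, ?_, ?_, ?_, ?_⟩
      · rw [conj_inr hπ, hπ.invol, h2]
      · rw [conj_inr hπ, hπ.invol, h3]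
      · rw [hπ.snd, ← hπ.snd x]; exact h4
      · simpa only [conj_inl, hπ.invol] using h5
  · intro f f' h x g hX hg
    rcases h x hX with h | ⟨_, -, -, -, -, ⟨h1, -⟩ | ⟨h1, -⟩⟩
    · rw [h, hg]
    · rw [h1] at hg; cases hg
    · rw [h1] at hg; cases hg
  · intro f f' h hv x hX
    rcases h x hX with h1 | ⟨g, h1, h2, h3, h4, h5⟩
    · rcases hv x hX with ⟨l, k1, k2, k3⟩ | ⟨g, k1, k2, k3, k4, k5⟩
      · exact .inl ⟨l, h1.trans k1, k2, k3⟩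
      · refine .inr ⟨g, k1, h1.trans k2, ?_, k4, .inl k5⟩
        rcases h g k1 with h2 | ⟨_, -, -, -, -, ⟨h2, -⟩ | ⟨h2, -⟩⟩
        · rw [h2, k3]
        · rw [h2] at k3; cases k3
        · rw [h2] at k3; cases k3
    · refine .inr ⟨g, h1, h2, h3, h4, .inr ?_⟩
      rcases h5 with ⟨h5, h6⟩ | ⟨h5, h6⟩
      · have k1 := hv.mem_of_eq_inl hX h5
        have k2 := hv.mem_of_eq_inl h1 h6
        exact .inl ⟨k1.1, k1.2, k2.1, k2.2⟩
      · have k1 := hv.mem_of_eq_inl hX h5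
        have k2 := hv.mem_of_eq_inl h1 h6
        exact .inr ⟨k1.1, k1.2, k2.1, k2.2⟩

theorem Inv.lt {X : Set V} {f : Partial V} {s : State} (h : ∀ l, cnt s l = (tok X f l).card)
    {x : V × Bool} {l : ℕ} (hx : x ∈ tok X f l) : l < s.length := by
  by_contra hl
  have := h l
  rw [cnt_of_le (by omega), eq_comm, Finset.card_eq_zero] at this
  simp [this] at hx

/-- `hlive` is what saves `reach`. A vertex whose waiting companion has just been matched is
equivalent to `z`, hence to any half-edge that still waits in the merged class; if nothing waits at
all, every vertex is equivalent to `z`. -/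
theorem Inv.cancel {X : Set V} {adm : V → ℕ → Prop} {Q : V × Bool → V × Bool → Prop}
    {f : Partial V} {E : Setoid V} {s : State} (h : Inv X f E s) (hv : Val X adm Q f)
    {a b m : ℕ} (hab' : a.bodd ≠ b.bodd) (ha : a < s.length) (hb : b < s.length) (hm : 1 ≤ m)
    (hma : m ≤ cnt s a) (hmb : m ≤ cnt s b)
    (hlive : isZero (cancelN m a b s) = true ∨ live (cls s b) (cancelN m a b s) = true) :
    ∃ f', CancelRel X a b f f' ∧ Inv X f' (grow E X f') (cancelN m a b s) := by
  classical
  have hab : a ≠ b := fun h => hab' (by rw [h])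
  obtain ⟨Z, hZ, hZm⟩ := Finset.exists_subset_card_eq (hma.trans_eq (h.count a))
  obtain ⟨W, hW, hWm⟩ := Finset.exists_subset_card_eq (hmb.trans_eq (h.count b))
  have hZ' : ∀ h ∈ Z, h.1 ∈ X ∧ f h = .inl a := fun h hh => mem_tok.1 (hZ hh)
  have hW' : ∀ h ∈ W, h.1 ∈ X ∧ f h = .inl b := fun h hh => mem_tok.1 (hW hh)
  have hdis : Disjoint Z W := by
    rw [Finset.disjoint_left]
    intro x h1 h2
    exact hab (Sum.inl_injective ((hZ' x h1).2.symm.trans (hW' x h2).2))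
  obtain ⟨p, hpZ, hpW⟩ := exists_partner hdis (hZm.trans hWm.symm)
  set f' : Partial V := fun h => if h ∈ Z ∨ h ∈ W then .inr (p h) else f h with hf'
  have hne : ∀ x ∈ Z, ∀ g ∈ W, x.2 ≠ g.2 := fun x hx g hg => by
    rw [← hv.bodd_eq (hZ hx), ← hv.bodd_eq (hW hg)]; exact hab'
  have hrel : CancelRel X a b f f' := by
    intro x hX
    by_cases hx : x ∈ Z
    · obtain ⟨h1, h2⟩ := hpZ x hx
      exact .inr ⟨p x, (hW' _ h1).1, by simp [hf', hx], by simp [hf', h1, h2], hne x hx _ h1,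
        .inl ⟨(hZ' x hx).2, (hW' _ h1).2⟩⟩
    by_cases hx' : x ∈ W
    · obtain ⟨h1, h2⟩ := hpW x hx'
      exact .inr ⟨p x, (hZ' _ h1).1, by simp [hf', hx'], by simp [hf', h1, h2],
        (hne _ h1 x hx').symm, .inr ⟨(hW' x hx').2, (hZ' _ h1).2⟩⟩
    · exact .inl (by simp [hf', hx, hx'])
  refine ⟨f', hrel, ?_⟩
  obtain ⟨z, hz⟩ : Z.Nonempty := Finset.card_pos.1 (by omega)
  set E' := grow E X f' with hE'
  have hEE' : ∀ {u v}, E.r u v → E'.r u v := fun huv => le_grow _ _ _ huv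
  have hcount : ∀ l, cnt (cancelN m a b s) l = (tok X f' l).card := by
    intro l
    rw [card_tok_cancel hab hZ hW (fun x _ h1 h2 => by simp [hf', h1, h2])
      (fun x hx => ⟨p x, by simp [hf', hx]⟩), hZm, hWm, cancelN, cnt_shift' ha hb, h.count,
      h.count, h.count]
  have hold : ∀ x l, x ∈ tok X f' l → x ∈ tok X f l := by
    intro x l hx
    rw [mem_tok] at hx ⊢
    refine ⟨hx.1, ?_⟩
    by_cases hxZ : x ∈ Z ∨ x ∈ W
    · simp [hf', hxZ] at hx
    · simpa [hf', hxZ] using hx.2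
  have hwz : ∀ x ∈ tok X f b, E'.r x.1 z.1 := by
    intro x hx
    have h1 : Link X f' z.1 (p z).1 :=
      ⟨(hZ' z hz).1, (hW' _ (hpZ z hz).1).1, .inr ⟨z.2, (p z).2, by simp [hf', hz]⟩⟩
    exact E'.trans (hEE' (h.classes x (p z) b b hx (hW (hpZ z hz).1) rfl))
      (E'.symm (grow_of_link h1))
  have hzz : ∀ x ∈ tok X f a, E'.r x.1 z.1 := fun x hx =>
    hEE' (h.classes x z a a hx (hZ hz) rfl)
  have hcls : ∀ l, l < s.length → cls (cancelN m a b s) l =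
      if cls s l = cls s a ∨ l = b then cls s b else cls s l := fun l hl => cls_shift hl
  have hclsy : ∀ x l, x ∈ tok X f' l → cls (cancelN m a b s) l = cls s b → E'.r x.1 z.1 := by
    intro x l hx hl
    have hx' := hold x l hx
    rw [hcls l (Inv.lt h.count hx')] at hl
    by_cases h1 : cls s l = cls s a
    · exact hEE' (h.classes x z l a hx' (hZ hz) h1)
    by_cases h2 : l = b
    · exact hwz x (h2 ▸ hx')
    rw [if_neg (by tauto)] at hl
    exact E'.trans (hEE' (h.classes x (p z) l b hx' (hW (hpZ z hz).1) hl))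
      (hwz _ (hW (hpZ z hz).1))
  refine ⟨hcount, ?_, ?_⟩
  · intro x g l l' hx hg hll
    by_cases hl : cls (cancelN m a b s) l = cls s b
    · exact E'.trans (hclsy x l hx hl) (E'.symm (hclsy g l' hg (hll ▸ hl)))
    · have hl' : cls (cancelN m a b s) l' ≠ cls s b := hll ▸ hl
      have hsame : ∀ x l, x ∈ tok X f' l → cls (cancelN m a b s) l ≠ cls s b →
          cls (cancelN m a b s) l = cls s l := by
        intro x l hx hl
        rw [hcls l (Inv.lt h.count (hold x l hx))] at hl ⊢
        split_ifs at hl ⊢ with h1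
        · exact absurd rfl hl
        · rfl
      exact hEE' (h.classes x g l l' (hold x l hx) (hold g l' hg)
        (by rw [← hsame x l hx hl, ← hsame g l' hg hl', hll]))
  · have hreach : ∀ v ∈ X, (∃ x l, x ∈ tok X f' l ∧ E'.r v x.1) ∨ E'.r v z.1 := by
      intro v hvX
      rcases h.reach v hvX with ⟨x, l, h1, h2⟩ | ⟨h1, -⟩
      · by_cases hxZ : x ∈ Z
        · exact .inr (E'.trans (hEE' h2) (hzz x (hZ hxZ)))
        by_cases hxW : x ∈ W
        · exact .inr (E'.trans (hEE' h2) (hwz x (hW hxW)))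
        · refine .inl ⟨x, l, ?_, hEE' h2⟩
          rw [mem_tok] at h1 ⊢
          exact ⟨h1.1, by simp [hf', hxZ, hxW, h1.2]⟩
      · have := hZ hz
        simp [h1 a] at this
    intro v hvX
    rcases hlive with h0 | hl
    · have hemp : ∀ l, tok X f' l = ∅ := fun l => by
        rw [← Finset.card_eq_zero, ← hcount]; exact isZero_iff.1 h0 l
      have hall : ∀ v ∈ X, E'.r v z.1 := by
        intro v hvX
        rcases hreach v hvX with ⟨x, l, h1, -⟩ | h1
        · simp [hemp l] at h1
        · exact h1
      exact .inr ⟨hemp, fun w hw => E'.trans (hall v hvX) (E'.symm (hall w hw))⟩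
    · obtain ⟨l, hl1, hl2⟩ := live_iff.1 hl
      rw [hcount] at hl1
      obtain ⟨g, hg⟩ := Finset.card_ne_zero.1 hl1
      rcases hreach v hvX with h1 | h1
      · exact .inl h1
      · exact .inl ⟨g, l, hg, E'.trans h1 (E'.symm (hclsy g l hg hl2))⟩

/-- New matches run between the colors `cls s a` and `cls s b`, and exactly these two are
identified. -/
theorem CInv.cancel {X : Set V} {f f' : Partial V} {κ : V → ℕ} {s : State} {a b : ℕ}
    (h : CInv X f κ s) (hab : a ≠ b) (ha : a < s.length) (hb : b < s.length)
    {Z W : Finset (V × Bool)} (hZ : Z ⊆ tok X f a) (hW : W ⊆ tok X f b)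
    (hcard : Z.card = W.card)
    (hf : ∀ h : V × Bool, h.1 ∈ X → h ∉ Z → h ∉ W → f' h = f h)
    (hfZ : ∀ h ∈ Z, ∃ g ∈ W, f' h = .inr g) (hfW : ∀ h ∈ W, ∃ g ∈ Z, f' h = .inr g) :
    CInv X f' (fun v => if κ v = cls s a then cls s b else κ v) (cancelN Z.card a b s) := by
  have hsome : ∀ h : V × Bool, h ∈ Z ∨ h ∈ W → ∃ g, f' h = .inr g := by
    rintro h (hh | hh)
    · obtain ⟨g, -, hg⟩ := hfZ h hh; exact ⟨g, hg⟩
    · obtain ⟨g, -, hg⟩ := hfW h hh; exact ⟨g, hg⟩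
  have hκZ : ∀ x ∈ Z, κ x.1 = cls s a := fun x hx => h.classes x a (hZ hx)
  have hκW : ∀ x ∈ W, κ x.1 = cls s b := fun x hx => h.classes x b (hW hx)
  refine ⟨?_, ?_, ?_⟩
  · intro l
    rw [card_tok_cancel hab hZ hW hf hsome, cancelN, cnt_shift' ha hb, h.count, h.count, h.count,
      ← hcard]
  · intro x l hx
    rw [mem_tok] at hx
    have hxZ : ¬ (x ∈ Z ∨ x ∈ W) := fun hxZ => by
      obtain ⟨g, hg⟩ := hsome x hxZ
      rw [hg] at hx; cases hx.2
    have hx' : x ∈ tok X f l := mem_tok.2 ⟨hx.1, by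
      rw [← hf x hx.1 (by tauto) (by tauto), hx.2]⟩
    rw [cancelN, cls_shift (Inv.lt h.count hx'), h.classes x l hx']
    by_cases h1 : cls s l = cls s a
    · simp [h1]
    by_cases h2 : l = b
    · subst h2; simp
    · simp [h1, h2]
  · intro x g hX hg
    beta_reduce
    by_cases hxZ : x ∈ Z
    · obtain ⟨g', hg', h1⟩ := hfZ x hxZ
      rw [hg] at h1
      obtain rfl := Sum.inr_injective h1
      rw [hκZ x hxZ, hκW g hg']; simp
    by_cases hxW : x ∈ W
    · obtain ⟨g', hg', h1⟩ := hfW x hxW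
      rw [hg] at h1
      obtain rfl := Sum.inr_injective h1
      rw [hκZ g hg', hκW x hxW]; simp
    · rw [hf x hX hxZ hxW] at hg
      rw [h.matched x g hX hg]

theorem Spec.cancel {n k L N a b : ℕ} {T : Table} {X : Set V} {adm : V → ℕ → Prop}
    {Q : V × Bool → V × Bool → Prop} (h : Spec L N T X adm Q) (hn : Fintype.card V = n)
    (hL : L ≤ 4 * k) (hN : N ≤ 8 * k) (ha : a < L) (hb : b < L)
    (hab' : a.bodd ≠ b.bodd) (hQ : ∀ h g, Q h g → Q g h) :
    Spec L N (cancelT n k a b T) X adm (joinQ adm Q a b) where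
  shape s hs := by
    obtain ⟨hs, -⟩ := mem_clean.1 hs
    obtain ⟨t, ht, hs⟩ := List.mem_flatMap.1 hs
    rcases List.mem_cons.1 hs with rfl | hs
    · exact h.shape _ ht
    · obtain ⟨m, -, rfl⟩ := List.mem_map.1 (List.mem_filter.1 hs).1
      exact (h.shape t ht).cancelN hb
  lt := h.lt
  sound := by
    obtain ⟨C, hC, hT⟩ := h.sound
    refine ⟨_, hC.cancel a b, fun s hs => ?_⟩
    obtain ⟨hs, -⟩ := mem_clean.1 hs
    obtain ⟨t, ht, hs⟩ := List.mem_flatMap.1 hs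
    obtain ⟨f, E, hf, hi⟩ := hT t ht
    rcases List.mem_cons.1 hs with rfl | hs
    · exact ⟨f, _, ⟨f, E, hf, fun x _ => .inl rfl, rfl⟩, hi.congr (fun _ _ => rfl) (le_grow _ _ _)⟩
    · obtain ⟨hs, hlive⟩ := List.mem_filter.1 hs
      obtain ⟨m, hm, rfl⟩ := List.mem_map.1 hs
      obtain ⟨hm, hm'⟩ := List.mem_filter.1 hm
      rw [List.mem_range] at hm
      have hm' := of_decide_eq_true hm'
      have hl := (h.shape t ht).1
      obtain ⟨f', h1, h2⟩ := hi.cancel (hC.val _ _ hf) (m := m + 1) hab' (by omega) (by omega)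
        (by omega) hm hm' (by simpa using hlive)
      exact ⟨f', _, ⟨f, E, hf, h1, rfl⟩, h2⟩
  complete F hF f' hf' hfF := by
    classical
    have hab : a ≠ b := fun h => hab' (by rw [h])
    -- Rewinding the step: matches not allowed by `Q` must have been made just now. Their half-edges
    -- return to `a` or `b` according to direction, which is unambiguous since `a` and `b` have
    -- different parity.
    set Y : Bool → Finset (V × Bool) := fun c => Finset.univ.filter fun h =>
      h.1 ∈ X ∧ h.2 = c ∧ ∃ g, f' h = .inr g ∧ ¬ Q h g with hYdef
    have hY : ∀ c h, h ∈ Y c ↔ h.1 ∈ X ∧ h.2 = c ∧ ∃ g, f' h = .inr g ∧ ¬ Q h g := by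
      simp [hYdef]
    have hpart : ∀ x c, x ∈ Y c → ∃ g, g ∈ Y (!c) ∧ f' x = .inr g ∧ f' g = .inr x ∧
        joinQ adm Q a b x g ∧ ¬ Q x g := by
      intro x c hx
      obtain ⟨hX, hc, g, hg, hQg⟩ := (hY c x).1 hx
      rcases hf' x hX with ⟨l, h1, -⟩ | ⟨g', h1, h2, h3, h4, h5⟩
      · rw [hg] at h1; cases h1
      · rw [hg] at h2
        obtain rfl := Sum.inr_injective h2
        refine ⟨g, (hY _ g).2 ⟨h1, ?_, x, h3, fun hq => hQg (hQ _ _ hq)⟩, hg, h3, h5, hQg⟩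
        rw [hc] at h4
        revert h4; cases c <;> cases g.2 <;> simp
    have hnot : b.bodd = !a.bodd := by
      revert hab'; cases a.bodd <;> cases b.bodd <;> simp
    set Z := Y a.bodd with hZ
    set W := Y b.bodd with hW
    have hpZ : ∀ x ∈ Z, ∃ g ∈ W, f' x = .inr g ∧ f' g = .inr x ∧ adm x.1 a := by
      intro x hx
      obtain ⟨g, h1, h2, h3, h4, h5⟩ := hpart x _ hx
      refine ⟨g, by rw [hW, hnot]; exact h1, h2, h3, ?_⟩
      rcases h4 with h4 | h4 | h4
      · exact absurd h4 h5
      · exact h4.1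
      · exact absurd (((hY _ x).1 hx).2.1.symm.trans h4.2.1.symm) hab'
    have hpW : ∀ x ∈ W, ∃ g ∈ Z, f' x = .inr g ∧ f' g = .inr x ∧ adm x.1 b := by
      intro x hx
      obtain ⟨g, h1, h2, h3, h4, h5⟩ := hpart x _ hx
      refine ⟨g, by rw [hZ, ← Bool.not_not a.bodd, ← hnot]; exact h1, h2, h3, ?_⟩
      rcases h4 with h4 | h4 | h4
      · exact absurd h4 h5
      · exact absurd (h4.2.1.trans ((hY _ x).1 hx).2.1) hab'
      · exact h4.1
    have hdis : ∀ x, x ∈ Z → x ∉ W := fun x h1 h2 =>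
      hab' (((hY _ x).1 h1).2.1.symm.trans ((hY _ x).1 h2).2.1)
    -- The full solution `F` exchanges `Z` and `W`.
    have hcard : Z.card = W.card := by
      refine Finset.card_bij' (fun x _ => (F x)) (fun x _ => F x) ?_ ?_ ?_ ?_
      · intro x hx
        obtain ⟨g, h1, h2, -⟩ := hpZ x hx
        rw [hfF x g ((hY _ x).1 hx).1 h2]; exact h1
      · intro x hx
        obtain ⟨g, h1, h2, -⟩ := hpW x hx
        rw [hfF x g ((hY _ x).1 hx).1 h2]; exact h1
      · intro x hx
        obtain ⟨g, h1, h2, h3, -⟩ := hpZ x hx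
        rw [hfF x g ((hY _ x).1 hx).1 h2, hfF g x ((hY _ g).1 h1).1 h3]
      · intro x hx
        obtain ⟨g, h1, h2, h3, -⟩ := hpW x hx
        rw [hfF x g ((hY _ x).1 hx).1 h2, hfF g x ((hY _ g).1 h1).1 h3]
    set f : Partial V := fun h => if h ∈ Z then .inl a else if h ∈ W then .inl b else f' h with hf
    have hfZ : ∀ x ∈ Z, f x = .inl a := fun x hx => by simp [hf, hx]
    have hfW : ∀ x ∈ W, f x = .inl b := fun x hx => by
      have : x ∉ Z := fun h => hdis x h hx
      simp [hf, hx, this]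
    have hfo : ∀ x, x ∉ Z → x ∉ W → f x = f' x := fun x h1 h2 => by simp [hf, h1, h2]
    have hval : Val X adm Q f := by
      intro x hX
      by_cases hxZ : x ∈ Z
      · obtain ⟨g, -, -, -, h1⟩ := hpZ x hxZ
        exact .inl ⟨a, hfZ x hxZ, h1, ((hY _ x).1 hxZ).2.1.symm⟩
      by_cases hxW : x ∈ W
      · obtain ⟨g, -, -, -, h1⟩ := hpW x hxW
        exact .inl ⟨b, hfW x hxW, h1, ((hY _ x).1 hxW).2.1.symm⟩
      rcases hf' x hX with ⟨l, h1, h2, h3⟩ | ⟨g, h1, h2, h3, h4, h5⟩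
      · exact .inl ⟨l, (hfo x hxZ hxW).trans h1, h2, h3⟩
      · have hQg : Q x g := by
          by_contra hQg
          by_cases hc : x.2 = a.bodd
          · exact hxZ ((hY _ x).2 ⟨hX, hc, g, h2, hQg⟩)
          · refine hxW ((hY _ x).2 ⟨hX, ?_, g, h2, hQg⟩)
            rw [hnot]; revert hc; cases x.2 <;> cases a.bodd <;> simp
        refine .inr ⟨g, h1, (hfo x hxZ hxW).trans h2, ?_, h4, hQg⟩
        rw [hfo g ?_ ?_, h3]
        · intro hg
          obtain ⟨y, hy, hy', -⟩ := hpZ g hg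
          rw [h3] at hy'
          obtain rfl := Sum.inr_injective hy'
          exact hxW hy
        · intro hg
          obtain ⟨y, hy, hy', -⟩ := hpW g hg
          rw [h3] at hy'
          obtain rfl := Sum.inr_injective hy'
          exact hxZ hy
    have hffF : ∀ h g : V × Bool, h.1 ∈ X → f h = .inr g → F h = g := by
      intro x g hX hg
      by_cases hxZ : x ∈ Z
      · rw [hfZ x hxZ] at hg; cases hg
      by_cases hxW : x ∈ W
      · rw [hfW x hxW] at hg; cases hg
      · exact hfF x g hX (by rw [← hfo x hxZ hxW, hg])
    obtain ⟨s, hs, κ, hκ⟩ := h.complete F hF f hval hffF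
    have hsl := (h.shape s hs).1
    by_cases hZ0 : Z = ∅
    · have hW0 : W = ∅ := by rw [← Finset.card_eq_zero, ← hcard, hZ0]; rfl
      have heq : ∀ x : V × Bool, x.1 ∈ X → f x = f' x := fun x _ =>
        hfo x (by simp [hZ0]) (by simp [hW0])
      refine ⟨s, mem_clean.2 ⟨List.mem_flatMap.2 ⟨s, hs, by simp [cancels]⟩, ?_⟩, κ,
        hκ.congr heq⟩
      refine small_of_shape (h.shape s hs) hL hN fun l => ?_
      rw [hκ.count, ← hn]; exact hval.card_tok_le l
    · have hZtok : Z ⊆ tok X f a := fun x hx => mem_tok.2 ⟨((hY _ x).1 hx).1, hfZ x hx⟩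
      have hWtok : W ⊆ tok X f b := fun x hx => mem_tok.2 ⟨((hY _ x).1 hx).1, hfW x hx⟩
      have hκ' := hκ.cancel hab (by omega) (by omega) hZtok hWtok hcard
        (fun x _ h1 h2 => (hfo x h1 h2).symm)
        (fun x hx => by obtain ⟨g, h1, h2, -⟩ := hpZ x hx; exact ⟨g, h1, h2⟩)
        (fun x hx => by obtain ⟨g, h1, h2, -⟩ := hpW x hx; exact ⟨g, h1, h2⟩)
      set κ' : V → ℕ := fun v => if κ v = cls s a then cls s b else κ v with hκdef
      have h2 := Finset.card_pos.2 (Finset.nonempty_iff_ne_empty.2 hZ0)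
      have ha1 := Finset.card_le_card hZtok
      have hb1 := Finset.card_le_card hWtok
      refine ⟨_, mem_clean.2 ⟨List.mem_flatMap.2 ⟨s, hs, ?_⟩, ?_⟩, κ', hκ'⟩
      · refine List.mem_cons_of_mem _ (List.mem_filter.2 ⟨List.mem_map.2 ⟨Z.card - 1,
          List.mem_filter.2 ⟨?_, ?_⟩, ?_⟩, ?_⟩)
        · rw [List.mem_range, hκ.count]; omega
        · rw [decide_eq_true_eq, hκ.count]; omega
        · rw [Nat.sub_add_cancel h2]
        · by_contra hdead
          rw [Bool.or_eq_true, not_or] at hdead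
          obtain ⟨z, hz⟩ := Finset.nonempty_iff_ne_empty.2 hZ0
          have huniv := hF {v | v ∈ X ∧ κ' v = cls s b}
            ⟨z.1, ((hY _ z).1 hz).1, by simp [hκdef, hκ.classes z a (hZtok hz)]⟩ ?_
          · refine hdead.1 (isZero_iff.2 fun l => ?_)
            rw [hκ'.count, Finset.card_eq_zero, Finset.eq_empty_iff_forall_notMem]
            intro x hx
            refine hdead.2 (live_iff.2 ⟨l, ?_, ?_⟩)
            · rw [hκ'.count]; exact Finset.card_ne_zero.2 ⟨x, hx⟩
            · rw [← hκ'.classes x l hx]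
              have : x.1 ∈ (Set.univ : Set V) := Set.mem_univ _
              rw [← huniv] at this
              exact this.2
          · rintro x ⟨hX, hx⟩
            rcases hf' x hX with ⟨l, h1, -⟩ | ⟨g, h1, h2, h3, -⟩
            · have hx' : x ∈ tok X f' l := mem_tok.2 ⟨hX, h1⟩
              refine absurd (live_iff.2 ⟨l, ?_, ?_⟩) hdead.2
              · rw [hκ'.count]; exact Finset.card_ne_zero.2 ⟨x, hx'⟩
              · rw [← hκ'.classes x l hx', hx]
            · rw [hfF x g hX h2]
              exact ⟨h1, by rw [← hκ'.matched x g hX h2, hx]⟩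
      · refine small_of_shape ((h.shape s hs).cancelN hb) hL hN fun l => ?_
        rw [hκ'.count, ← hn]; exact hf'.card_tok_le l

end HamDP

namespace HamDP

variable {V : Type} [Fintype V] [DecidableEq V]

/-! ### Dropping an index, renaming classes, single vertices -/

/-- The step relation is the identity restricted to partial solutions with nothing waiting at `a`,
so `Fam.step` applies. -/
theorem Spec.drop {n k L N : ℕ} {T : Table} {X : Set V} {adm : V → ℕ → Prop}
    {Q : V × Bool → V × Bool → Prop} (h : Spec L N T X adm Q) (hn : Fintype.card V = n)
    (hL : L ≤ 4 * k) (hN : N ≤ 8 * k) (a : ℕ) :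
    Spec L N (dropT n k a T) X (fun v l => adm v l ∧ l ≠ a) Q where
  shape s hs := h.shape s (List.mem_filter.1 (mem_clean.1 hs).1).1
  lt v hv l hl := h.lt v hv l hl.1
  sound := by
    obtain ⟨C, hC, hT⟩ := h.sound
    refine ⟨_, hC.step (adm' := fun v l => adm v l ∧ l ≠ a) (Q' := Q)
      (fun f f' => ∀ h : V × Bool, h.1 ∈ X → f' h = f h ∧ f h ≠ .inl a) ?_ ?_ ?_ ?_, ?_⟩
    · intro f f' f'' h hf x hX
      rw [← hf x hX]; exact h x hX
    · intro π f f' hπ h x hX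
      obtain ⟨h1, h2⟩ := h (π x) ((hπ.mem x).2 hX)
      exact ⟨by unfold conj; rw [h1], fun h3 => h2 (conj_inl.1 h3)⟩
    · intro f f' h x g hX hg
      rw [(h x hX).1, hg]
    · intro f f' h hv x hX
      rcases hv x hX with ⟨l, h1, h2, h3⟩ | ⟨g, h1, h2, h3, h4⟩
      · exact .inl ⟨l, (h x hX).1.trans h1, ⟨h2, fun hl => (h x hX).2 (hl ▸ h1)⟩, h3⟩
      · exact .inr ⟨g, h1, (h x hX).1.trans h2, (h g h1).1.trans h3, h4⟩
    · intro s hs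
      obtain ⟨hs, hs0⟩ := List.mem_filter.1 (mem_clean.1 hs).1
      obtain ⟨f, E, hf, hi⟩ := hT s hs
      refine ⟨f, _, ⟨f, E, hf, fun x hX => ⟨rfl, fun hx => ?_⟩, rfl⟩,
        hi.congr (fun _ _ => rfl) (le_grow _ _ _)⟩
      have h0 := of_decide_eq_true hs0
      rw [hi.count, Finset.card_eq_zero] at h0
      have : x ∈ tok X f a := mem_tok.2 ⟨hX, hx⟩
      simp [h0] at this
  complete F hF f hf hfF := by
    have hf' : Val X adm Q f := hf.congr (fun _ _ => rfl) (fun _ _ _ h => h.1)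
      (fun _ _ _ _ _ h => h)
    obtain ⟨s, hs, κ, hκ⟩ := h.complete F hF f hf' hfF
    refine ⟨s, mem_clean.2 ⟨List.mem_filter.2 ⟨hs, ?_⟩, ?_⟩, κ, hκ⟩
    · rw [decide_eq_true_eq, hκ.count, Finset.card_eq_zero,
        Finset.eq_empty_iff_forall_notMem]
      intro x hx
      rw [mem_tok] at hx
      exact (hf.mem_of_eq_inl hx.1 hx.2).1.2 rfl
    · refine small_of_shape (h.shape s hs) hL hN fun l => ?_
      rw [hκ.count, ← hn]; exact hf.card_tok_le l

/-- Class names matter only up to an injective renaming. The position of the first occurrence is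
such a renaming and stays below the length of the state. Cutting off the upper indices loses
nothing, as no half-edge is admissible there. -/
theorem Spec.norm {n k L N : ℕ} {T : Table} {X : Set V} {adm : V → ℕ → Prop}
    {Q : V × Bool → V × Bool → Prop} (h : Spec L N T X adm Q) (hn : Fintype.card V = n)
    (hL : L ≤ 4 * k) (hkL : 2 * k ≤ L) (hadm : ∀ v ∈ X, ∀ l, adm v l → l < 2 * k) :
    Spec (2 * k) (4 * k) (normT n k T) X adm Q := by
  have hshape : ∀ s ∈ T, Shape (2 * k) (4 * k) (HamDP.norm (2 * k) s) := by
    intro s hs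
    obtain ⟨h1, h2⟩ := h.shape s hs
    refine ⟨by simp [HamDP.norm], fun l hl => ?_⟩
    rw [cls_norm hl]
    have := List.idxOf_lt_length_of_mem (cls_mem (s := s) (l := l) (by omega))
    rw [List.length_map] at this
    omega
  have hcount : ∀ (f : Partial V) (s : State), Val X adm Q f →
      (∀ l, cnt s l = (tok X f l).card) → ∀ l, cnt (HamDP.norm (2 * k) s) l = (tok X f l).card := by
    intro f s hf hs l
    by_cases hl : l < 2 * k
    · rw [cnt_norm hl, hs]
    · rw [cnt_of_le (by simpa [HamDP.norm] using hl), eq_comm, Finset.card_eq_zero,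
        Finset.eq_empty_iff_forall_notMem]
      intro x hx
      rw [mem_tok] at hx
      exact hl (hadm _ hx.1 _ (hf.mem_of_eq_inl hx.1 hx.2).1)
  have hlt : ∀ (f : Partial V), Val X adm Q f → ∀ x l, x ∈ tok X f l → l < 2 * k := by
    intro f hf x l hx
    rw [mem_tok] at hx
    exact hadm _ hx.1 _ (hf.mem_of_eq_inl hx.1 hx.2).1
  refine ⟨?_, hadm, ?_, ?_⟩
  · intro s hs
    obtain ⟨t, ht, rfl⟩ := List.mem_map.1 (mem_clean.1 hs).1
    exact hshape t ht
  · obtain ⟨C, hC, hT⟩ := h.sound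
    refine ⟨C, hC, fun s hs => ?_⟩
    obtain ⟨t, ht, rfl⟩ := List.mem_map.1 (mem_clean.1 hs).1
    obtain ⟨f, E, hf, hi⟩ := hT t ht
    have hv := hC.val _ _ hf
    refine ⟨f, E, hf, hcount f t hv hi.count, ?_, hi.reach⟩
    intro x g l l' hx hg hll
    have hl := hlt f hv x l hx
    have hl' := hlt f hv g l' hg
    have h1 := (h.shape t ht).1
    rw [cls_norm hl, cls_norm hl', List.idxOf_inj (cls_mem (by omega))] at hll
    exact hi.classes x g l l' hx hg hll
  · intro F hF f hf hfF
    obtain ⟨s, hs, κ, hκ⟩ := h.complete F hF f hf hfF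
    refine ⟨HamDP.norm (2 * k) s, mem_clean.2 ⟨List.mem_map.2 ⟨s, hs, rfl⟩, ?_⟩,
      fun v => (s.map fun p => p.2).idxOf (κ v), hcount f s hf hκ.count, ?_, ?_⟩
    · refine small_of_shape (hshape s hs) (by omega) (by omega) fun l => ?_
      rw [hcount f s hf hκ.count, ← hn]; exact hf.card_tok_le l
    · intro x l hx
      rw [cls_norm (hlt f hf x l hx), hκ.classes x l hx]
    · intro x g hX hg
      beta_reduce
      rw [hκ.matched x g hX hg]

theorem tok_single {v : V} {f : Partial V} {l₁ l₀ : ℕ} (h₁ : f (v, true) = .inl l₁)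
    (h₀ : f (v, false) = .inl l₀) (hb₁ : l₁.bodd = true) (hb₀ : l₀.bodd = false) (l : ℕ) :
    (tok {v} f l).card = if l = l₁ ∨ l = l₀ then 1 else 0 := by
  have hne : l₁ ≠ l₀ := by rintro rfl; rw [hb₁] at hb₀; cases hb₀
  have hmem : ∀ x, x ∈ tok {v} f l ↔ (x = (v, true) ∧ l = l₁) ∨ (x = (v, false) ∧ l = l₀) := by
    rintro ⟨w, c⟩
    rw [mem_tok, Set.mem_singleton_iff]
    constructor
    · rintro ⟨hw, hx⟩
      simp only at hw
      subst hw
      cases c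
      · rw [h₀] at hx; exact .inr ⟨rfl, (Sum.inl_injective hx).symm⟩
      · rw [h₁] at hx; exact .inl ⟨rfl, (Sum.inl_injective hx).symm⟩
    · rintro (⟨hx, rfl⟩ | ⟨hx, rfl⟩)
      · cases hx; exact ⟨rfl, h₁⟩
      · cases hx; exact ⟨rfl, h₀⟩
  split_ifs with hl
  · rw [Finset.card_eq_one]
    rcases hl with rfl | rfl
    · exact ⟨(v, true), by ext x; rw [hmem, Finset.mem_singleton]; tauto⟩
    · have := hne.symm
      exact ⟨(v, false), by ext x; rw [hmem, Finset.mem_singleton]; tauto⟩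
  · rw [Finset.card_eq_zero, Finset.eq_empty_iff_forall_notMem]
    intro x
    rw [hmem]; tauto

/-- The family consists of all valid partial solutions with the discrete relation `⊥`, which crosses
no set, so no exchange is required. -/
theorem Spec.single {n k : ℕ} (hn : Fintype.card V = n) (v : V) {S : List ℕ}
    (hS : ∀ i ∈ S, i < k) :
    Spec (2 * k) (4 * k) (introT n k S) {v} (fun _ l => l / 2 ∈ S) (fun _ _ => False) := by
  have hshape : ∀ i ∈ S, ∀ j ∈ S, Shape (2 * k) (4 * k) (initState (2 * k) i j) := by
    intro i hi j hj
    refine ⟨by simp [initState], fun l hl => ?_⟩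
    rw [cls_initState]; omega
  have hcount : ∀ i ∈ S, ∀ j ∈ S, ∀ f : Partial V, f (v, true) = .inl (2 * i + 1) →
      f (v, false) = .inl (2 * j) → ∀ l, cnt (initState (2 * k) i j) l = (tok {v} f l).card := by
    intro i hi j hj f h1 h0 l
    rw [tok_single h1 h0 (by simp) (by simp)]
    by_cases hl : l < 2 * k
    · rw [cnt_initState hl]
    · have h2 := hS i hi
      have h3 := hS j hj
      rw [cnt_of_le (by simpa [initState] using hl), if_neg (by omega)]
  refine ⟨?_, ?_, ?_, ?_⟩
  · intro s hs
    obtain ⟨i, hi, hs⟩ := List.mem_flatMap.1 (mem_clean.1 hs).1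
    obtain ⟨j, hj, rfl⟩ := List.mem_map.1 hs
    exact hshape i hi j hj
  · intro w _ l hl
    have := hS _ hl
    omega
  · refine ⟨{q | Val {v} (fun _ l => l / 2 ∈ S) (fun _ _ => False) q.1 ∧ q.2 = ⊥}, ⟨?_, ?_, ?_⟩, ?_⟩
    · rintro f f' E ⟨h1, h2⟩ hf
      exact ⟨h1.congr hf (fun _ _ _ h => h) (fun _ _ _ _ _ h => h), h2⟩
    · exact fun f E h => h.1
    · rintro f E ⟨h1, h2⟩ A hA ⟨u, w, huw, hu, hw⟩
      have h2' : E = ⊥ := h2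
      rw [h2'] at huw
      have : u = w := huw
      exact absurd (this ▸ hu) hw
    · intro s hs
      obtain ⟨i, hi, hs⟩ := List.mem_flatMap.1 (mem_clean.1 hs).1
      obtain ⟨j, hj, rfl⟩ := List.mem_map.1 hs
      set f : Partial V := fun x => if x.2 = true then .inl (2 * i + 1) else .inl (2 * j) with hf
      have h1 : f (v, true) = .inl (2 * i + 1) := by simp [hf]
      have h0 : f (v, false) = .inl (2 * j) := by simp [hf]
      have hc := hcount i hi j hj f h1 h0
      refine ⟨f, ⊥, ⟨?_, rfl⟩, hc, ?_, ?_⟩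
      · rintro ⟨w, c⟩ hx
        left
        cases c
        · exact ⟨2 * j, rfl, by simpa using hj, by simp⟩
        · exact ⟨2 * i + 1, rfl, by
            have : (2 * i + 1) / 2 = i := by omega
            show (2 * i + 1) / 2 ∈ S
            rwa [this], by simp⟩
      · intro x g l l' hx hg _
        rw [mem_tok, Set.mem_singleton_iff] at hx hg
        rw [hx.1, hg.1]
      · intro w hw
        rw [Set.mem_singleton_iff] at hw
        subst hw
        exact .inl ⟨(w, true), 2 * i + 1, mem_tok.2 ⟨rfl, h1⟩, (⊥ : Setoid V).refl _⟩
  · intro F hF f hf hfF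
    have hval : ∀ c, ∃ l, f (v, c) = .inl l ∧ l / 2 ∈ S ∧ l.bodd = c := by
      intro c
      rcases hf (v, c) rfl with h | ⟨g, -, -, -, -, h⟩
      · exact h
      · exact h.elim
    obtain ⟨l₁, h1, h1S, h1b⟩ := hval true
    obtain ⟨l₀, h0, h0S, h0b⟩ := hval false
    have e1 : l₁ = 2 * (l₁ / 2) + 1 := by
      have := Nat.bodd_add_div2 l₁
      rw [h1b, Nat.div2_val] at this
      simp at this; omega
    have e0 : l₀ = 2 * (l₀ / 2) := by
      have := Nat.bodd_add_div2 l₀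
      rw [h0b, Nat.div2_val] at this
      simp at this; omega
    have hc := hcount _ h1S _ h0S f (e1 ▸ h1) (e0 ▸ h0)
    refine ⟨_, mem_clean.2 ⟨List.mem_flatMap.2 ⟨_, h1S, List.mem_map.2 ⟨_, h0S, rfl⟩⟩, ?_⟩,
      fun _ => 0, hc, ?_, fun _ _ _ _ => rfl⟩
    · refine small_of_shape (hshape _ h1S _ h0S) (by omega) (by omega) fun l => ?_
      rw [hc, ← hn]; exact hf.card_tok_le l
    · intro x l _
      rw [cls_initState]

/-! ### Disjoint unions -/

/-- The partial solution with all indices increased by `L`. -/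
def raise (L : ℕ) (f : Partial V) : Partial V := fun h => (f h).map (· + L) id

/-- Shifting by an even number keeps the parity of the indices, hence the directions. -/
theorem Fam.raise {X : Set V} {adm : V → ℕ → Prop} {Q : V × Bool → V × Bool → Prop}
    {C : Set (Partial V × Setoid V)} (hC : Fam X adm Q C) {L : ℕ} (hL : L.bodd = false) :
    Fam X (fun v l => L ≤ l ∧ adm v (l - L)) Q
      {q | ∃ f E, (f, E) ∈ C ∧ (∀ h : V × Bool, h.1 ∈ X → q.1 h = HamDP.raise L f h) ∧
        q.2 = grow E X q.1} := by
  refine hC.step (fun f f' => ∀ h : V × Bool, h.1 ∈ X → f' h = HamDP.raise L f h) ?_ ?_ ?_ ?_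
  · intro f f' f'' h hf x hX
    rw [← hf x hX]; exact h x hX
  · intro π f f' hπ h x hX
    unfold conj
    rw [h (π x) ((hπ.mem x).2 hX)]
    simp only [HamDP.raise]
    cases f (π x) <;> rfl
  · intro f f' h x g hX hg
    rw [h x hX, HamDP.raise, hg]; rfl
  · intro f f' h hv x hX
    rcases hv x hX with ⟨l, h1, h2, h3⟩ | ⟨g, h1, h2, h3, h4⟩
    · refine .inl ⟨l + L, by rw [h x hX, HamDP.raise, h1]; rfl, ⟨by omega, by simpa using h2⟩, ?_⟩
      rw [Nat.bodd_add, hL, h3]; simp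
    · exact .inr ⟨g, h1, by rw [h x hX, HamDP.raise, h2]; rfl,
        by rw [h g h1, HamDP.raise, h3]; rfl, h4⟩

/-- The two sides first keep separate indices and separate class names, so nothing interacts;
half-edges of different sides meet only when indices are lowered afterwards. Discarding zero states
gives `reach` in the soundness part. -/
theorem Spec.concat {n k : ℕ} {T T' : Table} {X X' : Set V} {adm adm' : V → ℕ → Prop}
    {Q Q' : V × Bool → V × Bool → Prop} (h : Spec (2 * k) (4 * k) T X adm Q)
    (h' : Spec (2 * k) (4 * k) T' X' adm' Q') (hn : Fintype.card V = n)
    (hX : Disjoint X X') (hne : X.Nonempty) (hne' : X'.Nonempty) :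
    Spec (4 * k) (8 * k) (catT n k T T') (X ∪ X')
      (fun v l => v ∈ X ∧ adm v l ∨ v ∈ X' ∧ 2 * k ≤ l ∧ adm' v (l - 2 * k))
      (fun h g => h.1 ∈ X ∧ g.1 ∈ X ∧ Q h g ∨ h.1 ∈ X' ∧ g.1 ∈ X' ∧ Q' h g) := by
  classical
  have hshape : ∀ s ∈ T, ∀ t ∈ T', Shape (4 * k) (8 * k) (HamDP.concat (4 * k) s t) := by
    intro s hs t ht
    obtain ⟨h1, h2⟩ := h.shape s hs
    obtain ⟨h3, h4⟩ := h'.shape t ht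
    refine ⟨by simp [HamDP.concat, h1, h3]; ring, fun l hl => ?_⟩
    by_cases hl' : l < 2 * k
    · rw [cls_concat_left (by omega)]
      have := h2 l hl'
      omega
    · obtain ⟨j, rfl⟩ := Nat.exists_eq_add_of_le (not_lt.1 hl')
      rw [← h1, cls_concat_right (by omega)]
      have := h4 j (by omega)
      omega
  have hdisj : ∀ v, v ∈ X → v ∉ X' := fun v h1 h2 => Set.disjoint_left.1 hX h1 h2
  have hmem : ∀ s, s ∈ catT n k T T' → ∃ u ∈ T, ∃ t ∈ T', isZero u = false ∧ isZero t = false ∧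
      s = HamDP.concat (4 * k) u t := by
    intro s hs
    obtain ⟨u, hu, hs⟩ := List.mem_flatMap.1 (mem_clean.1 hs).1
    obtain ⟨t, ht, hs⟩ := List.mem_flatMap.1 hs
    split_ifs at hs with hz
    · simp at hs
    · simp only [Bool.or_eq_true, not_or, Bool.not_eq_true] at hz
      exact ⟨u, hu, t, ht, hz.1, hz.2, List.mem_singleton.1 hs⟩
  -- The half-edges waiting in the union, split by side; both soundness and completeness use this.
  have hcount : ∀ s ∈ T, ∀ t ∈ T', ∀ f₁ f₂ f : Partial V, Val X adm Q f₁ → Val X' adm' Q' f₂ →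
      (∀ x : V × Bool, x.1 ∈ X → f x = f₁ x) →
      (∀ x : V × Bool, x.1 ∈ X' → f x = raise (2 * k) f₂ x) →
      (∀ l, cnt s l = (tok X f₁ l).card) → (∀ l, cnt t l = (tok X' f₂ l).card) →
      (∀ l, cnt (HamDP.concat (4 * k) s t) l = (tok (X ∪ X') f l).card) ∧
      (∀ x l, x ∈ tok (X ∪ X') f l → (l < 2 * k ∧ x ∈ tok X f₁ l) ∨
        ∃ j < 2 * k, l = 2 * k + j ∧ x ∈ tok X' f₂ j) := by
    intro s hs t ht f₁ f₂ f hv₁ hv₂ hf₁ hf₂ hs' ht'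
    have hls := (h.shape s hs).1
    have hlt₁ : ∀ x l, x ∈ tok X f₁ l → l < 2 * k := fun x l hx => by
      rw [mem_tok] at hx
      exact h.lt _ hx.1 _ (hv₁.mem_of_eq_inl hx.1 hx.2).1
    have hlt₂ : ∀ x l, x ∈ tok X' f₂ l → l < 2 * k := fun x l hx => by
      rw [mem_tok] at hx
      exact h'.lt _ hx.1 _ (hv₂.mem_of_eq_inl hx.1 hx.2).1
    have hr : ∀ x l, raise (2 * k) f₂ x = .inl l ↔ ∃ j, l = 2 * k + j ∧ f₂ x = .inl j := by
      intro x l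
      unfold HamDP.raise
      cases hx : f₂ x with
      | inl i =>
        simp only [Sum.map_inl, Sum.inl.injEq]
        constructor
        · rintro rfl; exact ⟨i, by omega, rfl⟩
        · rintro ⟨j, rfl, rfl⟩; omega
      | inr g => simp
    have hcases : ∀ x l, x ∈ tok (X ∪ X') f l ↔ x ∈ tok X f₁ l ∨
        ∃ j, l = 2 * k + j ∧ x ∈ tok X' f₂ j := by
      intro x l
      simp only [mem_tok, Set.mem_union]
      constructor
      · rintro ⟨hx | hx, hxl⟩
        · exact .inl ⟨hx, by rw [← hf₁ x hx, hxl]⟩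
        · rw [hf₂ x hx, hr] at hxl
          obtain ⟨j, h1, h2⟩ := hxl
          exact .inr ⟨j, h1, hx, h2⟩
      · rintro (⟨hx, hxl⟩ | ⟨j, h1, hx, hxl⟩)
        · exact ⟨.inl hx, by rw [hf₁ x hx, hxl]⟩
        · exact ⟨.inr hx, by rw [hf₂ x hx, hr]; exact ⟨j, h1, hxl⟩⟩
    refine ⟨fun l => ?_, fun x l hx => ?_⟩
    · rw [cnt_concat, hls]
      split_ifs with hl
      · rw [hs']
        congr 1
        ext x
        rw [hcases]
        constructor
        · exact .inl
        · rintro (hx | ⟨j, rfl, -⟩)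
          · exact hx
          · omega
      · rw [ht']
        congr 1
        ext x
        rw [hcases]
        constructor
        · exact fun hx => .inr ⟨_, by omega, hx⟩
        · rintro (hx | ⟨j, rfl, hx⟩)
          · exact absurd (hlt₁ x l hx) hl
          · rwa [Nat.add_sub_cancel_left]
    · rcases (hcases x l).1 hx with hx | ⟨j, h1, h2⟩
      · exact .inl ⟨hlt₁ x l hx, hx⟩
      · exact .inr ⟨j, hlt₂ x j h2, h1, h2⟩
  refine ⟨?_, ?_, ?_, ?_⟩
  · intro s hs
    obtain ⟨u, hu, t, ht, -, -, rfl⟩ := hmem s hs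
    exact hshape u hu t ht
  · rintro v - l (⟨hv, hl⟩ | ⟨hv, h1, hl⟩)
    · have := h.lt v hv l hl
      omega
    · have := h'.lt v hv _ hl
      omega
  · obtain ⟨C, hC, hT⟩ := h.sound
    obtain ⟨C', hC', hT'⟩ := h'.sound
    have hfam := hC.union (hC'.raise (L := 2 * k) (by simp)) hX
    refine ⟨_, hfam, fun s hs => ?_⟩
    obtain ⟨u, hu, t, ht, hzu, hzt, rfl⟩ := hmem s hs
    obtain ⟨f₁, E₁, hf₁, hi₁⟩ := hT u hu
    obtain ⟨f₂, E₂, hf₂, hi₂⟩ := hT' t ht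
    set f : Partial V := fun x => if x.1 ∈ X then f₁ x else raise (2 * k) f₂ x with hf
    have hfX : ∀ x : V × Bool, x.1 ∈ X → f x = f₁ x := fun x hx => by simp [hf, hx]
    have hfX' : ∀ x : V × Bool, x.1 ∈ X' → f x = raise (2 * k) f₂ x := fun x hx => by
      have : x.1 ∉ X := fun hx' => hdisj _ hx' hx
      simp [hf, this]
    obtain ⟨hc1, hc2⟩ := hcount u hu t ht f₁ f₂ f (hC.val _ _ hf₁) (hC'.val _ _ hf₂) hfX hfX'
      hi₁.count hi₂.count
    set E' := grow E₂ X' f with hE'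
    have hle₁ : ∀ {v w}, E₁.r v w → (E₁ ⊔ E').r v w := fun hvw =>
      (le_sup_left : E₁ ≤ E₁ ⊔ E') hvw
    have hle₂ : ∀ {v w}, E₂.r v w → (E₁ ⊔ E').r v w := fun hvw =>
      ((le_grow E₂ X' f).trans le_sup_right : E₂ ≤ E₁ ⊔ E') hvw
    have hlu := (h.shape u hu).1
    have hlt := (h'.shape t ht).1
    have hcls₁ : ∀ l < 2 * k, cls (HamDP.concat (4 * k) u t) l = cls u l := fun l hl =>
      cls_concat_left (by omega)
    have hcls₂ : ∀ l < 2 * k, cls (HamDP.concat (4 * k) u t) (2 * k + l) = cls t l + 4 * k :=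
      fun l hl => by rw [← hlu, cls_concat_right (by omega)]
    refine ⟨f, E₁ ⊔ E', ⟨E₁, E', hC.congr _ _ _ hf₁ fun x hx => (hfX x hx).symm,
      ⟨f₂, E₂, hf₂, hfX', rfl⟩, rfl⟩, hc1, ?_, ?_⟩
    · intro x g l l' hx hg hll
      rcases hc2 x l hx with ⟨h1, h2⟩ | ⟨j, h1, rfl, h2⟩ <;>
        rcases hc2 g l' hg with ⟨h3, h4⟩ | ⟨j', h3, rfl, h4⟩
      · rw [hcls₁ l h1, hcls₁ l' h3] at hll
        exact hle₁ (hi₁.classes x g l l' h2 h4 hll)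
      · rw [hcls₁ l h1, hcls₂ j' h3] at hll
        have := (h.shape u hu).2 l h1
        omega
      · rw [hcls₂ j h1, hcls₁ l' h3] at hll
        have := (h.shape u hu).2 l' h3
        omega
      · rw [hcls₂ j h1, hcls₂ j' h3, Nat.add_right_cancel_iff] at hll
        exact hle₂ (hi₂.classes x g j j' h2 h4 hll)
    · rintro v (hv | hv)
      · rcases hi₁.reach v hv with ⟨x, l, h1, h2⟩ | ⟨h1, -⟩
        · refine .inl ⟨x, l, ?_, hle₁ h2⟩
          rw [mem_tok] at h1 ⊢
          exact ⟨.inl h1.1, by rw [hfX x h1.1, h1.2]⟩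
        · have : isZero u = true := isZero_iff.2 fun l => by rw [hi₁.count, h1 l]; rfl
          rw [this] at hzu; cases hzu
      · rcases hi₂.reach v hv with ⟨x, l, h1, h2⟩ | ⟨h1, -⟩
        · refine .inl ⟨x, l + 2 * k, ?_, hle₂ h2⟩
          rw [mem_tok] at h1 ⊢
          exact ⟨.inr h1.1, by rw [hfX' x h1.1, HamDP.raise, h1.2]; rfl⟩
        · have : isZero t = true := isZero_iff.2 fun l => by rw [hi₂.count, h1 l]; rfl
          rw [this] at hzt; cases hzt
  · intro F hF f hf hfF
    set f₂ : Partial V := fun x => (f x).map (· - 2 * k) id with hf₂def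
    have hv₁ : Val X adm Q f := by
      intro x hx
      rcases hf x (.inl hx) with ⟨l, h1, h2, h3⟩ | ⟨g, h1, h2, h3, h4, h5⟩
      · rcases h2 with h2 | h2
        · exact .inl ⟨l, h1, h2.2, h3⟩
        · exact absurd h2.1 (hdisj _ hx)
      · rcases h5 with h5 | h5
        · exact .inr ⟨g, h5.2.1, h2, h3, h4, h5.2.2⟩
        · exact absurd h5.1 (hdisj _ hx)
    have hv₂ : Val X' adm' Q' f₂ := by
      intro x hx
      rcases hf x (.inr hx) with ⟨l, h1, h2, h3⟩ | ⟨g, h1, h2, h3, h4, h5⟩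
      · rcases h2 with h2 | h2
        · exact absurd hx (hdisj _ h2.1)
        · refine .inl ⟨l - 2 * k, by simp [hf₂def, h1], h2.2.2, ?_⟩
          obtain ⟨j, rfl⟩ := Nat.exists_eq_add_of_le h2.2.1
          rw [Nat.add_sub_cancel_left, ← h3]; simp
      · rcases h5 with h5 | h5
        · exact absurd hx (hdisj _ h5.1)
        · exact .inr ⟨g, h5.2.1, by simp [hf₂def, h2], by simp [hf₂def, h3], h4, h5.2.2⟩
    have hfX' : ∀ x : V × Bool, x.1 ∈ X' → f x = raise (2 * k) f₂ x := by
      intro x hx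
      rcases hf x (.inr hx) with ⟨l, h1, h2, h3⟩ | ⟨g, h1, h2, -⟩
      · rcases h2 with h2 | h2
        · exact absurd hx (hdisj _ h2.1)
        · simp only [HamDP.raise, hf₂def, h1, Sum.map_inl, Sum.inl.injEq]
          have := h2.2.1
          omega
      · simp [HamDP.raise, hf₂def, h2]
    have hfF₂ : ∀ x g : V × Bool, x.1 ∈ X' → f₂ x = .inr g → F x = g := by
      intro x g hx hg
      refine hfF x g (.inr hx) ?_
      rw [hfX' x hx, HamDP.raise, hg]; rfl
    -- A side on which nothing waits would be closed under `F` and hence be everything, but the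
    -- other side is nonempty.
    have hzero : ∀ {Y Y' : Set V} {a : V → ℕ → Prop} {q : V × Bool → V × Bool → Prop}
        {e : Partial V} {s : State}, Y.Nonempty → Y'.Nonempty → Disjoint Y Y' → Val Y a q e →
        (∀ x g : V × Bool, x.1 ∈ Y → e x = .inr g → F x = g) →
        (∀ l, cnt s l = (tok Y e l).card) → isZero s = false := by
      intro Y Y' a q e s hY hY' hYY he heF hs
      by_contra hz
      rw [Bool.not_eq_false, isZero_iff] at hz
      have := hF Y hY fun x hx => by
        rcases he x hx with ⟨l, h1, -⟩ | ⟨g, h1, h2, -⟩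
        · have h0 := hz l
          rw [hs, Finset.card_eq_zero] at h0
          have : x ∈ tok Y e l := mem_tok.2 ⟨hx, h1⟩
          simp [h0] at this
        · rw [heF x g hx h2]; exact h1
      obtain ⟨w, hw⟩ := hY'
      exact Set.disjoint_left.1 hYY (this ▸ Set.mem_univ w) hw
    obtain ⟨s, hs, κ₁, hκ₁⟩ := h.complete F hF f hv₁ fun x g hx => hfF x g (.inl hx)
    obtain ⟨t, ht, κ₂, hκ₂⟩ := h'.complete F hF f₂ hv₂ hfF₂
    have hzs := hzero hne hne' hX hv₁ (fun x g hx => hfF x g (.inl hx)) hκ₁.count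
    have hzt := hzero hne' hne hX.symm hv₂ hfF₂ hκ₂.count
    obtain ⟨hc1, hc2⟩ := hcount s hs t ht f f₂ f hv₁ hv₂ (fun _ _ => rfl) hfX' hκ₁.count hκ₂.count
    have hls := (h.shape s hs).1
    have hlt := (h'.shape t ht).1
    refine ⟨HamDP.concat (4 * k) s t, mem_clean.2 ⟨List.mem_flatMap.2 ⟨s, hs, List.mem_flatMap.2
      ⟨t, ht, by simp [hzs, hzt]⟩⟩, ?_⟩, fun v => if v ∈ X then κ₁ v else κ₂ v + 4 * k, hc1, ?_, ?_⟩
    · refine small_of_shape (hshape s hs t ht) (by omega) (by omega) fun l => ?_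
      rw [hc1, ← hn]; exact hf.card_tok_le l
    · intro x l hx
      rcases hc2 x l hx with ⟨h1, h2⟩ | ⟨j, h1, rfl, h2⟩
      · have hxX := (mem_tok.1 h2).1
        rw [cls_concat_left (by omega), if_pos hxX, hκ₁.classes x l h2]
      · have hxX : x.1 ∉ X := fun hx' => hdisj _ hx' (mem_tok.1 h2).1
        rw [← hls, cls_concat_right (by omega), if_neg hxX, hκ₂.classes x j h2]
    · rintro x g hx hg
      rcases hf x hx with ⟨l, h1, -⟩ | ⟨g', h1, h2, h3, h4, h5⟩
      · rw [hg] at h1; cases h1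
      · rw [hg] at h2
        obtain rfl := Sum.inr_injective h2
        rcases h5 with h5 | h5
        · beta_reduce
          rw [if_pos h5.1, if_pos h5.2.1, hκ₁.matched x g h5.1 hg]
        · beta_reduce
          have hx1 : x.1 ∉ X := fun hx' => hdisj _ hx' h5.1
          have hg1 : g.1 ∉ X := fun hx' => hdisj _ hx' h5.2.1
          rw [if_neg hx1, if_neg hg1, hκ₂.matched x g h5.1 (by simp [hf₂def, hg])]

end HamDP

namespace HamDP

/-! ## Expressions without types, and their evaluation by elementary steps -/

/-- Expressions without side conditions, with natural numbers for vertices and labels. -/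
inductive RawExpr : Type
  | intro : ℕ → List ℕ → RawExpr
  | union : RawExpr → RawExpr → RawExpr
  | join : ℕ → ℕ → RawExpr → RawExpr
  | relabel : ℕ → List ℕ → RawExpr → RawExpr

/-- An elementary step: a tag, two indices, and a list of labels. -/
abbrev Op : Type := ℕ × ℕ × ℕ × List ℕ

/-- A step that changes one table. -/
def act (n k : ℕ) (T : Table) (o : Op) : Table :=
  if o.1 = 2 then moveT n k o.2.1 o.2.2.1 T
  else if o.1 = 3 then cancelT n k o.2.1 o.2.2.1 T
  else if o.1 = 4 then dropT n k o.2.1 T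
  else normT n k T

/-- A step on a stack of tables. -/
def exec (n k : ℕ) (st : List Table) (o : Op) : List Table :=
  if o.1 = 0 then introT n k o.2.2.2 :: st
  else if o.1 = 1 then catT n k (st.headD []) (st.tail.headD []) :: st.tail.tail
  else act n k (st.headD []) o :: st.tail

/-- Move the half-edges that wait at index `2 * k + l` to index `l`. -/
def lowerOps (k l : ℕ) : List Op := [(2, 2 * k + l, l, []), (4, 2 * k + l, 0, [])]

/-- The indices of the second operand are merged into those of the first one by one; the last step
restores short states and class names. -/
def unionOps (k : ℕ) : List Op :=
  (List.range (2 * k)).flatMap (fun l => lowerOps k l) ++ [(5, 0, 0, [])]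

/-- One step for each orientation of the new edges. -/
def joinOps (i j : ℕ) : List Op :=
  [(3, 2 * i + 1, 2 * j, []), (3, 2 * j + 1, 2 * i, [])]

def spreadOps (i s : ℕ) : List Op := [(2, 2 * i, 2 * s, []), (2, 2 * i + 1, 2 * s + 1, [])]

/-- Half-edges at label `i` may spread to the other labels in `S`. They may also stay if `i ∈ S`;
otherwise states with half-edges left at `i` are thrown away. -/
def relabelOps (i : ℕ) (S : List ℕ) : List Op :=
  (S.filter fun s => !decide (s = i)).flatMap (fun s => spreadOps i s) ++
    if i ∈ S then [] else [(4, 2 * i, 0, []), (4, 2 * i + 1, 0, [])]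

/-- The table of an expression. -/
def tab (n k : ℕ) : RawExpr → Table
  | .intro _ S => introT n k S
  | .union e f => (unionOps k).foldl (act n k) (catT n k (tab n k e) (tab n k f))
  | .join i j e => (joinOps i j).foldl (act n k) (tab n k e)
  | .relabel i S e => (relabelOps i S).foldl (act n k) (tab n k e)

/-- The steps for the outermost operation. -/
def RawExpr.own (k : ℕ) : RawExpr → List Op
  | .intro _ S => [(0, 0, 0, S)]
  | .union _ _ => (1, 0, 0, []) :: unionOps k
  | .join i j _ => joinOps i j
  | .relabel i S _ => relabelOps i S

/-- The arguments of the outermost operation. -/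
def RawExpr.args : RawExpr → List RawExpr
  | .intro _ _ => []
  | .union e f => [e, f]
  | .join _ _ e => [e]
  | .relabel _ _ e => [e]

/-- All steps for an expression. -/
def RawExpr.ops (k : ℕ) : RawExpr → List Op
  | .intro _ S => [(0, 0, 0, S)]
  -- `f` goes first, so that the table of `e` lies on top of the stack when the two are combined.
  | .union e f => f.ops k ++ (e.ops k ++ (1, 0, 0, []) :: unionOps k)
  | .join i j e => e.ops k ++ joinOps i j
  | .relabel i S e => e.ops k ++ relabelOps i S

theorem foldl_exec {n k : ℕ} {os : List Op} (h : ∀ o ∈ os, 2 ≤ o.1) (T : Table)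
    (st : List Table) : os.foldl (exec n k) (T :: st) = os.foldl (act n k) T :: st := by
  induction os generalizing T with
  | nil => rfl
  | cons o os ih =>
    have h0 := h o (by simp)
    rw [List.foldl_cons, List.foldl_cons, ← ih fun o ho => h o (by simp [ho])]
    congr 1
    simp [exec, show o.1 ≠ 0 by omega, show o.1 ≠ 1 by omega]

theorem tag_unionOps {k : ℕ} : ∀ o ∈ unionOps k, 2 ≤ o.1 := by
  intro o ho
  simp only [unionOps, lowerOps, List.mem_append, List.mem_flatMap, List.mem_cons,
    List.not_mem_nil, or_false] at ho
  rcases ho with ⟨l, -, rfl | rfl⟩ | rfl <;> simp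

theorem tag_joinOps {i j : ℕ} : ∀ o ∈ joinOps i j, 2 ≤ o.1 := by
  simp [joinOps]

theorem tag_relabelOps {i : ℕ} {S : List ℕ} : ∀ o ∈ relabelOps i S, 2 ≤ o.1 := by
  intro o ho
  simp only [relabelOps, List.mem_append, List.mem_flatMap] at ho
  rcases ho with ⟨l, -, ho⟩ | ho
  · simp only [spreadOps, List.mem_cons, List.not_mem_nil, or_false] at ho
    rcases ho with rfl | rfl <;> simp
  · split_ifs at ho
    · simp at ho
    · simp only [List.mem_cons, List.not_mem_nil, or_false] at ho
      rcases ho with rfl | rfl <;> simp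

theorem foldl_ops (n k : ℕ) (e : RawExpr) (st : List Table) :
    (e.ops k).foldl (exec n k) st = tab n k e :: st := by
  induction e generalizing st with
  | intro v S => simp [RawExpr.ops, exec, tab]
  | union e f ihe ihf =>
    rw [RawExpr.ops, List.foldl_append, ihf, List.foldl_append, ihe, List.foldl_cons, tab,
      ← foldl_exec tag_unionOps]
    simp [exec]
  | join i j e ih => rw [RawExpr.ops, List.foldl_append, ih, foldl_exec tag_joinOps, tab]
  | relabel i S e ih => rw [RawExpr.ops, List.foldl_append, ih, foldl_exec tag_relabelOps, tab]

/-! ## The tables describe the partial solutions -/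

section Spec

variable {V : Type} [Fintype V] [DecidableEq V]

theorem bodd_add_two_mul (k l : ℕ) : (2 * k + l).bodd = l.bodd := by
  rw [Nat.bodd_add]; simp

/-- The sources `2 * k + l` lie above all targets, so the individual moves do not interfere. -/
theorem Spec.lower {n k N : ℕ} {T : Table} {X : Set V} {adm : V → ℕ → Prop}
    {Q : V × Bool → V × Bool → Prop} (h : Spec (4 * k) N T X adm Q) (hn : Fintype.card V = n)
    (hN : N ≤ 8 * k) (ls : List ℕ) (hls : ∀ l ∈ ls, l < 2 * k) :
    Spec (4 * k) N ((ls.flatMap fun l => lowerOps k l).foldl (act n k) T) X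
      (fun v l => (adm v l ∨ l ∈ ls ∧ adm v (2 * k + l)) ∧ ∀ j ∈ ls, l ≠ 2 * k + j) Q := by
  induction ls generalizing T adm with
  | nil => exact h.congr (by simp) (by simp) le_rfl
  | cons j ls ih =>
    have hj := hls j (by simp)
    have h1 := (h.move hn le_rfl hN (a := 2 * k + j) (b := j) (by omega) (by omega) (by omega)
      (bodd_add_two_mul k j)).drop hn le_rfl hN (2 * k + j)
    refine (ih h1 fun l hl => hls l (by simp [hl])).congr (fun v _ l => ?_) (by simp) le_rfl
    simp only [List.mem_cons, forall_eq_or_imp]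
    constructor
    · rintro ⟨(⟨h2 | ⟨rfl, h2⟩, h3⟩ | ⟨h2, h3 | ⟨h3, -⟩, h4⟩), h5⟩
      · exact ⟨.inl h2, h3, h5⟩
      · exact ⟨.inr ⟨.inl rfl, h2⟩, h3, h5⟩
      · have := hls l (by simp [h2])
        exact ⟨.inr ⟨.inr h2, h3⟩, by omega, h5⟩
      · omega
    · rintro ⟨h2 | ⟨rfl | h2, h3⟩, h4, h5⟩
      · exact ⟨.inl ⟨.inl h2, h4⟩, h5⟩
      · exact ⟨.inl ⟨.inr ⟨rfl, h3⟩, h4⟩, h5⟩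
      · by_cases hlj : l = j
        · subst hlj
          exact ⟨.inl ⟨.inr ⟨rfl, h3⟩, h4⟩, h5⟩
        · exact ⟨.inr ⟨h2, .inl h3, by omega⟩, h5⟩

theorem Spec.union {n k : ℕ} {T T' : Table} {X X' : Set V} {adm adm' : V → ℕ → Prop}
    {Q Q' : V × Bool → V × Bool → Prop} (h : Spec (2 * k) (4 * k) T X adm Q)
    (h' : Spec (2 * k) (4 * k) T' X' adm' Q') (hn : Fintype.card V = n)
    (hX : Disjoint X X') (hne : X.Nonempty) (hne' : X'.Nonempty) :
    Spec (2 * k) (4 * k) ((unionOps k).foldl (act n k) (catT n k T T')) (X ∪ X')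
      (fun v l => v ∈ X ∧ adm v l ∨ v ∈ X' ∧ adm' v l)
      (fun h g => h.1 ∈ X ∧ g.1 ∈ X ∧ Q h g ∨ h.1 ∈ X' ∧ g.1 ∈ X' ∧ Q' h g) := by
  rw [unionOps, List.foldl_append]
  have h1 := ((h.concat h' hn hX hne hne').lower hn le_rfl (List.range (2 * k))
    (by simp)).congr (adm' := fun v l => v ∈ X ∧ adm v l ∨ v ∈ X' ∧ adm' v l)
    (Q' := fun h g => h.1 ∈ X ∧ g.1 ∈ X ∧ Q h g ∨ h.1 ∈ X' ∧ g.1 ∈ X' ∧ Q' h g)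
    (fun v _ l => ?_) (fun _ _ _ _ _ => Iff.rfl) le_rfl
  · refine h1.norm hn le_rfl (by omega) ?_
    rintro v - l (⟨hv, hl⟩ | ⟨hv, hl⟩)
    · exact h.lt v hv l hl
    · exact h'.lt v hv l hl
  · simp only [List.mem_range]
    constructor
    · rintro ⟨(⟨h2, h3⟩ | ⟨h2, h3, h4⟩) | ⟨h5, (⟨h2, h3⟩ | ⟨h2, h3, h4⟩)⟩, h6⟩
      · exact .inl ⟨h2, h3⟩
      · have := h'.lt v h2 _ h4
        exact absurd (by omega) (h6 (l - 2 * k) this)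
      · have := h.lt v h2 _ h3
        omega
      · rw [Nat.add_sub_cancel_left] at h4
        exact .inr ⟨h2, h4⟩
    · rintro (⟨h2, h3⟩ | ⟨h2, h3⟩)
      · have := h.lt v h2 _ h3
        exact ⟨.inl (.inl ⟨h2, h3⟩), fun j hj => by omega⟩
      · have := h'.lt v h2 _ h3
        exact ⟨.inr ⟨this, .inr ⟨h2, by omega, by rwa [Nat.add_sub_cancel_left]⟩⟩,
          fun j hj => by omega⟩

/-- As no target is `i` itself, what is admissible at the two source indices never changes, and the
contributions of the targets simply accumulate. -/
theorem Spec.spread {n k i : ℕ} {T : Table} {X : Set V} {adm : V → ℕ → Prop}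
    {Q : V × Bool → V × Bool → Prop} (h : Spec (2 * k) (4 * k) T X adm Q)
    (hn : Fintype.card V = n) (hi : i < k) (S : List ℕ) (hS : ∀ s ∈ S, s < k ∧ s ≠ i) :
    Spec (2 * k) (4 * k) ((S.flatMap fun s => spreadOps i s).foldl (act n k) T) X
      (fun v l => adm v l ∨ ∃ s ∈ S, l = 2 * s ∧ adm v (2 * i) ∨ l = 2 * s + 1 ∧ adm v (2 * i + 1))
      Q := by
  induction S generalizing T adm with
  | nil => exact h.congr (by simp) (by simp) le_rfl
  | cons s S ih =>
    obtain ⟨h1, h2⟩ := hS s (by simp)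
    have h3 := (h.move (k := k) hn (by omega) (by omega) (a := 2 * i) (b := 2 * s) (by omega)
        (by omega)
      (by omega) (by simp)).move (k := k) hn (by omega) (by omega) (a := 2 * i + 1) (b := 2 * s + 1)
      (by omega) (by omega) (by omega) (by simp)
    refine (ih h3 fun l hl => hS l (by simp [hl])).congr (fun v _ l => ?_)
      (fun _ _ _ _ _ => Iff.rfl) le_rfl
    have e1 : ¬ (2 * i + 1 = 2 * s) := by omega
    have e2 : ¬ (2 * i = 2 * s) := by omega
    have e3 : ¬ (2 * i = 2 * s + 1) := by omega
    have e4 : ¬ (2 * i + 1 = 2 * s + 1) := by omega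
    simp only [List.mem_cons, exists_eq_or_imp, e1, e2, e3, e4, false_and, or_false,
      or_assoc]

theorem Spec.join {n k i j : ℕ} {T : Table} {X : Set V} {adm : V → ℕ → Prop}
    {Q : V × Bool → V × Bool → Prop} (h : Spec (2 * k) (4 * k) T X adm Q)
    (hn : Fintype.card V = n) (hi : i < k) (hj : j < k) (hQ : ∀ h g, Q h g → Q g h) :
    Spec (2 * k) (4 * k) ((joinOps i j).foldl (act n k) T) X adm
      (joinQ adm (joinQ adm Q (2 * i + 1) (2 * j)) (2 * j + 1) (2 * i)) := by
  refine (h.cancel (k := k) hn (by omega) (by omega) (a := 2 * i + 1) (b := 2 * j) (by omega)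
      (by omega)
    (by simp) hQ).cancel (k := k) hn (by omega) (by omega) (a := 2 * j + 1) (b := 2 * i) (by omega)
    (by omega) (by simp) ?_
  rintro h g (h1 | h1 | h1)
  · exact .inl (hQ _ _ h1)
  · exact .inr (.inr ⟨h1.2.2.1, h1.2.2.2, h1.1, h1.2.1⟩)
  · exact .inr (.inl ⟨h1.2.2.1, h1.2.2.2, h1.1, h1.2.1⟩)

end Spec

end HamDP

/-! ### From expressions to tables: `Spec` for labels and edges -/

namespace MultiExpr

variable {V : Type} {k : ℕ}

/-- This is why `catT` may discard zero states: neither side of a union is everything. -/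
theorem verts_nonempty (φ : MultiExpr V k) : φ.verts.Nonempty := by
  induction φ with
  | introduce v S => exact ⟨v, rfl⟩
  | union a b iha _ => exact iha.mono Set.subset_union_left
  | join i j a ih => exact ih
  | relabel i S a ih => exact ih

theorem lab_eq_empty (φ : MultiExpr V k) {v : V} (hv : v ∉ φ.verts) : φ.lab v = ∅ := by
  induction φ with
  | introduce w S => simp only [lab]; rw [if_neg]; exact hv
  | union a b iha ihb =>
    simp only [verts, Set.mem_union, not_or] at hv
    simp [lab, iha hv.1, ihb hv.2]
  | join i j a ih => exact ih hv
  | relabel i S a ih =>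
    have := ih hv
    simp [lab, this]

theorem mem_of_adj (φ : MultiExpr V k) {u v : V} (h : φ.graph.Adj u v) :
    u ∈ φ.verts ∧ v ∈ φ.verts := by
  have hlab : ∀ (ψ : MultiExpr V k) {v : V} {i : Fin k}, i ∈ ψ.lab v → v ∈ ψ.verts := by
    intro ψ v i hi
    by_contra hv
    rw [lab_eq_empty ψ hv] at hi
    simp at hi
  induction φ with
  | introduce w S => simp [graph] at h
  | union a b iha ihb =>
    simp only [graph, SimpleGraph.sup_adj] at h
    rcases h with h | h
    · exact ⟨.inl (iha h).1, .inl (iha h).2⟩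
    · exact ⟨.inr (ihb h).1, .inr (ihb h).2⟩
  | join i j a ih =>
    simp only [graph, SimpleGraph.sup_adj, SimpleGraph.fromRel_adj] at h
    rcases h with h | ⟨-, h | h⟩
    · exact ih h
    · exact ⟨hlab a h.1, hlab a h.2⟩
    · exact ⟨hlab a h.2, hlab a h.1⟩
  | relabel i S a ih => exact ih h

open HamDP

/-- The expression without types. -/
def raw {n : ℕ} : MultiExpr (Fin n) k → RawExpr
  | introduce v S => .intro v ((S.sort (· ≤ ·)).map fun i : Fin k => (i : ℕ))
  | union a b => .union a.raw b.raw
  | join i j a => .join i j a.raw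
  | relabel i S a => .relabel i ((S.sort (· ≤ ·)).map fun i : Fin k => (i : ℕ)) a.raw

theorem mem_sort_map {S : Finset (Fin k)} {l : ℕ} :
    l ∈ (S.sort (· ≤ ·)).map (fun i : Fin k => (i : ℕ)) ↔ ∃ i ∈ S, l = i := by
  simp [eq_comm]

/-- Halving an index gives its label, so a half-edge may wait exactly at the labels of its vertex,
and it may be matched exactly along edges. Each operation is one of the `Spec` lemmas, followed by a
comparison of admissible indices and matches with `lab` and `graph`. -/
theorem spec_tab {n : ℕ} (φ : MultiExpr (Fin n) k) (h : φ.WellFormed) :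
    Spec (2 * k) (4 * k) (tab n k φ.raw) φ.verts (fun v l => ∃ i ∈ φ.lab v, l / 2 = i)
      (fun h g => φ.graph.Adj h.1 g.1) := by
  have hn : Fintype.card (Fin n) = n := Fintype.card_fin n
  induction φ with
  | introduce v S =>
    refine (Spec.single (k := k) hn v (S := (S.sort (· ≤ ·)).map fun i : Fin k => (i : ℕ)) ?_).congr
      ?_ ?_ le_rfl
    · intro i hi
      obtain ⟨j, -, rfl⟩ := mem_sort_map.1 hi
      exact j.2
    · rintro w hw l
      rw [Set.mem_singleton_iff] at hw
      rw [mem_sort_map]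
      simp [lab, hw]
    · intro h g _ _ _
      simp [graph]
  | union a b iha ihb =>
    obtain ⟨ha, hb, hab⟩ := h
    refine ((iha ha).union (ihb hb) hn hab (verts_nonempty a)
      (verts_nonempty b)).congr ?_ ?_ le_rfl
    · intro v hv l
      simp only [lab, Finset.mem_union]
      by_cases hva : v ∈ a.verts
      · have hvb : v ∉ b.verts := Set.disjoint_left.1 hab hva
        simp [hva, hvb, lab_eq_empty b hvb]
      · have hvb : v ∈ b.verts := hv.resolve_left hva
        simp [hva, hvb, lab_eq_empty a hva]
    · intro h g _ _ _
      simp only [graph, SimpleGraph.sup_adj]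
      constructor
      · rintro (h | h)
        · exact .inl h.2.2
        · exact .inr h.2.2
      · rintro (h | h)
        · exact .inl ⟨(mem_of_adj a h).1, (mem_of_adj a h).2, h⟩
        · exact .inr ⟨(mem_of_adj b h).1, (mem_of_adj b h).2, h⟩
  | join i j a ih =>
    obtain ⟨ha, hij, hdis⟩ := h
    refine ((ih ha).join hn i.2 j.2 fun h g h1 => h1.symm).congr (fun _ _ _ => Iff.rfl) ?_ le_rfl
    rintro ⟨u, b⟩ ⟨v, c⟩ hu hv hbc
    have e1 : ∀ (w : Fin n) (i : Fin k), (∃ j ∈ a.lab w, (2 * (i : ℕ) + 1) / 2 = j) ↔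
        i ∈ a.lab w := by
      intro w i
      rw [show (2 * (i : ℕ) + 1) / 2 = i by omega]
      simp [← Fin.ext_iff]
    have e2 : ∀ (w : Fin n) (i : Fin k), (∃ j ∈ a.lab w, (2 * (i : ℕ)) / 2 = j) ↔
        i ∈ a.lab w := by
      intro w i
      rw [show (2 * (i : ℕ)) / 2 = i by omega]
      simp [← Fin.ext_iff]
    -- A match of a vertex with itself would need a vertex that holds both labels, which the side
    -- condition of a join excludes.
    have hne : ∀ {i j : Fin k}, (i ∈ a.lab u ∧ j ∈ a.lab v) → ¬ (i ∈ a.lab u ∧ j ∈ a.lab u) →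
        u ≠ v := by
      rintro i j h1 h2 rfl; exact h2 h1
    have h1 := hdis u hu
    simp only [joinQ, e1, e2, graph, SimpleGraph.sup_adj, SimpleGraph.fromRel_adj]
    have e3 : (2 * (i : ℕ) + 1).bodd = true := by simp
    have e4 : (2 * (j : ℕ) + 1).bodd = true := by simp
    have e5 : (2 * (i : ℕ)).bodd = false := by simp
    have e6 : (2 * (j : ℕ)).bodd = false := by simp
    rw [e3, e4, e5, e6]
    have h2 : i ∈ a.lab u ∧ j ∈ a.lab v → u ≠ v := fun h => hne h h1
    have h3 : j ∈ a.lab u ∧ i ∈ a.lab v → u ≠ v := fun h => hne h (by tauto)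
    generalize (i ∈ a.lab u) = p₁ at *
    generalize (j ∈ a.lab u) = p₂ at *
    generalize (i ∈ a.lab v) = p₃ at *
    generalize (j ∈ a.lab v) = p₄ at *
    cases b <;> cases c <;> simp only [ne_eq, reduceCtorEq, not_true_eq_false, true_and,
        false_and, and_true,
      and_false, or_false, false_or, Bool.false_eq_true, Bool.true_eq_false] at hbc ⊢
    · constructor
      · rintro ((h | h) | h)
        · exact .inl h
        · exact .inr ⟨h3 h, .inr h.symm⟩
        · exact .inr ⟨h2 h, .inl h⟩
      · rintro (h | ⟨-, h | h⟩)
        · exact .inl (.inl h)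
        · exact .inr h
        · exact .inl (.inr h.symm)
    · constructor
      · rintro ((h | h) | h)
        · exact .inl h
        · exact .inr ⟨h2 h, .inl h⟩
        · exact .inr ⟨h3 h, .inr h.symm⟩
      · rintro (h | ⟨-, h | h⟩)
        · exact .inl (.inl h)
        · exact .inl (.inr h)
        · exact .inr h.symm
  | relabel i S a ih =>
    set S' := (S.sort (· ≤ ·)).map fun i : Fin k => (i : ℕ) with hS'
    have hlt : ∀ s ∈ S'.filter fun s => !decide (s = (i : ℕ)), s < k ∧ s ≠ i := by
      intro s hs
      obtain ⟨h1, h2⟩ := List.mem_filter.1 hs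
      obtain ⟨j, -, rfl⟩ := mem_sort_map.1 h1
      exact ⟨j.2, by simpa using h2⟩
    have h1 := (ih h).spread hn i.2 _ hlt
    have hadm : ∀ (v : Fin n) (l : ℕ), ((∃ j ∈ a.lab v, l / 2 = j) ∨ ∃ s ∈ S'.filter fun s =>
        !decide (s = (i : ℕ)),
        l = 2 * s ∧ (∃ j ∈ a.lab v, 2 * (i : ℕ) / 2 = j) ∨
        l = 2 * s + 1 ∧ (∃ j ∈ a.lab v, (2 * (i : ℕ) + 1) / 2 = j)) ↔
        ∃ j : Fin k, l / 2 = j ∧ (j ∈ a.lab v ∨ i ∈ a.lab v ∧ j ∈ S ∧ j ≠ i) := by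
      intro v l
      rw [show (2 * (i : ℕ) + 1) / 2 = i by omega, show (2 * (i : ℕ)) / 2 = i by omega]
      simp only [← Fin.ext_iff, exists_eq_right', List.mem_filter, hS', mem_sort_map,
        Bool.not_eq_true', decide_eq_false_iff_not]
      constructor
      · rintro (⟨j, h1, h2⟩ | ⟨s, ⟨⟨j, h1, rfl⟩, h2⟩, h3⟩)
        · exact ⟨j, h2, .inl h1⟩
        · refine ⟨j, by omega, .inr ⟨?_, h1, fun h => h2 (by rw [h])⟩⟩
          rcases h3 with h3 | h3 <;> exact h3.2
      · rintro ⟨j, h1, h2 | ⟨h2, h3, h4⟩⟩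
        · exact .inl ⟨j, h2, h1⟩
        · refine .inr ⟨j, ⟨⟨j, h3, rfl⟩, fun h => h4 (Fin.ext h)⟩, ?_⟩
          simp only [h2, and_true]
          omega
    simp only [raw, tab, relabelOps, List.foldl_append]
    rw [← hS']
    by_cases hi : i ∈ S
    · rw [if_pos (mem_sort_map.2 ⟨i, hi, rfl⟩)]
      refine h1.congr (fun v _ l => (hadm v l).trans ?_) (fun _ _ _ _ _ => Iff.rfl) le_rfl
      refine ⟨?_, ?_⟩
      · rintro ⟨j, h1, h2⟩
        refine ⟨j, ?_, h1⟩
        simp only [lab]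
        split_ifs with h3
        · rw [Finset.mem_union, Finset.mem_erase]
          by_cases hj : j = i
          · exact .inr (hj ▸ hi)
          · tauto
        · tauto
      · rintro ⟨j, h1, h2⟩
        refine ⟨j, h2, ?_⟩
        simp only [lab] at h1
        split_ifs at h1 with h3
        · rw [Finset.mem_union, Finset.mem_erase] at h1
          by_cases hj : j = i
          · exact .inl (hj ▸ h3)
          · tauto
        · exact .inl h1
    · rw [if_neg (fun h => by
        obtain ⟨j, h1, h2⟩ := mem_sort_map.1 h
        exact hi (Fin.ext h2 ▸ h1))]
      refine ((h1.drop (k := k) hn (by omega) (by omega) (2 * i)).drop (k := k) hn (by omega)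
          (by omega)
        (2 * i + 1)).congr (fun v _ l => ?_) (fun _ _ _ _ _ => Iff.rfl) le_rfl
      rw [hadm v l]
      refine ⟨?_, ?_⟩
      · rintro ⟨⟨⟨j, h1, h2⟩, h4⟩, h5⟩
        have hj : j ≠ i := by rintro rfl; omega
        refine ⟨j, ?_, h1⟩
        simp only [lab]
        split_ifs with h3
        · rw [Finset.mem_union, Finset.mem_erase]
          tauto
        · tauto
      · rintro ⟨j, h1, h2⟩
        have hj : j ≠ i := by
          rintro rfl
          simp only [lab] at h1
          split_ifs at h1 with h3
          · rw [Finset.mem_union, Finset.mem_erase] at h1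
            tauto
          · exact h3 h1
        have hj' : (j : ℕ) ≠ i := fun h => hj (Fin.ext h)
        refine ⟨⟨⟨j, h2, ?_⟩, by omega⟩, by omega⟩
        simp only [lab] at h1
        split_ifs at h1 with h3
        · rw [Finset.mem_union, Finset.mem_erase] at h1
          tauto
        · exact .inl h1

end MultiExpr

namespace HamDP

/-! ## Complete solutions and Hamiltonian cycles -/

section Full

variable {V : Type}

/-- The half-edge that a permutation matches with a half-edge. -/
def partner (p : Equiv.Perm V) (h : V × Bool) : V × Bool :=
  if h.2 = true then (p h.1, false) else (p.symm h.1, true)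

/-- The solution that matches the half-edge leaving `v` with the half-edge entering `p v`. -/
def full (p : Equiv.Perm V) : Partial V := fun h => .inr (partner p h)

theorem full_out (p : Equiv.Perm V) (v : V) : full p (v, true) = .inr (p v, false) := rfl

theorem full_in (p : Equiv.Perm V) (v : V) : full p (v, false) = .inr (p.symm v, true) := rfl

/-- Exchanging two leaving half-edges swaps arguments of `p`; exchanging two entering ones, in
`conj_full_in`, swaps values. -/
theorem conj_full_out [DecidableEq V] (p : Equiv.Perm V) (u v : V) :
    conj (Equiv.swap (u, true) (v, true)) (full p) = full (p * Equiv.swap u v) := by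
  funext ⟨w, b⟩
  have h1 : ∀ w, Equiv.swap (u, true) (v, true) (w, true) = (Equiv.swap u v w, true) := by
    intro w
    simp only [Equiv.swap_apply_def, Prod.mk.injEq, and_true]
    split_ifs <;> rfl
  have h2 : ∀ w, Equiv.swap (u, true) (v, true) (w, false) = (w, false) := by
    intro w
    exact Equiv.swap_apply_of_ne_of_ne (by simp) (by simp)
  unfold conj
  cases b
  · rw [h2, full_in, full_in, Sum.map_inr, h1]
    simp [← Equiv.Perm.inv_def, mul_inv_rev]
  · rw [h1, full_out, full_out, Sum.map_inr, h2]
    rfl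

theorem conj_full_in [DecidableEq V] (p : Equiv.Perm V) (u v : V) :
    conj (Equiv.swap (u, false) (v, false)) (full p) = full (Equiv.swap u v * p) := by
  funext ⟨w, b⟩
  have h1 : ∀ w, Equiv.swap (u, false) (v, false) (w, false) = (Equiv.swap u v w, false) := by
    intro w
    simp only [Equiv.swap_apply_def, Prod.mk.injEq, and_true]
    split_ifs <;> rfl
  have h2 : ∀ w, Equiv.swap (u, false) (v, false) (w, true) = (w, true) := by
    intro w
    exact Equiv.swap_apply_of_ne_of_ne (by simp) (by simp)
  unfold conj
  cases b
  · rw [h1, full_in, full_in, Sum.map_inr, h2]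
    simp [← Equiv.Perm.inv_def, mul_inv_rev]
  · rw [h2, full_out, full_out, Sum.map_inr, h1]
    rfl

/-- A solution in which no half-edge waits comes from a permutation. -/
theorem exists_full {adm : V → ℕ → Prop} {Q : V × Bool → V × Bool → Prop} {f : Partial V}
    (hf : Val Set.univ adm Q f) (h0 : ∀ h l, f h ≠ .inl l) : ∃ p, f = full p := by
  have hp : ∀ h : V × Bool, ∃ w, f h = .inr (w, !h.2) ∧ f (w, !h.2) = .inr h := by
    intro h
    rcases hf h trivial with ⟨l, h1, -⟩ | ⟨⟨w, b⟩, -, h1, h2, h3, -⟩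
    · exact absurd h1 (h0 h l)
    · obtain rfl : b = !h.2 := by revert h3; cases b <;> cases h.2 <;> simp
      exact ⟨w, h1, h2⟩
  choose w h1 h2 using hp
  refine ⟨⟨fun v => w (v, true), fun v => w (v, false), fun v => ?_, fun v => ?_⟩, ?_⟩
  · have h3 := h2 (v, true)
    rw [show (!(v, true).2) = false from rfl, h1] at h3
    exact congrArg Prod.fst (Sum.inr_injective h3)
  · have h3 := h2 (v, false)
    rw [show (!(v, false).2) = true from rfl, h1] at h3
    exact congrArg Prod.fst (Sum.inr_injective h3)
  · funext ⟨v, b⟩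
    cases b
    · exact h1 (v, false)
    · exact h1 (v, true)

/-- A transposition that meets the cycle of `x` once enlarges it. -/
theorem sameCycle_mul_swap [Finite V] [DecidableEq V] {p : Equiv.Perm V} {x u v : V}
    (hu : p.SameCycle x u) (hv : ¬ p.SameCycle x v) :
    (∀ y, p.SameCycle x y → (p * Equiv.swap u v).SameCycle x y) ∧
      (p * Equiv.swap u v).SameCycle x v := by
  set r := p * Equiv.swap u v with hr
  have hru : r v = p u := by simp [hr]
  -- `r` differs from `p` only at `u` and `v`. Starting at `p u`, it follows the old cycle of `u`
  -- all the way to `u`, since `v` is not on it; and `r v = p u` adds `v`.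
  have key : ∀ i : ℕ, r.SameCycle (p u) ((p ^ (i + 1)) u) := by
    intro i
    induction i with
    | zero => simp; rfl
    | succ i ih =>
      set y := (p ^ (i + 1)) u with hy
      have h1 : (p ^ (i + 1 + 1)) u = p y := by rw [pow_succ', Equiv.Perm.mul_apply]
      rw [h1]
      by_cases hyu : y = u
      · rw [hyu]
      · have hyv : y ≠ v := by
          rintro h
          refine hv (hu.trans ?_)
          rw [← h, hy]
          exact ⟨((i + 1 : ℕ) : ℤ), by rw [zpow_natCast]⟩
        have : r y = p y := by rw [hr, Equiv.Perm.mul_apply, Equiv.swap_apply_of_ne_of_ne hyu hyv]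
        rw [← this]
        exact ih.trans ⟨1, by simp⟩
  have hall : ∀ y, p.SameCycle x y → r.SameCycle (p u) y := by
    intro y hy
    obtain ⟨i, hi, -, rfl⟩ := (hu.symm.trans hy).exists_pow_eq''
    obtain ⟨j, rfl⟩ := Nat.exists_eq_add_of_lt hi
    have := key j
    rwa [show j + 1 = 0 + j + 1 by omega] at this
  have hx := hall x (Equiv.Perm.SameCycle.refl _ _)
  refine ⟨fun y hy => hx.symm.trans (hall y hy), hx.symm.trans ?_⟩
  rw [← hru]
  exact (⟨-1, by simp⟩ : r.SameCycle (r v) v)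

end Full

/-! ### Hamiltonian cycles as permutations with one orbit -/

section Hamiltonian

variable {n k : ℕ} {G : SimpleGraph (Fin n)}

/-- A Hamiltonian cycle is a cycle of length `n`, that is, a copy of the cycle graph. The condition
`2 < n` also rules out permutations that run back and forth along one edge. -/
theorem exists_isHamiltonianCycle_iff : (∃ (a : Fin n) (w : G.Walk a a), w.IsHamiltonianCycle) ↔
    2 < n ∧ (SimpleGraph.cycleGraph n).IsContained G := by
  simp only [SimpleGraph.Walk.isHamiltonianCycle_iff_isCycle_and_length_eq, Fintype.card_fin]
  constructor
  · rintro ⟨a, w, h1, h2⟩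
    have hn : 2 < n := by have := h1.three_le_length; omega
    exact ⟨hn, (SimpleGraph.cycleGraph_isContained_iff hn).2 ⟨a, w, h1, h2⟩⟩
  · rintro ⟨hn, h⟩
    exact (SimpleGraph.cycleGraph_isContained_iff hn).1 h

/-- The copy of the cycle is `i ↦ (p ^ i) 0`; it is onto because `p` has a single orbit, hence
injective by finiteness. -/
theorem isContained_of_perm (hn : 2 < n) {p : Equiv.Perm (Fin n)} (hG : ∀ v, G.Adj v (p v))
    (hp : ∀ x y, p.SameCycle x y) : (SimpleGraph.cycleGraph n).IsContained G := by
  obtain ⟨m, rfl⟩ : ∃ m, n = m + 2 := ⟨n - 2, by omega⟩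
  have hc : p.IsCycleOn (Finset.univ : Finset (Fin (m + 2))) :=
    ⟨by simpa using p.bijective, fun x _ y _ => hp x y⟩
  have hstep : ∀ i : Fin (m + 2), (p ^ ((i + 1 : Fin (m + 2)) : ℕ)) 0 = p ((p ^ (i : ℕ)) 0) := by
    intro i
    rw [← Equiv.Perm.mul_apply, ← pow_succ']
    -- At the last index, `i + 1` wraps around to `0`, and `p ^ (m + 2)` fixes `0`.
    by_cases hi : (i : ℕ) = m + 1
    · have : i = Fin.last (m + 1) := Fin.ext hi
      have h1 := hc.pow_card_apply (Finset.mem_univ (0 : Fin (m + 2)))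
      rw [Finset.card_univ, Fintype.card_fin] at h1
      rw [this, Fin.last_add_one, Fin.val_last, h1]
      simp
    · rw [Fin.val_add_one_of_lt]
      exact Fin.lt_last_iff_ne_last.2 fun h => hi (by rw [h]; rfl)
  have hsurj : Function.Surjective fun i : Fin (m + 2) => (p ^ (i : ℕ)) 0 := by
    intro y
    obtain ⟨i, hi, h⟩ := hc.exists_pow_eq (Finset.mem_univ 0) (Finset.mem_univ y)
    rw [Finset.card_univ, Fintype.card_fin] at hi
    exact ⟨⟨i, hi⟩, h⟩
  refine ⟨⟨⟨fun i => (p ^ (i : ℕ)) 0, ?_⟩, Finite.injective_iff_surjective.2 hsurj⟩⟩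
  intro i j hij
  rw [SimpleGraph.cycleGraph_adj] at hij
  rcases hij with h | h
  · rw [sub_eq_iff_eq_add'] at h
    subst h
    change G.Adj ((p ^ ((j + 1 : Fin (m + 2)) : ℕ)) 0) ((p ^ (j : ℕ)) 0)
    rw [hstep]
    exact (hG _).symm
  · rw [sub_eq_iff_eq_add'] at h
    subst h
    change G.Adj ((p ^ (i : ℕ)) 0) ((p ^ ((i + 1 : Fin (m + 2)) : ℕ)) 0)
    rw [hstep]
    exact hG _

-- The permutation is the rotation `i ↦ i + 1` transported to the copy of the cycle. A closed set
-- that contains one vertex contains all its rotations.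
open scoped Fin.NatCast in
theorem perm_of_isContained (hn : 2 < n) (h : (SimpleGraph.cycleGraph n).IsContained G) :
    ∃ p : Equiv.Perm (Fin n), (∀ v, G.Adj v (p v)) ∧
      ∀ C : Set (Fin n), C.Nonempty → (∀ v ∈ C, p v ∈ C) → C = Set.univ := by
  obtain ⟨m, rfl⟩ : ∃ m, n = m + 2 := ⟨n - 2, by omega⟩
  obtain ⟨φ⟩ := h
  set e := Equiv.ofBijective φ (Finite.injective_iff_bijective.1 φ.injective) with he
  refine ⟨(e.symm.trans (Equiv.addRight 1)).trans e, fun v => ?_, fun C hC hstep => ?_⟩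
  · obtain ⟨i, rfl⟩ := e.surjective v
    simp only [Equiv.trans_apply, Equiv.symm_apply_apply, Equiv.coe_addRight]
    refine φ.toHom.map_adj (SimpleGraph.cycleGraph_adj.2 (.inr ?_))
    simp
  · obtain ⟨x, hx⟩ := hC
    obtain ⟨i, rfl⟩ := e.surjective x
    have h1 : ∀ j : ℕ, e (i + (j : Fin (m + 2))) ∈ C := by
      intro j
      induction j with
      | zero => simpa using hx
      | succ j ih =>
        have := hstep _ ih
        simp only [Equiv.trans_apply, Equiv.symm_apply_apply, Equiv.coe_addRight] at this
        rwa [Nat.cast_succ, ← add_assoc]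
    rw [Set.eq_univ_iff_forall]
    intro y
    obtain ⟨j, rfl⟩ := e.surjective y
    have := h1 ((j - i : Fin (m + 2)) : ℕ)
    rwa [Fin.cast_val_eq_self, add_sub_cancel] at this

/-- A zero state yields a permutation in the family whose relation `E` is total. Choose a
permutation of the family, with the same `E`, whose cycle through `x` is largest. If this cycle
missed a vertex, `E` would cross it, and the exchange given by `Fam.swap` would enlarge it.
Conversely, a Hamiltonian cycle is a solution in which nothing waits, and completeness finds a state
for it. -/
theorem Spec.exists_isZero_iff {L N : ℕ} {T : Table} {adm : Fin n → ℕ → Prop} (hn : 2 < n)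
    (h : Spec L N T Set.univ adm fun h g => G.Adj h.1 g.1) :
    (∃ s ∈ T, isZero s = true) ↔ (SimpleGraph.cycleGraph n).IsContained G := by
  classical
  constructor
  · rintro ⟨s, hs, hz⟩
    obtain ⟨C, hC, hT⟩ := h.sound
    obtain ⟨f, E, hf, hi⟩ := hT s hs
    have htok : ∀ l, tok Set.univ f l = ∅ := fun l => by
      rw [← Finset.card_eq_zero, ← hi.count]; exact isZero_iff.1 hz l
    have hE : ∀ v w, E.r v w := by
      intro v w
      rcases hi.reach v trivial with ⟨x, l, h1, -⟩ | ⟨-, h1⟩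
      · simp [htok l] at h1
      · exact h1 w trivial
    obtain ⟨p₀, rfl⟩ := exists_full (hC.val _ _ hf) fun h l hl => by
      have : h ∈ tok Set.univ f l := mem_tok.2 ⟨trivial, hl⟩
      simp [htok l] at this
    let x : Fin n := ⟨0, by omega⟩
    obtain ⟨p, hp, hmax⟩ := Finset.exists_max_image
      (Finset.univ.filter fun p : Equiv.Perm (Fin n) => (full p, E) ∈ C)
      (fun p => (Finset.univ.filter fun y => p.SameCycle x y).card) ⟨p₀, by simpa using hf⟩
    rw [Finset.mem_filter] at hp
    have hbig : ∀ r : Equiv.Perm (Fin n), (full r, E) ∈ C →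
        (∀ y, p.SameCycle x y → r.SameCycle x y) → ∀ v, ¬ p.SameCycle x v → ¬ r.SameCycle x v := by
      intro r hr hle v hv hrv
      refine absurd (hmax r (by simpa using hr)) (not_le.2 (Finset.card_lt_card ?_))
      rw [Finset.ssubset_iff_of_subset]
      · exact ⟨v, by simpa using hrv, by simpa using hv⟩
      · intro y hy
        simp only [Finset.mem_filter, Finset.mem_univ, true_and] at hy ⊢
        exact hle y hy
    have hall : ∀ y, p.SameCycle x y := by
      by_contra hno
      push Not at hno
      obtain ⟨y, hy⟩ := hno
      have hcl : ∀ h g : Fin n × Bool, h.1 ∈ (Set.univ : Set (Fin n)) → full p h = .inr g →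
          (p.SameCycle x h.1 ↔ p.SameCycle x g.1) := by
        rintro ⟨v, b⟩ ⟨w, c⟩ - hg
        cases b
        · rw [full_in] at hg
          cases hg
          simp [← Equiv.Perm.inv_def]
        · rw [full_out] at hg
          cases hg
          simp
      obtain ⟨u, v, b, -, -, hu, hv, -, hmem⟩ := hC.swap _ _ hp.2 (fun y => p.SameCycle x y) hcl
        ⟨x, y, hE x y, Equiv.Perm.SameCycle.refl _ _, hy⟩
      · cases b
        · rw [conj_full_in] at hmem
          -- The transposition stands on the left here; inverses have the same cycles and bring it
          -- to the right.
          have h1 := sameCycle_mul_swap (p := p⁻¹) (x := x) (u := u) (v := v) (by simpa using hu)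
            (by simpa using hv)
          have h2 : (Equiv.swap u v * p)⁻¹ = p⁻¹ * Equiv.swap u v := by simp
          rw [← h2] at h1
          simp only [Equiv.Perm.sameCycle_inv] at h1
          exact hbig _ hmem h1.1 v hv h1.2
        · rw [conj_full_out] at hmem
          have h1 := sameCycle_mul_swap hu hv
          exact hbig _ hmem h1.1 v hv h1.2
    refine isContained_of_perm hn (p := p) (fun v => ?_) fun y z => (hall y).symm.trans (hall z)
    rcases hC.val _ _ hp.2 (v, true) trivial with ⟨l, h1, -⟩ | ⟨g, -, h1, -, -, h2⟩
    · cases h1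
    · rw [full_out] at h1
      cases h1
      exact h2
  · intro hG
    obtain ⟨p, hp, hC⟩ := perm_of_isContained hn hG
    have hval : Val Set.univ adm (fun h g : Fin n × Bool => G.Adj h.1 g.1) (full p) := by
      rintro ⟨v, b⟩ -
      right
      cases b
      · refine ⟨_, trivial, full_in p v, by simp [full_out], by simp, ?_⟩
        have := hp (p.symm v)
        rw [Equiv.apply_symm_apply] at this
        exact this.symm
      · exact ⟨_, trivial, full_out p v, by simp [full_in], by simp, hp v⟩
    obtain ⟨s, hs, κ, hκ⟩ := h.complete (partner p)
      (fun C hne hstep => hC C hne fun v hv => hstep (v, true) hv) (full p) hval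
      (fun x g _ hg => Sum.inr_injective hg)
    refine ⟨s, hs, isZero_iff.2 fun l => ?_⟩
    rw [hκ.count, Finset.card_eq_zero, Finset.eq_empty_iff_forall_notMem]
    intro x hx
    rw [mem_tok] at hx
    cases hx.2

end Hamiltonian

end HamDP

/-! ### Correctness of the dynamic program -/

namespace MultiExpr

open HamDP

theorem exists_isZero_tab_iff {n k : ℕ} {G : SimpleGraph (Fin n)} {φ : MultiExpr (Fin n) k}
    (h : φ.IsExpressionOf G) : (2 < n ∧ ∃ s ∈ tab n k φ.raw, isZero s = true) ↔
      ∃ (a : Fin n) (w : G.Walk a a), w.IsHamiltonianCycle := by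
  rw [exists_isHamiltonianCycle_iff]
  refine and_congr_right fun hn => ?_
  obtain ⟨h1, h2, rfl⟩ := h
  have := spec_tab φ h1
  rw [h2] at this
  exact this.exists_isZero_iff hn

end MultiExpr

/-! ### Further polynomial time functions on lists -/

namespace WhileLang.PT

variable {α β γ : Type} [Enc α] [Enc β] [Enc γ]

theorem headD {l : α → List β} (hl : PT l) (d : β) : PT (fun a => (l a).headD d) := by
  have : PT (fun l : List β => l.headD d) := by
    refine cases (not_nil PT.id) (of_expr (.head (.var 0)) ?_ (Pb.sz.mono ?_))
      ((const d).congr ?_)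
    · rintro ⟨l, hl⟩ s hs
      cases l with
      | nil => simp at hl
      | cons c l => simp [Expr.eval, hs, BTree.head]
    · rintro ⟨l, hl⟩
      cases l with
      | nil => simp at hl
      | cons c l => simp; omega
    · rintro ⟨l, hl⟩
      cases l <;> simp at hl ⊢
  exact this.comp hl

theorem getD {l : α → List β} {i : α → ℕ} (hl : PT l) (hi : PT i) (d : β) :
    PT (fun a => (l a).getD (i a) d) :=
  ((drop hi hl).headD d).congr fun a => by simp [List.headD_eq_head?_getD,
      List.getD_eq_getElem?_getD]

theorem double {f : α → ℕ} (hf : PT f) : PT (fun a => 2 * f a) :=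
  (hf.add hf).congr fun a => by ring

theorem idxOf [DecidableEq β] (h : PT (fun p : β × β => decide (p.1 = p.2))) {f : α → β}
    {l : α → List β} (hf : PT f) (hl : PT l) : PT (fun a => (l a).idxOf (f a)) := by
  have hb : PT (fun x : α × ℕ × β => x.2.2) := PT.snd.comp PT.snd
  have := foldr_add (step := fun x : α × ℕ × β => if x.2.2 = f x.1 then 0 else x.2.1 + 1) hl
    (const 0) (ite (h.comp (hb.pair (hf.comp PT.fst))) (const 0) (succ (PT.fst.comp PT.snd)))
    (q := fun _ => 2) (Pb.const 2) (fun a g b => by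
      simp only; split_ifs <;> simp <;> omega)
  refine this.congr fun a => ?_
  induction l a with
  | nil => rfl
  | cons b l ih =>
    rw [List.foldr_cons, ih]
    simp only [List.idxOf_cons]
    rw [cond_eq_ite]
    simp

end WhileLang.PT

namespace HamDP

/-! ## The dynamic program runs in polynomial time in the size of the tables -/

section Time

variable {α : Type} [Enc α]

theorem pt_state_eq : PT (fun p : State × State => decide (p.1 = p.2)) :=
  PT.list_eq (PT.pair_eq (PT.nat_eq PT.fst PT.snd) (PT.nat_eq PT.fst PT.snd))

theorem pt_cnt {s : α → State} {a : α → ℕ} (hs : PT s) (ha : PT a) :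
    PT (fun x => cnt (s x) (a x)) := PT.fst.comp (hs.getD ha (0, 0))

theorem pt_cls {s : α → State} {a : α → ℕ} (hs : PT s) (ha : PT a) :
    PT (fun x => cls (s x) (a x)) := PT.snd.comp (hs.getD ha (0, 0))

theorem pt_isZero {s : α → State} (hs : PT s) : PT (fun x => isZero (s x)) :=
  hs.all (g := fun x : α × (ℕ × ℕ) => decide (x.2.1 = 0)) (PT.eq_zero (PT.fst.comp PT.snd))

theorem pt_live {s : α → State} {y : α → ℕ} (hy : PT y) (hs : PT s) :
    PT (fun x => live (y x) (s x)) :=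
  hs.any (g := fun x : α × (ℕ × ℕ) => !decide (x.2.1 = 0) && decide (x.2.2 = y x.1))
    ((PT.eq_zero (PT.fst.comp PT.snd)).not.and
      (PT.nat_eq (PT.snd.comp PT.snd) (hy.comp PT.fst)))

theorem pt_shift {s : α → State} {a b ca cb y : α → ℕ} (ha : PT a) (hb : PT b) (hca : PT ca)
    (hcb : PT cb) (hy : PT y) (hs : PT s) :
    PT (fun x => shift (a x) (b x) (ca x) (cb x) (y x) (s x)) := by
  have hl : PT (fun x : α × ℕ × (ℕ × ℕ) => x.2.1) := PT.fst.comp PT.snd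
  have hp : PT (fun x : α × ℕ × (ℕ × ℕ) => x.2.2) := PT.snd.comp PT.snd
  refine hs.mapIdx (g := fun x : α × ℕ × (ℕ × ℕ) =>
    (if x.2.1 = a x.1 then ca x.1 else if x.2.1 = b x.1 then cb x.1 else x.2.2.1,
      if x.2.2.2 = cls (s x.1) (a x.1) ∨ x.2.1 = b x.1 then y x.1 else x.2.2.2)) (PT.pair ?_ ?_)
  · exact PT.ite (hl.nat_eq (ha.comp PT.fst)) (hca.comp PT.fst)
      (PT.ite (hl.nat_eq (hb.comp PT.fst)) (hcb.comp PT.fst) (PT.fst.comp hp))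
  · exact PT.ite ((((PT.snd.comp hp).nat_eq ((pt_cls hs ha).comp PT.fst)).or
      (hl.nat_eq (hb.comp PT.fst))).congr fun _ => (Bool.decide_or _ _).symm) (hy.comp PT.fst)
      (PT.snd.comp hp)

theorem pt_moveN {s : α → State} {m a b : α → ℕ} (hm : PT m) (ha : PT a) (hb : PT b)
    (hs : PT s) : PT (fun x => moveN (m x) (a x) (b x) (s x)) :=
  pt_shift ha hb ((pt_cnt hs ha).sub hm) ((pt_cnt hs hb).add hm)
    (PT.ite (PT.eq_zero (pt_cnt hs hb)) (pt_cls hs ha) (pt_cls hs hb)) hs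

theorem pt_cancelN {s : α → State} {m a b : α → ℕ} (hm : PT m) (ha : PT a) (hb : PT b)
    (hs : PT s) : PT (fun x => cancelN (m x) (a x) (b x) (s x)) :=
  pt_shift ha hb ((pt_cnt hs ha).sub hm) ((pt_cnt hs hb).sub hm) (pt_cls hs hb) hs

theorem pt_moves {s : α → State} {a b : α → ℕ} (ha : PT a) (hb : PT b) (hs : PT s) :
    PT (fun x => moves (a x) (b x) (s x)) :=
  hs.cons ((PT.range (pt_cnt hs ha)).map
    (g := fun x : α × ℕ => moveN (x.2 + 1) (a x.1) (b x.1) (s x.1))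
    (pt_moveN PT.snd.succ (ha.comp PT.fst) (hb.comp PT.fst) (hs.comp PT.fst)))

theorem pt_cancels {s : α → State} {a b : α → ℕ} (ha : PT a) (hb : PT b) (hs : PT s) :
    PT (fun x => cancels (a x) (b x) (s x)) :=
  hs.cons ((((PT.range (pt_cnt hs ha)).filter
    (g := fun x : α × ℕ => decide (x.2 < cnt (s x.1) (b x.1)))
    (PT.lt PT.snd ((pt_cnt hs hb).comp PT.fst))).map
    (g := fun x : α × ℕ => cancelN (x.2 + 1) (a x.1) (b x.1) (s x.1))
    (pt_cancelN PT.snd.succ (ha.comp PT.fst) (hb.comp PT.fst) (hs.comp PT.fst))).filter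
    (g := fun x : α × State => isZero x.2 || live (cls (s x.1) (b x.1)) x.2)
    ((pt_isZero PT.snd).or (pt_live ((pt_cls hs hb).comp PT.fst) PT.snd)))

theorem pt_concat {s t : α → State} {N : α → ℕ} (hN : PT N) (hs : PT s) (ht : PT t) :
    PT (fun x => concat (N x) (s x) (t x)) :=
  hs.append (ht.map (g := fun x : α × (ℕ × ℕ) => (x.2.1, x.2.2 + N x.1))
    ((PT.fst.comp PT.snd).pair ((PT.snd.comp PT.snd).add (hN.comp PT.fst))))

theorem pt_norm {s : α → State} {L : α → ℕ} (hL : PT L) (hs : PT s) :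
    PT (fun x => norm (L x) (s x)) := by
  have h1 : PT (fun x => (s x).map fun p => p.2) :=
    hs.map (g := fun x : α × (ℕ × ℕ) => x.2.2) (PT.snd.comp PT.snd)
  exact (PT.range hL).map (g := fun x : α × ℕ =>
    (cnt (s x.1) x.2, ((s x.1).map fun p => p.2).idxOf (cls (s x.1) x.2)))
    ((pt_cnt (hs.comp PT.fst) PT.snd).pair
      (PT.idxOf (PT.nat_eq PT.fst PT.snd) (pt_cls (hs.comp PT.fst) PT.snd) (h1.comp PT.fst)))

theorem pt_initState {L i j : α → ℕ} (hL : PT L) (hi : PT i) (hj : PT j) :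
    PT (fun x => initState (L x) (i x) (j x)) :=
  (PT.range hL).map (g := fun x : α × ℕ =>
    (if x.2 = 2 * i x.1 + 1 ∨ x.2 = 2 * j x.1 then 1 else 0, 0))
    ((PT.ite (((PT.nat_eq PT.snd (hi.comp PT.fst).double.succ).or
      (PT.nat_eq PT.snd (hj.comp PT.fst).double)).congr fun _ => (Bool.decide_or _ _).symm)
      (PT.const 1) (PT.const 0)).pair (PT.const 0))

theorem pt_undup {T : α → Table} (hT : PT T) : PT (fun x => undup (T x)) := by
  refine PT.foldr_add (step := fun x : α × Table × State =>
    if x.2.2 ∈ x.2.1 then x.2.1 else x.2.2 :: x.2.1) hT (PT.const [])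
    (PT.ite ((PT.mem pt_state_eq (PT.snd.comp PT.snd) (PT.fst.comp PT.snd)).congr
      fun _ => decide_eq_decide.2 Iff.rfl) (PT.fst.comp PT.snd)
      (PT.cons (PT.snd.comp PT.snd) (PT.fst.comp PT.snd)))
    (q := fun x => sz x.2 + 1) ((PT.snd.size).add (Pb.const 1)) (fun a g b => ?_)
  simp only
  split_ifs
  · omega
  · simp; omega

theorem pt_small {s : α → State} {n k : α → ℕ} (hn : PT n) (hk : PT k) (hs : PT s) :
    PT (fun x => small (n x) (k x) (s x)) := by
  have h4 : PT (fun x => 4 * k x) := hk.double.double.congr fun x => by ring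
  have h8 : PT (fun x => 8 * k x) := h4.double.congr fun x => by ring
  exact (PT.le hs.length h4).and (hs.all
    (g := fun x : α × (ℕ × ℕ) => decide (x.2.1 ≤ n x.1) && decide (x.2.2 ≤ 8 * k x.1))
    ((PT.le (PT.fst.comp PT.snd) (hn.comp PT.fst)).and
      (PT.le (PT.snd.comp PT.snd) (h8.comp PT.fst))))

theorem pt_clean {T : α → Table} {n k : α → ℕ} (hn : PT n) (hk : PT k) (hT : PT T) :
    PT (fun x => clean (n x) (k x) (T x)) :=
  pt_undup (hT.filter (g := fun x : α × State => small (n x.1) (k x.1) x.2)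
    (pt_small (hn.comp PT.fst) (hk.comp PT.fst) PT.snd))

theorem pt_introT {S : α → List ℕ} {n k : α → ℕ} (hn : PT n) (hk : PT k) (hS : PT S) :
    PT (fun x => introT (n x) (k x) (S x)) := by
  refine pt_clean hn hk (hS.flatMap
    (g := fun x : α × ℕ => (S x.1).map fun j => initState (2 * k x.1) x.2 j) ?_)
  exact (hS.comp PT.fst).map (g := fun x : (α × ℕ) × ℕ => initState (2 * k x.1.1) x.1.2 x.2)
    (pt_initState (hk.comp (PT.fst.comp PT.fst)).double (PT.snd.comp PT.fst) PT.snd)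

theorem pt_catT {T T' : α → Table} {n k : α → ℕ} (hn : PT n) (hk : PT k) (hT : PT T)
    (hT' : PT T') : PT (fun x => catT (n x) (k x) (T x) (T' x)) := by
  refine pt_clean hn hk (hT.flatMap (g := fun x : α × State => (T' x.1).flatMap fun t =>
    if (isZero x.2 || isZero t) = true then [] else [concat (4 * k x.1) x.2 t]) ?_)
  have h4 : PT (fun x => 4 * k x) := hk.double.double.congr fun x => by ring
  have h1 : PT (fun x : (α × State) × State => x.1.2) := PT.snd.comp PT.fst
  exact (hT'.comp PT.fst).flatMap (g := fun x : (α × State) × State =>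
    if (isZero x.1.2 || isZero x.2) = true then [] else [concat (4 * k x.1.1) x.1.2 x.2])
    (PT.ite (((pt_isZero h1).or (pt_isZero PT.snd)).congr fun _ => by simp) (PT.const [])
      (PT.cons (pt_concat (h4.comp (PT.fst.comp PT.fst)) h1 PT.snd) (PT.const [])))

theorem pt_moveT {T : α → Table} {n k a b : α → ℕ} (hn : PT n) (hk : PT k) (ha : PT a)
    (hb : PT b) (hT : PT T) : PT (fun x => moveT (n x) (k x) (a x) (b x) (T x)) :=
  pt_clean hn hk (hT.flatMap (g := fun x : α × State => moves (a x.1) (b x.1) x.2)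
    (pt_moves (ha.comp PT.fst) (hb.comp PT.fst) PT.snd))

theorem pt_cancelT {T : α → Table} {n k a b : α → ℕ} (hn : PT n) (hk : PT k) (ha : PT a)
    (hb : PT b) (hT : PT T) : PT (fun x => cancelT (n x) (k x) (a x) (b x) (T x)) :=
  pt_clean hn hk (hT.flatMap (g := fun x : α × State => cancels (a x.1) (b x.1) x.2)
    (pt_cancels (ha.comp PT.fst) (hb.comp PT.fst) PT.snd))

theorem pt_dropT {T : α → Table} {n k a : α → ℕ} (hn : PT n) (hk : PT k) (ha : PT a)
    (hT : PT T) : PT (fun x => dropT (n x) (k x) (a x) (T x)) :=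
  pt_clean hn hk (hT.filter (g := fun x : α × State => decide (cnt x.2 (a x.1) = 0))
    (PT.eq_zero (pt_cnt PT.snd (ha.comp PT.fst))))

theorem pt_normT {T : α → Table} {n k : α → ℕ} (hn : PT n) (hk : PT k) (hT : PT T) :
    PT (fun x => normT (n x) (k x) (T x)) :=
  pt_clean hn hk (hT.map (g := fun x : α × State => norm (2 * k x.1) x.2)
    (pt_norm (hk.comp PT.fst).double PT.snd))

theorem pt_exec {st : α → List Table} {o : α → Op} {n k : α → ℕ} (hn : PT n) (hk : PT k)
    (hst : PT st) (ho : PT o) : PT (fun x => exec (n x) (k x) (st x) (o x)) := by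
  have h1 : PT (fun x => (o x).1) := PT.fst.comp ho
  have h2 : PT (fun x => (o x).2.1) := PT.fst.comp (PT.snd.comp ho)
  have h3 : PT (fun x => (o x).2.2.1) := PT.fst.comp (PT.snd.comp (PT.snd.comp ho))
  have h4 : PT (fun x => (o x).2.2.2) := PT.snd.comp (PT.snd.comp (PT.snd.comp ho))
  have hT := hst.headD []
  have htag : ∀ i : ℕ, PT (fun x => decide ((o x).1 = i)) := fun i => h1.nat_eq (PT.const i)
  unfold exec act
  exact PT.ite (htag 0) (PT.cons (pt_introT hn hk h4) hst)
    (PT.ite (htag 1) (PT.cons (pt_catT hn hk hT (hst.tail.headD [])) hst.tail.tail)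
      (PT.cons (PT.ite (htag 2) (pt_moveT hn hk h2 h3 hT)
        (PT.ite (htag 3) (pt_cancelT hn hk h2 h3 hT)
          (PT.ite (htag 4) (pt_dropT hn hk h2 hT) (pt_normT hn hk hT)))) hst.tail))

end Time

end HamDP

namespace HamDP

/-! ## Flattening an expression -/

/-- The tree that represents an expression. -/
def RawExpr.tree : RawExpr → BTree
  | .intro v S => BTree.ofList [enc 0, enc v, enc S]
  | .union e f => BTree.ofList [enc 1, e.tree, f.tree]
  | .join i j e => BTree.ofList [enc 2, enc i, enc j, e.tree]
  | .relabel i S e => BTree.ofList [enc 3, enc i, enc S, e.tree]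

instance : Enc RawExpr := ⟨RawExpr.tree⟩

theorem RawExpr.enc_intro (v : ℕ) (S : List ℕ) : enc (RawExpr.intro v S) = enc (0, v, S, ()) := rfl
theorem RawExpr.enc_union (e f : RawExpr) : enc (RawExpr.union e f) = enc (1, e, f, ()) := rfl
theorem RawExpr.enc_join (i j : ℕ) (e : RawExpr) :
    enc (RawExpr.join i j e) = enc (2, i, j, e, ()) := rfl
theorem RawExpr.enc_relabel (i : ℕ) (S : List ℕ) (e : RawExpr) :
    enc (RawExpr.relabel i S e) = enc (3, i, S, e, ()) := rfl

/-- The kind of the outermost operation. -/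
def RawExpr.tag : RawExpr → ℕ
  | .intro _ _ => 0
  | .union _ _ => 1
  | .join _ _ _ => 2
  | .relabel _ _ _ => 3

/-- The label set of the outermost operation. -/
def RawExpr.labels : RawExpr → List ℕ
  | .intro _ S => S
  | .relabel _ S _ => S
  | _ => []

/-- The first label of the outermost operation. -/
def RawExpr.label₁ : RawExpr → ℕ
  | .join i _ _ => i
  | .relabel i _ _ => i
  | _ => 0

/-- The second label of the outermost operation. -/
def RawExpr.label₂ : RawExpr → ℕ
  | .join _ j _ => j
  | _ => 0

/-- The number of operations. -/
def RawExpr.nodes : RawExpr → ℕ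
  | .intro _ _ => 1
  | .union e f => e.nodes + f.nodes + 1
  | .join _ _ e => e.nodes + 1
  | .relabel _ _ e => e.nodes + 1

theorem RawExpr.nodes_pos (e : RawExpr) : 1 ≤ e.nodes := by
  cases e <;> simp [nodes]

theorem RawExpr.sz_intro (v : ℕ) (S : List ℕ) : sz (RawExpr.intro v S) = sz (0, v, S, ()) := rfl
theorem RawExpr.sz_union (e f : RawExpr) : sz (RawExpr.union e f) = sz (1, e, f, ()) := rfl
theorem RawExpr.sz_join (i j : ℕ) (e : RawExpr) :
    sz (RawExpr.join i j e) = sz (2, i, j, e, ()) := rfl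
theorem RawExpr.sz_relabel (i : ℕ) (S : List ℕ) (e : RawExpr) :
    sz (RawExpr.relabel i S e) = sz (3, i, S, e, ()) := rfl

theorem RawExpr.nodes_le_sz (e : RawExpr) : e.nodes ≤ sz e := by
  induction e with
  | intro v S => exact sz_pos _
  | union e f ihe ihf => rw [sz_union]; simp only [nodes, sz_pair]; omega
  | join i j e ih => rw [sz_join]; simp only [nodes, sz_pair]; omega
  | relabel i S e ih => rw [sz_relabel]; simp only [nodes, sz_pair]; omega

section Time

variable {α : Type} [Enc α]

theorem pt_tag {e : α → RawExpr} (he : PT e) : PT (fun x => (e x).tag) := by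
  have : PT RawExpr.tag := by
    refine PT.of_expr (.head (.var 0)) (fun e s hs => ?_) ((Pb.const 7).mono fun e => ?_)
    · cases e <;> simp [Expr.eval, hs, RawExpr.enc_intro, RawExpr.enc_union, RawExpr.enc_join,
        RawExpr.enc_relabel, BTree.head, RawExpr.tag]
    · cases e <;> simp [RawExpr.tag]
  exact this.comp he

theorem pt_tag_eq {e : α → RawExpr} (he : PT e) (i : ℕ) :
    PT (fun x => decide ((e x).tag = i)) := (pt_tag he).nat_eq (PT.const i)

theorem pt_labels {e : α → RawExpr} (he : PT e) : PT (fun x => (e x).labels) := by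
  have : PT RawExpr.labels := by
    refine PT.cases ((pt_tag_eq PT.id 0).or (pt_tag_eq PT.id 3))
      (PT.of_expr (.head (.tail (.tail (.var 0)))) ?_ (Pb.sz.mono ?_)) ((PT.const []).congr ?_)
    · rintro ⟨e, he⟩ s hs
      cases e <;> simp [RawExpr.tag] at he <;>
        simp [Expr.eval, hs, RawExpr.enc_intro, RawExpr.enc_relabel, BTree.head, BTree.tail,
          RawExpr.labels]
    · rintro ⟨e, he⟩
      cases e <;> simp [RawExpr.tag] at he <;>
        simp [RawExpr.sz_intro, RawExpr.sz_relabel, RawExpr.labels] <;> omega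
    · rintro ⟨e, he⟩
      cases e <;> simp [RawExpr.tag] at he <;> rfl
  exact this.comp he

theorem pt_label₁ {e : α → RawExpr} (he : PT e) : PT (fun x => (e x).label₁) := by
  have : PT RawExpr.label₁ := by
    refine PT.cases ((pt_tag_eq PT.id 2).or (pt_tag_eq PT.id 3))
      (PT.of_expr (.head (.tail (.var 0))) ?_ (Pb.sz.mono ?_)) ((PT.const 0).congr ?_)
    · rintro ⟨e, he⟩ s hs
      cases e <;> simp [RawExpr.tag] at he <;>
        simp [Expr.eval, hs, RawExpr.enc_join, RawExpr.enc_relabel, BTree.head, BTree.tail,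
          RawExpr.label₁]
    · rintro ⟨e, he⟩
      cases e <;> simp [RawExpr.tag] at he <;>
        simp [RawExpr.sz_join, RawExpr.sz_relabel, RawExpr.label₁] <;> omega
    · rintro ⟨e, he⟩
      cases e <;> simp [RawExpr.tag] at he <;> rfl
  exact this.comp he

theorem pt_label₂ {e : α → RawExpr} (he : PT e) : PT (fun x => (e x).label₂) := by
  have : PT RawExpr.label₂ := by
    refine PT.cases (pt_tag_eq PT.id 2)
      (PT.of_expr (.head (.tail (.tail (.var 0)))) ?_ (Pb.sz.mono ?_)) ((PT.const 0).congr ?_)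
    · rintro ⟨e, he⟩ s hs
      cases e <;> simp [RawExpr.tag] at he <;>
        simp [Expr.eval, hs, RawExpr.enc_join, BTree.head, BTree.tail, RawExpr.label₂]
    · rintro ⟨e, he⟩
      cases e <;> simp [RawExpr.tag] at he <;>
        simp [RawExpr.sz_join, RawExpr.label₂] <;> omega
    · rintro ⟨e, he⟩
      cases e <;> simp [RawExpr.tag] at he <;> rfl
  exact this.comp he

/-- Keeps the worklist of the flattening no larger than at its start. -/
theorem RawExpr.sz_args_append (e : RawExpr) (w : List RawExpr) : sz (e.args ++ w) ≤ sz (e :: w)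
    := by
  cases e <;> simp [RawExpr.args, RawExpr.sz_intro, RawExpr.sz_union, RawExpr.sz_join,
    RawExpr.sz_relabel] <;> omega

theorem pt_args {e : α → RawExpr} (he : PT e) : PT (fun x => (e x).args) := by
  have : PT RawExpr.args := by
    have hsz : ∀ e : RawExpr, sz e.args ≤ sz e + 2 := fun e => by
      have := e.sz_args_append []
      simpa using this
    refine PT.cases (pt_tag_eq PT.id 0) ((PT.const []).congr ?_)
      (PT.cases ((pt_tag_eq PT.id 1).restrict _)
        (PT.of_expr (.tail (.var 0)) ?_ ((Pb.sz.add (Pb.const 2)).mono fun e => hsz e.1.1))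
        (PT.of_expr (.tail (.tail (.tail (.var 0)))) ?_
          ((Pb.sz.add (Pb.const 2)).mono fun e => hsz e.1.1)))
    · rintro ⟨e, he⟩
      cases e <;> simp [RawExpr.tag] at he <;> rfl
    · rintro ⟨⟨e, he⟩, he'⟩ s hs
      cases e <;> simp [RawExpr.tag] at he he' <;>
        simp [Expr.eval, hs, RawExpr.enc_union, BTree.tail, RawExpr.args]
    · rintro ⟨⟨e, he⟩, he'⟩ s hs
      cases e <;> simp [RawExpr.tag] at he he' <;>
        simp [Expr.eval, hs, RawExpr.enc_join, RawExpr.enc_relabel, BTree.tail, RawExpr.args]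
  exact this.comp he

theorem pt_op {t : ℕ} {a b : α → ℕ} {S : α → List ℕ} (ha : PT a) (hb : PT b) (hS : PT S) :
    PT (fun x => ((t, a x, b x, S x) : Op)) :=
  (PT.const t).pair (ha.pair (hb.pair hS))

theorem pt_unionOps {k : α → ℕ} (hk : PT k) : PT (fun x => unionOps (k x)) := by
  have h1 : PT (fun x : α × ℕ => 2 * k x.1 + x.2) := (hk.comp PT.fst).double.add PT.snd
  exact ((PT.range hk.double).flatMap (g := fun x : α × ℕ => lowerOps (k x.1) x.2)
    (PT.cons (pt_op h1 PT.snd (PT.const []))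
      (PT.cons (pt_op h1 (PT.const 0) (PT.const [])) (PT.const [])))).append (PT.const _)

theorem pt_joinOps {i j : α → ℕ} (hi : PT i) (hj : PT j) : PT (fun x => joinOps (i x) (j x)) :=
  PT.cons (pt_op hi.double.succ hj.double (PT.const []))
    (PT.cons (pt_op hj.double.succ hi.double (PT.const [])) (PT.const []))

theorem pt_relabelOps {i : α → ℕ} {S : α → List ℕ} (hi : PT i) (hS : PT S) :
    PT (fun x => relabelOps (i x) (S x)) := by
  have h1 : PT (fun x : α × ℕ => i x.1) := hi.comp PT.fst
  refine ((hS.filter (g := fun x : α × ℕ => !decide (x.2 = i x.1))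
    (PT.nat_eq PT.snd h1).not).flatMap (g := fun x : α × ℕ => spreadOps (i x.1) x.2)
    (PT.cons (pt_op h1.double PT.snd.double (PT.const []))
      (PT.cons (pt_op h1.double.succ PT.snd.double.succ (PT.const [])) (PT.const [])))).append ?_
  exact PT.ite ((PT.mem (PT.nat_eq PT.fst PT.snd) hi hS).congr
    fun _ => decide_eq_decide.2 Iff.rfl) (PT.const [])
    (PT.cons (pt_op hi.double (PT.const 0) (PT.const []))
      (PT.cons (pt_op hi.double.succ (PT.const 0) (PT.const [])) (PT.const [])))

theorem pt_own {k : α → ℕ} {e : α → RawExpr} (hk : PT k) (he : PT e) :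
    PT (fun x => (e x).own (k x)) := by
  refine (PT.ite (pt_tag_eq he 0)
    (PT.cons (pt_op (t := 0) (PT.const 0) (PT.const 0) (pt_labels he)) (PT.const []))
    (PT.ite (pt_tag_eq he 1) (PT.cons (PT.const (1, 0, 0, [])) (pt_unionOps hk))
      (PT.ite (pt_tag_eq he 2) (pt_joinOps (pt_label₁ he) (pt_label₂ he))
        (pt_relabelOps (pt_label₁ he) (pt_labels he))))).congr fun x => ?_
  cases e x <;> simp [RawExpr.tag, RawExpr.own, RawExpr.label₁, RawExpr.label₂, RawExpr.labels]

end Time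

/-- One step of the flattening: the state holds the number of labels, the expressions that are
still to be treated, and the steps of the program that follow. -/
def flattenStep (g : ℕ × List RawExpr × List Op) : ℕ × List RawExpr × List Op :=
  (g.1, (g.2.1.headD (.intro 0 [])).args ++ g.2.1.tail,
    (g.2.1.headD (.intro 0 [])).own g.1 ++ g.2.2)

theorem flattenStep_cons (k : ℕ) (e : RawExpr) (w : List RawExpr) (o : List Op) :
    flattenStep (k, e :: w, o) = (k, e.args ++ w, e.own k ++ o) := rfl

theorem pt_flattenStep : PT flattenStep := by
  have h1 : PT (fun g : ℕ × List RawExpr × List Op => g.2.1.headD (.intro 0 [])) :=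
    (PT.fst.comp PT.snd).headD _
  exact PT.fst.pair (((pt_args h1).append (PT.fst.comp PT.snd).tail).pair
    ((pt_own PT.fst h1).append (PT.snd.comp PT.snd)))

/-- The number of operations in a list of expressions. -/
def nodesSum (w : List RawExpr) : ℕ := (w.map RawExpr.nodes).sum

theorem nodesSum_args_append (e : RawExpr) (w : List RawExpr) :
    nodesSum (e.args ++ w) + 1 = nodesSum (e :: w) := by
  cases e <;> simp [nodesSum, RawExpr.args, RawExpr.nodes] <;> omega

/-- The invariant of the flattening: the steps still to be produced for the worklist, put in front
of those produced already, always make up the same list. -/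
theorem foldl_args_append (k : ℕ) (e : RawExpr) (w : List RawExpr) (o : List Op) :
    (e.args ++ w).foldl (fun acc e => e.ops k ++ acc) (e.own k ++ o) =
      (e :: w).foldl (fun acc e => e.ops k ++ acc) o := by
  cases e <;> simp [RawExpr.args, RawExpr.own, RawExpr.ops]

theorem flattenStep_iterate (k m : ℕ) (w : List RawExpr) (o : List Op) (h : nodesSum w = m) :
    flattenStep^[m] (k, w, o) = (k, [], w.foldl (fun acc e => e.ops k ++ acc) o) := by
  induction m generalizing w o with
  | zero =>
    cases w with
    | nil => rfl
    | cons e w =>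
      have := e.nodes_pos
      simp [nodesSum] at h
      omega
  | succ m ih =>
    cases w with
    | nil => simp [nodesSum] at h
    | cons e w =>
      rw [Function.iterate_succ_apply, flattenStep_cons, ih, foldl_args_append]
      have := nodesSum_args_append e w
      omega

theorem flattenStep_bounds (k B : ℕ) (w : List RawExpr) (o : List Op)
    (hB : ∀ e : RawExpr, sz e ≤ sz w → sz (e.own k) ≤ B) (i : ℕ) (hi : i ≤ nodesSum w) :
    ∃ w' o', flattenStep^[i] (k, w, o) = (k, w', o') ∧ nodesSum w' + i = nodesSum w ∧
      sz w' ≤ sz w ∧ sz o' ≤ sz o + i * B := by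
  induction i with
  | zero => exact ⟨w, o, rfl, rfl, le_rfl, by simp⟩
  | succ i ih =>
    obtain ⟨w', o', h1, h2, h3, h4⟩ := ih (by omega)
    cases w' with
    | nil => simp [nodesSum] at h2; simp [nodesSum] at hi; omega
    | cons e w' =>
      refine ⟨e.args ++ w', e.own k ++ o', ?_, ?_, (e.sz_args_append w').trans h3, ?_⟩
      · rw [Function.iterate_succ_apply', h1, flattenStep_cons]
      · have := nodesSum_args_append e w'
        omega
      · have h5 := sz_append (e.own k) o'
        have h6 := hB e ((sz_le_of_mem (by simp)).trans h3)
        rw [Nat.succ_mul]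
        omega

/-- The recursion over the tree becomes a loop with a worklist. Every iteration removes one
operation, so their number is at most the input size, and each adds only a polynomial amount of
output. -/
theorem pt_ops : PT (fun x : ℕ × RawExpr => x.2.ops x.1) := by
  obtain ⟨T, hT, ⟨c, hc⟩, -⟩ := pt_flattenStep
  obtain ⟨d, hd⟩ := (pt_own (α := ℕ × RawExpr) PT.fst PT.snd).size
  obtain ⟨Tf, hf, hTf, -⟩ : PT (fun x : ℕ × RawExpr => (x.1, [x.2], ([] : List Op))) :=
    PT.fst.pair ((PT.cons PT.snd (PT.const [])).pair (PT.const []))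
  -- Bounds the steps emitted in one iteration. The summand `5` leaves room for the singleton list
  -- around the expression.
  set B : ℕ × RawExpr → ℕ := fun x => d * (sz x + 5) ^ d with hBdef
  have hB : Pb B := (Pb.const d).mul ((Pb.sz.add (Pb.const 5)).pow d)
  have hBown : ∀ x : ℕ × RawExpr, ∀ e : RawExpr, sz e ≤ sz [x.2] → sz (e.own x.1) ≤ B x := by
    rintro ⟨k, e'⟩ e he
    refine (hd (k, e)).trans ?_
    have h1 : sz (k, e) ≤ sz (k, e') + 5 := by
      simp only [sz_pair, sz_cons, sz_nil] at he ⊢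
      omega
    simp only [hBdef]
    gcongr
  set S : ℕ × RawExpr → ℕ := fun x => sz x + (1 + sz x * B x) + 10 with hSdef
  have hS : Pb S := (Pb.sz.add ((Pb.const 1).add (Pb.sz.mul hB))).add (Pb.const 10)
  have hnodes : ∀ x : ℕ × RawExpr, nodesSum [x.2] = x.2.nodes := fun x => by simp [nodesSum]
  have hle : ∀ x : ℕ × RawExpr, x.2.nodes ≤ sz x := fun x => by
    have := x.2.nodes_le_sz
    rw [sz_prod]; omega
  have hiter : ∀ (x : ℕ × RawExpr), ∀ i ≤ x.2.nodes, ∃ w' o',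
      flattenStep^[i] (x.1, [x.2], []) = (x.1, w', o') ∧ nodesSum w' + i = x.2.nodes ∧
      sz (x.1, w', o') ≤ S x := by
    intro x i hi
    obtain ⟨w', o', h1, h2, h3, h4⟩ := flattenStep_bounds x.1 (B x) [x.2] [] (hBown x) i
      (by rw [hnodes]; exact hi)
    refine ⟨w', o', h1, by rw [h2, hnodes], ?_⟩
    have h5 : i * B x ≤ sz x * B x := Nat.mul_le_mul_right _ (hi.trans (hle x))
    simp only [sz_pair, sz_cons, sz_nil, hSdef, sz_prod x] at *
    omega
  have hloop := Comp.loop (e := .head (.tail (.var 0)))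
    (C := fun g : ℕ × List RawExpr × List Op => g.2.1 ≠ [])
    (fun g s hs => by
      obtain ⟨k, w, o⟩ := g
      simp only [Expr.eval, hs, enc_pair, BTree.tail, BTree.head, ne_eq, enc_list_eq_nil])
    (Ts := T) (hT.cast _ _ (fun _ => rfl) (fun _ => rfl)) hf
    (it := fun x => x.2.nodes) (B := fun x => c * S x ^ c) ?_ ?_ ?_
  · refine PT.congr (f := fun x : ℕ × RawExpr =>
      (flattenStep^[x.2.nodes] (x.1, [x.2], [])).2.2) ?_ ?_
    · refine PT.snd.comp (PT.snd.comp ⟨_, hloop, ?_, hS.mono fun x => ?_⟩)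
      · exact (((hTf.add (Pb.mul (Pb.sz.mono hle) ((((Pb.const c).mul (hS.pow c)).add
          (Pb.const _)).add (Pb.const 1)))).add (Pb.const _)).add (Pb.const 1))
      · obtain ⟨w', o', h1, -, h2⟩ := hiter x _ le_rfl
        beta_reduce
        rw [h1]; exact h2
    · intro x
      rw [flattenStep_iterate _ _ _ _ (hnodes x)]
      simp
  · intro x i hi
    obtain ⟨w', o', h1, h2, -⟩ := hiter x i hi.le
    rw [h1]
    rintro rfl
    simp [nodesSum] at h2
    omega
  · intro x
    rw [flattenStep_iterate _ _ _ _ (hnodes x)]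
    simp
  · intro x i hi
    obtain ⟨w', o', h1, -, h2⟩ := hiter x i hi.le
    rw [h1]
    exact (hc _).trans (by gcongr)

end HamDP

namespace HamDP

/-! ## The size of the tables -/

/-- A bound for the number of states. -/
def stateBound (n k : ℕ) : ℕ := ((n + 1) * (8 * k + 1) + 1) ^ (4 * k)

/-- Tables without repetitions all of whose states are small. -/
def Tidy (n k : ℕ) (T : Table) : Prop := T.Nodup ∧ ∀ s ∈ T, small n k s = true

theorem tidy_clean (n k : ℕ) (T : Table) : Tidy n k (clean n k T) :=
  ⟨nodup_undup _, fun _ hs => (mem_clean.1 hs).2⟩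

theorem small_iff {n k : ℕ} {s : State} :
    small n k s = true ↔ s.length ≤ 4 * k ∧ ∀ p ∈ s, p.1 ≤ n ∧ p.2 ≤ 8 * k := by
  simp [small]

/-- A small state is determined by its entries at the first `4 * k` positions. Each is one of `(n +
1) * (8 * k + 1)` pairs or missing, which explains the final `+ 1` in the base of `stateBound`. -/
theorem Tidy.length_le {n k : ℕ} {T : Table} (h : Tidy n k T) : T.length ≤ stateBound n k := by
  classical
  set A : Finset (Option (ℕ × ℕ)) :=
    Finset.insertNone (Finset.range (n + 1) ×ˢ Finset.range (8 * k + 1)) with hA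
  have hcard : (Fintype.piFinset fun _ : Fin (4 * k) => A).card = stateBound n k := by
    simp [hA, stateBound]
  rw [← hcard, ← List.toFinset_card_of_nodup h.1]
  refine Finset.card_le_card_of_injOn (fun s i => s[(i : ℕ)]?) ?_ ?_
  · intro s hs
    rw [Finset.mem_coe, List.mem_toFinset] at hs
    obtain ⟨h1, h2⟩ := small_iff.1 (h.2 s hs)
    rw [Finset.mem_coe, Fintype.mem_piFinset]
    intro i
    rw [hA, Finset.mem_insertNone]
    intro p hp
    have := h2 p (List.mem_of_getElem? hp)
    rw [Finset.mem_product, Finset.mem_range, Finset.mem_range]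
    omega
  · intro s hs t ht hst
    rw [Finset.mem_coe, List.mem_toFinset] at hs ht
    have h1 := (small_iff.1 (h.2 s hs)).1
    have h2 := (small_iff.1 (h.2 t ht)).1
    refine List.ext_getElem? fun i => ?_
    by_cases hi : i < 4 * k
    · exact congrFun hst ⟨i, hi⟩
    · rw [List.getElem?_eq_none (by omega), List.getElem?_eq_none (by omega)]

/-- A bound for the size of a table in terms of a bound for the number of states. -/
def tableBound (n k M : ℕ) : ℕ := M * (4 * k * (2 * n + 16 * k + 4) + 1 + 1) + 1

theorem Tidy.sz_le {n k : ℕ} {T : Table} (h : Tidy n k T) :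
    sz T ≤ tableBound n k (stateBound n k) := by
  have h1 : ∀ s ∈ T, sz s ≤ 4 * k * (2 * n + 16 * k + 4) + 1 := by
    intro s hs
    obtain ⟨h1, h2⟩ := small_iff.1 (h.2 s hs)
    refine (sz_le_mul (M := 2 * n + 16 * k + 3) fun p hp => ?_).trans ?_
    · have := h2 p hp
      rw [sz_prod, sz_nat, sz_nat]; omega
    · gcongr
  refine (sz_le_mul h1).trans ?_
  unfold tableBound
  gcongr
  exact h.length_le

theorem tidy_act (n k : ℕ) (T : Table) (o : Op) : Tidy n k (act n k T o) := by
  unfold act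
  split_ifs <;> exact tidy_clean _ _ _

theorem tidy_exec {n k : ℕ} {st : List Table} (h : ∀ T ∈ st, Tidy n k T) (o : Op) :
    ∀ T ∈ exec n k st o, Tidy n k T := by
  intro T hT
  unfold exec at hT
  split_ifs at hT
  · rcases List.mem_cons.1 hT with rfl | hT
    · exact tidy_clean _ _ _
    · exact h T hT
  · rcases List.mem_cons.1 hT with rfl | hT
    · exact tidy_clean _ _ _
    · exact h T (List.mem_of_mem_tail (List.mem_of_mem_tail hT))
  · rcases List.mem_cons.1 hT with rfl | hT
    · exact tidy_act _ _ _ _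
    · exact h T (List.mem_of_mem_tail hT)

theorem length_exec_le (n k : ℕ) (st : List Table) (o : Op) :
    (exec n k st o).length ≤ st.length + 1 := by
  unfold exec
  split_ifs <;> simp
  omega

theorem foldl_exec_tidy (n k : ℕ) (os : List Op) :
    (∀ T ∈ os.foldl (exec n k) [], Tidy n k T) ∧
      (os.foldl (exec n k) []).length ≤ os.length := by
  induction os using List.reverseRecOn with
  | nil => simp
  | append_singleton os o ih =>
    rw [List.foldl_append]
    refine ⟨tidy_exec ih.1 o, (length_exec_le _ _ _ _).trans ?_⟩
    simpa using ih.2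

/-- Holds for arbitrary lists of steps, in particular for every prefix of a run, as the time bound
of `Comp.foldl` demands: a step adds at most one table to the stack, and every table it creates is
cleaned. -/
theorem sz_foldl_exec_le (n k : ℕ) (os : List Op) :
    sz (os.foldl (exec n k) []) ≤ os.length * (tableBound n k (stateBound n k) + 1) + 1 := by
  obtain ⟨h1, h2⟩ := foldl_exec_tidy n k os
  refine (sz_le_mul fun T hT => (h1 T hT).sz_le).trans ?_
  gcongr

/-! ## The algorithm -/

/-- The input: the number of labels, the rows of the adjacency matrix, and the expression. -/
abbrev Input : Type := ℕ × List (List ℕ) × RawExpr × Unit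

/-- The number of vertices. -/
def Input.order (x : Input) : ℕ := x.2.1.length

/-- The answer of the algorithm. -/
def answer (x : Input) : Bool :=
  decide (2 < x.order) && (((x.2.2.1.ops x.1).foldl (exec x.order x.1) []).headD []).any
    fun s => isZero s

theorem answer_eq (x : Input) :
    answer x = (decide (2 < x.order) && (tab x.order x.1 x.2.2.1).any fun s => isZero s) := by
  rw [answer, foldl_ops]; rfl

/-- The time is not polynomial in the input alone. The number of states is therefore treated as a
further argument `p.2`, so that the calculus of `Pb` applies, and `stateBound` is substituted at the
end. A pair with a number `M` in unary has size larger by `2 * M + 2`, whence the form of the bound.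
-/
theorem comp_run : ∃ (T : (ℕ × ℕ) × List Op → ℕ) (c : ℕ),
    Comp (fun a : (ℕ × ℕ) × List Op => a.2.foldl (exec a.1.1 a.1.2) []) T ∧
    ∀ a, T a ≤ c * (sz a + 2 * stateBound a.1.1 a.1.2 + 2) ^ c := by
  obtain ⟨Tl, hl, hTl, -⟩ : PT (fun a : (ℕ × ℕ) × List Op => a.2) := PT.snd
  obtain ⟨Ti, hi, hTi, -⟩ : PT (fun _ : (ℕ × ℕ) × List Op => ([] : List Table)) := PT.const []
  have hn : PT (fun x : ((ℕ × ℕ) × List Op) × List Table × Op => x.1.1.1) :=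
    PT.fst.comp (PT.fst.comp PT.fst)
  have hk : PT (fun x : ((ℕ × ℕ) × List Op) × List Table × Op => x.1.1.2) :=
    PT.snd.comp (PT.fst.comp PT.fst)
  obtain ⟨Ts, hs, ⟨c, hc⟩, -⟩ := pt_exec hn hk (PT.fst.comp PT.snd) (PT.snd.comp PT.snd)
  set D : ((ℕ × ℕ) × List Op) × ℕ → ℕ := fun p =>
    sz p.1 + (sz p.1 * (tableBound p.1.1.1 p.1.1.2 p.2 + 1) + 1 + sz p.1 + 1) + 1 with hD
  have hlen : ∀ a : (ℕ × ℕ) × List Op, a.2.length ≤ sz a := fun a => by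
    have := length_le_sz a.2
    rw [sz_prod]; omega
  have hfold := Comp.foldl (B := fun a => c * D (a, stateBound a.1.1 a.1.2) ^ c) hl hi hs ?_
  · have hPb : Pb (fun p : ((ℕ × ℕ) × List Op) × ℕ => Tl p.1 + Ti p.1 +
        sz p.1 * (c * D p ^ c + 234) + 100) := by
      have h1 : PT (fun p : ((ℕ × ℕ) × List Op) × ℕ => p.1) := PT.fst
      have hn : Pb (fun p : ((ℕ × ℕ) × List Op) × ℕ => p.1.1.1) :=
        (PT.fst.comp (PT.fst.comp h1)).size.mono fun p => by rw [sz_nat]; omega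
      have hk : Pb (fun p : ((ℕ × ℕ) × List Op) × ℕ => p.1.1.2) :=
        (PT.snd.comp (PT.fst.comp h1)).size.mono fun p => by rw [sz_nat]; omega
      have hM : Pb (fun p : ((ℕ × ℕ) × List Op) × ℕ => p.2) :=
        (PT.snd (α := (ℕ × ℕ) × List Op) (β := ℕ)).size.mono fun p => by rw [sz_nat]; omega
      have hc1 : ∀ m : ℕ, Pb (fun _ : ((ℕ × ℕ) × List Op) × ℕ => m) := Pb.const
      have htb : Pb (fun p : ((ℕ × ℕ) × List Op) × ℕ => tableBound p.1.1.1 p.1.1.2 p.2) :=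
        (hM.mul ((((((hc1 4).mul hk).mul ((((hc1 2).mul hn).add ((hc1 16).mul hk)).add
          (hc1 4))).add (hc1 1)).add (hc1 1)))).add (hc1 1)
      have hDb : Pb D := (h1.size.add ((((h1.size.mul (htb.add (hc1 1))).add (hc1 1)).add
        h1.size).add (hc1 1))).add (hc1 1)
      exact (((hTl.comp h1.size).add (hTi.comp h1.size)).add (h1.size.mul
        (((hc1 c).mul (hDb.pow c)).add (hc1 234)))).add (hc1 100)
    obtain ⟨d, hd⟩ := hPb
    refine ⟨_, d, hfold, fun a => ?_⟩
    have h1 := hd (a, stateBound a.1.1 a.1.2)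
    rw [sz_pair, sz_nat] at h1
    refine le_trans ?_ (h1.trans (by rw [show sz a + (2 * stateBound a.1.1 a.1.2 + 1) + 1 =
      sz a + 2 * stateBound a.1.1 a.1.2 + 2 by ring]))
    simp only
    gcongr
    exact hlen a
  · intro a l₁ b l₂ hab
    refine (hc _).trans ?_
    have h1 := sz_foldl_exec_le a.1.1 a.1.2 l₁
    have h2 : l₁.length ≤ sz a := le_trans (by simp [hab]) (hlen a)
    have h3 : sz b ≤ sz a := by
      have : sz b ≤ sz a.2 := sz_le_of_mem (by simp [hab])
      rw [sz_prod a]; omega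
    have h4 : l₁.length * (tableBound a.1.1 a.1.2 (stateBound a.1.1 a.1.2) + 1) ≤
        sz a * (tableBound a.1.1 a.1.2 (stateBound a.1.1 a.1.2) + 1) := Nat.mul_le_mul_right _ h2
    have h5 : sz (a, l₁.foldl (exec a.1.1 a.1.2) [], b) ≤ D (a, stateBound a.1.1 a.1.2) := by
      simp only [sz_pair, hD] at *
      omega
    gcongr

theorem comp_answer : ∃ (T : Input → ℕ) (c : ℕ), Comp answer T ∧
    ∀ x, T x ≤ c * (sz x + 2 * stateBound x.order x.1 + 2) ^ c := by
  obtain ⟨T, c, hT, hc⟩ := comp_run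
  have hord : PT Input.order := (PT.fst.comp PT.snd).length
  have hpre : PT (fun x : Input => ((x.order, x.1), x.2.2.1.ops x.1)) :=
    (hord.pair PT.fst).pair (pt_ops.comp (PT.fst.pair (PT.fst.comp (PT.snd.comp PT.snd))))
  have hpost : PT (fun y : Bool × List Table => y.1 && (y.2.headD []).any fun s => isZero s) :=
    PT.and PT.fst (((PT.snd (α := Bool) (β := List Table)).headD []).any
      (g := fun y : (Bool × List Table) × State => isZero y.2) (pt_isZero PT.snd))
  obtain ⟨Tt, ht, hTt, -⟩ : PT (fun x : Input => decide (2 < x.order)) :=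
    PT.lt (PT.const 2) hord
  obtain ⟨Tp, hp, hTp, hpsz⟩ := hpre
  obtain ⟨Tq, hq, ⟨d, hTq⟩, -⟩ := hpost
  have hcomp := hq.comp (ht.pair (hT.comp hp))
  set D : Input × ℕ → ℕ := fun p => 3 + (sz ((p.1.order, p.1.1), p.1.2.2.1.ops p.1.1) *
    (tableBound p.1.order p.1.1 p.2 + 1) + 1) + 1 with hD
  have hbound : Pb (fun p : Input × ℕ => Tt p.1 + (Tp p.1 +
      c * (sz ((p.1.order, p.1.1), p.1.2.2.1.ops p.1.1) + 2 * p.2 + 2) ^ c) + 10 +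
      d * D p ^ d) := by
    have h1 : PT (fun p : Input × ℕ => p.1) := PT.fst
    have hn : Pb (fun p : Input × ℕ => p.1.order) :=
      (hord.comp h1).size.mono fun p => by rw [sz_nat]; omega
    have hk : Pb (fun p : Input × ℕ => p.1.1) :=
      (PT.fst.comp h1).size.mono fun p => by rw [sz_nat]; omega
    have hM : Pb (fun p : Input × ℕ => p.2) :=
      (PT.snd (α := Input) (β := ℕ)).size.mono fun p => by rw [sz_nat]; omega
    have hc1 : ∀ m : ℕ, Pb (fun _ : Input × ℕ => m) := Pb.const
    have htb : Pb (fun p : Input × ℕ => tableBound p.1.order p.1.1 p.2) :=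
      (hM.mul ((((((hc1 4).mul hk).mul ((((hc1 2).mul hn).add ((hc1 16).mul hk)).add
        (hc1 4))).add (hc1 1)).add (hc1 1)))).add (hc1 1)
    have hpsz' : Pb (fun p : Input × ℕ => sz ((p.1.order, p.1.1), p.1.2.2.1.ops p.1.1)) :=
      hpsz.comp h1.size
    have hDb : Pb D := ((hc1 3).add ((hpsz'.mul (htb.add (hc1 1))).add (hc1 1))).add (hc1 1)
    exact (((hTt.comp h1.size).add ((hTp.comp h1.size).add ((hc1 c).mul
      (((hpsz'.add ((hc1 2).mul hM)).add (hc1 2)).pow c)))).add (hc1 10)).add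
      ((hc1 d).mul (hDb.pow d))
  obtain ⟨e, he⟩ := hbound
  refine ⟨_, e, hcomp, fun x => ?_⟩
  have h1 := he (x, stateBound x.order x.1)
  rw [sz_pair, sz_nat] at h1
  refine le_trans ?_ (h1.trans (by rw [show sz x + (2 * stateBound x.order x.1 + 1) + 1 =
    sz x + 2 * stateBound x.order x.1 + 2 by ring]))
  have h2 := hc ((x.order, x.1), x.2.2.1.ops x.1)
  have h3 := hTq (decide (2 < x.order), (x.2.2.1.ops x.1).foldl (exec x.order x.1) [])
  have h4 : sz (decide (2 < x.order), (x.2.2.1.ops x.1).foldl (exec x.order x.1) []) ≤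
      D (x, stateBound x.order x.1) := by
    have h5 := sz_foldl_exec_le x.order x.1 (x.2.2.1.ops x.1)
    have h6 : (x.2.2.1.ops x.1).length ≤ sz ((x.order, x.1), x.2.2.1.ops x.1) := by
      have := length_le_sz (x.2.2.1.ops x.1)
      rw [sz_pair]; omega
    have h7 := sz_bool (decide (2 < x.order))
    have h8 := Nat.mul_le_mul_right (tableBound x.order x.1 (stateBound x.order x.1) + 1) h6
    rw [sz_pair]
    simp only [hD]
    omega
  have h9 : d * sz (decide (2 < x.order), (x.2.2.1.ops x.1).foldl (exec x.order x.1) []) ^ d ≤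
      d * D (x, stateBound x.order x.1) ^ d := by gcongr
  simp only at h2 h3 ⊢
  omega

end HamDP

namespace HamDP

/-! ## The running time in terms of the numbers of vertices, labels, and operations -/

theorem enc_map {α β : Type} [Enc β] (l : List α) (f : α → β) :
    enc (l.map f) = BTree.ofList (l.map fun a => enc (f a)) := by
  show BTree.ofList ((l.map f).map enc) = _
  rw [List.map_map]; rfl

theorem enc_raw {n k : ℕ} (φ : MultiExpr (Fin n) k) : enc φ.raw = encodeExpr φ := by
  have hl : ∀ S : Finset (Fin k), enc ((S.sort (· ≤ ·)).map fun i : Fin k => (i : ℕ)) =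
      encodeLabels S := by
    intro S
    rw [enc_map, encodeLabels]
    simp only [List.bind_eq_flatMap, List.pure_def, ← List.map_eq_flatMap, List.map_map]
    rfl
  induction φ with
  | introduce v S => rw [MultiExpr.raw, RawExpr.enc_intro, encodeExpr, ← hl]; rfl
  | union a b iha ihb => rw [MultiExpr.raw, RawExpr.enc_union, encodeExpr, ← iha, ← ihb]; rfl
  | join i j a ih => rw [MultiExpr.raw, RawExpr.enc_join, encodeExpr, ← ih]; rfl
  | relabel i S a ih => rw [MultiExpr.raw, RawExpr.enc_relabel, encodeExpr, ← hl, ← ih]; rfl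

open Classical in
/-- The input without types. -/
noncomputable def toInput {n k : ℕ} (G : SimpleGraph (Fin n)) (φ : MultiExpr (Fin n) k) : Input :=
  (k, List.ofFn fun u => List.ofFn fun v => if G.Adj u v then 1 else 0, φ.raw, ())

theorem enc_toInput {n k : ℕ} (G : SimpleGraph (Fin n)) (φ : MultiExpr (Fin n) k) :
    enc (toInput G φ) = encodeInput G φ := by
  classical
  have hG : enc (toInput G φ).2.1 = encodeGraph G := by
    simp only [toInput, encodeGraph, List.ofFn_eq_map]
    rw [enc_map]
    congr 2
    funext u
    rw [enc_map]
    congr 2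
    funext v
    split_ifs <;> rfl
  show BTree.cons (enc k) (.cons (enc (toInput G φ).2.1) (.cons (enc φ.raw) .nil)) = _
  rw [hG, enc_raw]
  rfl

theorem order_toInput {n k : ℕ} (G : SimpleGraph (Fin n)) (φ : MultiExpr (Fin n) k) :
    (toInput G φ).order = n := by simp [toInput, Input.order]

theorem sz_raw_le {n k : ℕ} (φ : MultiExpr (Fin n) k) :
    sz φ.raw ≤ φ.numNodes * (2 * n + 2 * k * k + 5 * k + 30) := by
  have hS : ∀ S : Finset (Fin k), sz ((S.sort (· ≤ ·)).map fun i : Fin k => (i : ℕ)) ≤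
      2 * k * k + k + 1 := by
    intro S
    refine (sz_le_mul (M := 2 * k) fun a ha => ?_).trans ?_
    · obtain ⟨i, -, rfl⟩ := MultiExpr.mem_sort_map.1 ha
      have := i.2
      rw [sz_nat]; omega
    · rw [List.length_map, Finset.length_sort]
      have : S.card ≤ k := by simpa using S.card_le_univ
      calc S.card * (2 * k + 1) + 1 ≤ k * (2 * k + 1) + 1 := by gcongr
        _ = _ := by ring
  induction φ with
  | introduce v S =>
    have := hS S
    have := v.2
    rw [MultiExpr.raw, RawExpr.sz_intro]
    simp only [sz_pair, sz_nat, sz_unit, MultiExpr.numNodes]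
    omega
  | union a b iha ihb =>
    rw [MultiExpr.raw, RawExpr.sz_union]
    simp only [sz_pair, sz_nat, sz_unit, MultiExpr.numNodes, add_mul]
    omega
  | join i j a ih =>
    have := i.2
    have := j.2
    rw [MultiExpr.raw, RawExpr.sz_join]
    simp only [sz_pair, sz_nat, sz_unit, MultiExpr.numNodes, add_mul]
    omega
  | relabel i S a ih =>
    have := hS S
    have := i.2
    rw [MultiExpr.raw, RawExpr.sz_relabel]
    simp only [sz_pair, sz_nat, sz_unit, MultiExpr.numNodes, add_mul]
    omega

theorem numNodes_pos {V : Type} {k : ℕ} (φ : MultiExpr V k) : 1 ≤ φ.numNodes := by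
  cases φ <;> simp [MultiExpr.numNodes]

theorem sz_toInput_le {n k : ℕ} (G : SimpleGraph (Fin n)) (φ : MultiExpr (Fin n) k) (hn : 1 ≤ n)
    (hk : k ≤ n) : sz (toInput G φ) ≤ 53 * φ.numNodes * n ^ 2 := by
  classical
  have hrow : sz (toInput G φ).2.1 ≤ n * (n * 4 + 2) + 1 := by
    refine (sz_le_mul (M := n * 4 + 1) fun r hr => ?_).trans (by simp [toInput])
    obtain ⟨u, rfl⟩ := (List.mem_ofFn' _ _).1 hr
    refine (sz_le_mul (M := 3) fun a ha => ?_).trans (by simp)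
    obtain ⟨v, rfl⟩ := (List.mem_ofFn' _ _).1 ha
    rw [sz_nat]
    beta_reduce
    split_ifs <;> simp
  have hsum : sz (toInput G φ) = 2 * k + 1 + (sz (toInput G φ).2.1 + (sz φ.raw + 1 + 1) + 1) + 1
      := by
    rw [sz_prod (toInput G φ), sz_prod (toInput G φ).2, sz_prod (toInput G φ).2.2, sz_unit]
    simp only [toInput, sz_nat]
  have hraw := sz_raw_le φ
  have hN := numNodes_pos φ
  -- `39 = 2 + 2 + 5 + 30`, by `k ≤ n` and `1 ≤ n`. The matrix, the number `k` and the list cells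
  -- contribute at most `14 * n ^ 2` more, which gives `53`.
  have hW : 2 * n + 2 * k * k + 5 * k + 30 ≤ 39 * n ^ 2 := by nlinarith
  have h1 : sz φ.raw ≤ φ.numNodes * (39 * n ^ 2) := hraw.trans (Nat.mul_le_mul_left _ hW)
  have h2 : n ^ 2 ≤ φ.numNodes * n ^ 2 := Nat.le_mul_of_pos_left _ hN
  rw [hsum]
  nlinarith

/-- The base is at most `2 * n * (9 * n) + 1 ≤ 19 * n ^ 2`. For `2 ≤ n`, the factor `19 ^ (4 * k)`
is absorbed using `19 ≤ n ^ 5`, which gives the exponent `28 * k = 20 * k + 8 * k`. For `n = 1`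
nothing can be absorbed, but then `k = 1` and the factor is the constant `19 ^ 4`. -/
theorem stateBound_le {n k : ℕ} (hn : 1 ≤ n) (hk : k ≤ n) (hk1 : 1 ≤ k) :
    stateBound n k ≤ 19 ^ 4 * n ^ (28 * k) := by
  have h1 : (n + 1) * (8 * k + 1) + 1 ≤ 19 * n ^ 2 := by nlinarith
  have h2 : stateBound n k ≤ 19 ^ (4 * k) * n ^ (8 * k) := by
    refine (Nat.pow_le_pow_left h1 _).trans (le_of_eq ?_)
    rw [mul_pow, ← pow_mul]; ring_nf
  refine h2.trans ?_
  rcases Nat.lt_or_ge 1 n with hn2 | hn2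
  · have h3 : 19 ^ (4 * k) ≤ n ^ (20 * k) := by
      rw [show 20 * k = 5 * (4 * k) by ring, pow_mul n 5]
      refine Nat.pow_le_pow_left ?_ _
      calc 19 ≤ 2 ^ 5 := by norm_num
        _ ≤ n ^ 5 := Nat.pow_le_pow_left hn2 5
    calc 19 ^ (4 * k) * n ^ (8 * k) ≤ n ^ (20 * k) * n ^ (8 * k) := by gcongr
      _ = n ^ (28 * k) := by rw [← pow_add]; ring_nf
      _ ≤ _ := Nat.le_mul_of_pos_left _ (by norm_num)
  · obtain rfl : n = 1 := by omega
    obtain rfl : k = 1 := by omega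
    norm_num

theorem size_bound {n k : ℕ} (G : SimpleGraph (Fin n)) (φ : MultiExpr (Fin n) k) (hn : 1 ≤ n)
    (hk : k ≤ n) (hk1 : 1 ≤ k) : sz (toInput G φ) + 2 * stateBound n k + 2 ≤
      (55 + 2 * 19 ^ 4) * φ.numNodes * n ^ (28 * k) := by
  have h1 := sz_toInput_le G φ hn hk
  have h2 := stateBound_le hn hk hk1
  have hN := numNodes_pos φ
  have h3 : n ^ 2 ≤ n ^ (28 * k) := Nat.pow_le_pow_right hn (by omega)
  have h4 : n ^ (28 * k) ≤ φ.numNodes * n ^ (28 * k) := Nat.le_mul_of_pos_left _ hN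
  have h5 : 1 ≤ n ^ (28 * k) := Nat.one_le_pow _ _ hn
  have h6 : φ.numNodes * n ^ 2 ≤ φ.numNodes * n ^ (28 * k) := Nat.mul_le_mul_left _ h3
  nlinarith

/-- A single constant has to serve as factor, as exponent of `N` and as coefficient of `k`; it
dominates `c * K ^ c`, `c` and `28 * c`. -/
theorem time_bound {c K N n k : ℕ} (hK : 1 ≤ K) (hN : 1 ≤ N) (hn : 1 ≤ n) :
    c * (K * N * n ^ (28 * k)) ^ c ≤
      (c * K ^ c + 28 * c) * N ^ (c * K ^ c + 28 * c) * n ^ ((c * K ^ c + 28 * c) * k) := by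
  have h1 : c * (K * N * n ^ (28 * k)) ^ c = c * K ^ c * N ^ c * n ^ (28 * c * k) := by
    rw [mul_pow, mul_pow, ← pow_mul]; ring_nf
  rw [h1]
  gcongr <;> first | assumption | omega

/-- Nonempty label sets at introduced vertices force `1 ≤ k`, hence `1 ≤ n`. Without this, `n ^ (c *
k)` could not absorb the polynomial factors in `n`. -/
theorem label_pos {n k : ℕ} {φ : MultiExpr (Fin n) k} (h : φ.WellFormed) : 1 ≤ k := by
  induction φ with
  | introduce v S => obtain ⟨i, -⟩ := h; have := i.2; omega
  | union a b iha _ => exact iha h.1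
  | join i j a ih => exact ih h.1
  | relabel i S a ih => exact ih h

end HamDP

/-! ### The main theorem -/

theorem theorem2 :
    ∃ (p : WhileLang.Program) (c : ℕ), ∀ (n k : ℕ) (G : SimpleGraph (Fin n))
      (φ : MultiExpr (Fin n) k), φ.IsExpressionOf G → k ≤ n →
        p.DecidesWithin (encodeInput G φ)
          (∃ (a : Fin n) (w : G.Walk a a), w.IsHamiltonianCycle)
          (c * φ.numNodes ^ c * n ^ (c * k)) := by
  obtain ⟨T, c, ⟨p, m, hp⟩, hT⟩ := HamDP.comp_answer
  -- The constant of `time_bound`, with `K` the factor in `size_bound`.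
  refine ⟨p, c * (55 + 2 * 19 ^ 4) ^ c + 28 * c, fun n k G φ hφ hk => ?_⟩
  have hk1 := HamDP.label_pos hφ.1
  obtain ⟨s, t, hrun, hs, -, ht⟩ := hp (HamDP.toInput G φ) (initStore (encodeInput G φ))
    (by rw [HamDP.enc_toInput]; rfl)
  refine ⟨s, t, hrun, ht.trans ((hT _).trans ?_), ?_⟩
  · rw [HamDP.order_toInput]
    refine le_trans ?_ (HamDP.time_bound (by norm_num) (HamDP.numNodes_pos φ) (hk1.trans hk))
    gcongr
    exact HamDP.size_bound G φ (hk1.trans hk) hk hk1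
  · rw [hs, ← MultiExpr.exists_isZero_tab_iff hφ, HamDP.answer_eq, HamDP.order_toInput]
    show enc (decide (2 < n) && (HamDP.tab n k φ.raw).any fun s => HamDP.isZero s) ≠ .nil ↔ _
    rw [← List.any_eq_true]
    by_cases hn : 2 < n <;>
      cases h : (HamDP.tab n k φ.raw).any fun s => HamDP.isZero s <;> simp [hn, h]
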